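/- Let $D\ge 0$ be an integer. Let $p,\sigma$ be measurable functions such that $p$ is a probability density supported on $[0,1]^{1+D}$, $p$ and $\sigma$ are positive on $[0,1]^{1+D}$ with $|\ln p|$ and $|\ln\sigma|$ bounded there, and $\mathcal I(x):=\int_{[0,1]^D}p(x,\mathbf z)\,\sigma^{-2}(x,\mathbf z)\,d\mathbf z$ is Riemann integrable on $[0,1]$. Let $g:\mathbb R^D\to\mathbb R$ be measurable. Let $(X_l,\mathbf Z_l,Y_l)$, $l=1,\dots,n$, be i.i.d. observations from $$Y=f(X)+g(\mathbf Z)+\sigma(X,\mathbf Z)\,\varepsilon ,$$ where $(X,\mathbf Z)$ has density $p$ and $\varepsilon$ is standard normal and independent of $(X,\mathbf Z)$. (The case $g=0$ is the pivotal model $Y=f(X)+\sigma(X,\mathbf Z)\varepsilon$; the additive model, in which $g$ integrates to zero on $[0,1]^D$, is also included.) Let $\varphi_0=1$ and $\varphi_j(x)=\sqrt2\cos(\pi jx)$ for $j\ge1$. Let $\alpha\ge1$ and $Q\ge0$ be real numbers, and let $f_0$ (the pivot) be a bounded, square integrable function on $[0,1]$. Let $M_n\in\{0,1,2,\dots\}$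 and $\rho_n\in[0,\infty]$ be sequences such that, for all sufficiently large $n$, $$M_n<\frac{n^{1/(2\alpha+1)}}{\ln^2 n},\qquad \rho_n>n^{-1/(2\alpha+1)}\ln n .$$ Let $\mathcal F(f_0,\rho_n,M_n,\alpha,Q)$ be the class of functions $f$ on $[0,1]$ of the form $$f(x)=\sum_{0\le j<M_n}\Big(\int_0^1f_0(u)\varphi_j(u)\,du\Big)\varphi_j(x)+\sum_{j\ge M_n}\theta_j\varphi_j(x),\qquad \theta_j=\int_0^1f(u)\varphi_j(u)\,du,$$ with $$\sum_{j\ge M_n}\big[1+(\pi j)^{2\alpha}\big]\theta_j^2\le Q,\qquad \sup_{x\in[0,1]}\Big|\sum_{j\ge M_n}\theta_j\varphi_j(x)\Big|<\rho_n .$$ Then there is a sequence $o_n(1)\to0$ such that for every $n\ge1$ $$\inf_{\tilde f^*}\ \sup_{f\in\mathcal F(f_0,\rho_n,M_n,\alpha,Q)}E\Big\{\int_0^1\big[\tilde f^*(x)-f(x)\big]^2dx\Big\}\ \ge\ P(\alpha,Q)\,\Big(\frac dn\Big)^{2\alpha/(2\alpha+1)}\big(1+o_n(1)\big),$$ where $$P(\alpha,Q)=\Big[\frac{\alpha}{\pi(\alpha+1)}\Big]^{2\alpha/(2\alpha+1)}\big[Q(2\alpha+1)\big]^{1/(2\alpha+1)},\qquad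 d=\int_0^1\frac{dx}{\int_{[0,1]^D}p(x,\mathbf z)\,\sigma^{-2}(x,\mathbf z)\,d\mathbf z},$$ and the infimum is over all dealer-estimators, that is, all jointly measurable functions $\tilde f^*$ of $x$ and of the sample $(X_l,\mathbf Z_l,Y_l)_{l\le n}$, which may depend in any way on $n$, $f_0$, $g$, $p$, $\sigma$, $\rho_n$, $M_n$, $\alpha$ and $Q$ (everything except $f$). -/

import Mathlib

open MeasureTheory ProbabilityTheory Filter Topology
open scoped ENNReal

noncomputable section

namespace ScaleRegression

/-- The cosine basis of `L²[0,1]`: `φ₀ = 1` and `φⱼ(x) = √2 cos(π j x)` for `j ≥ 1`. -/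
def cosBasis (j : ℕ) (x : ℝ) : ℝ :=
  if j = 0 then 1 else Real.sqrt 2 * Real.cos (Real.pi * j * x)

/-- Fourier coefficient `∫₀¹ f(u) φⱼ(u) du`. -/
def cosCoef (f : ℝ → ℝ) (j : ℕ) : ℝ :=
  ∫ u in (0 : ℝ)..1, f u * cosBasis j u

/-- The class of regression functions `𝓕(f₀, ρ, M, α, Q)` for one sample size. Only the values of
`f` on `[0,1]` matter. The members agree with the pivot `f₀` on the frequencies below `M`; their
remaining part lies in a Sobolev ball and has sup-norm on `[0,1]` less than `ρ`, where `ρ = ∞` is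
allowed. -/
def pivotClass (f₀ : ℝ → ℝ) (ρ : ℝ≥0∞) (M : ℕ) (α Q : ℝ) : Set (ℝ → ℝ) :=
  {f | (∀ x ∈ Set.Icc (0 : ℝ) 1,
          HasSum (fun j => (if j < M then cosCoef f₀ j else cosCoef f j) * cosBasis j x) (f x)) ∧
       Summable (fun k : ℕ =>
          (1 + (Real.pi * ((M + k : ℕ) : ℝ)) ^ (2 * α)) * cosCoef f (M + k) ^ 2) ∧
       ∑' k : ℕ, (1 + (Real.pi * ((M + k : ℕ) : ℝ)) ^ (2 * α)) * cosCoef f (M + k) ^ 2 ≤ Q ∧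
       (⨆ x ∈ Set.Icc (0 : ℝ) 1,
          ENNReal.ofReal |∑' k : ℕ, cosCoef f (M + k) * cosBasis (M + k) x|) < ρ}

/-- The Pinsker constant
`P(α,Q) = [α / (π(α+1))]^{2α/(2α+1)} [Q(2α+1)]^{1/(2α+1)}`. -/
def pinskerConst (α Q : ℝ) : ℝ :=
  (α / (Real.pi * (α + 1))) ^ (2 * α / (2 * α + 1)) *
    (Q * (2 * α + 1)) ^ (1 / (2 * α + 1))

/-- `𝓘(x) = ∫_{[0,1]^D} p(x,z) σ⁻²(x,z) dz`. -/
def designInfo {D : ℕ} (p σ : ℝ → (Fin D → ℝ) → ℝ) (x : ℝ) : ℝ :=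
  ∫ z in Set.Icc (0 : Fin D → ℝ) 1, p x z / σ x z ^ 2

/-- The coefficient of difficulty `d(p,σ) = ∫₀¹ dx / 𝓘(x)`. -/
def difficulty {D : ℕ} (p σ : ℝ → (Fin D → ℝ) → ℝ) : ℝ :=
  ∫ x in (0 : ℝ)..1, 1 / designInfo p σ x

/-- Riemann integrability on `[0,1]`: the Riemann sums over tagged partitions
`0 = t₀ ≤ t₁ ≤ ⋯ ≤ t_N = 1` with tags `ξₖ ∈ [tₖ, tₖ₊₁]` converge as the mesh tends to `0`. -/
def RiemannIntegrableUnit (h : ℝ → ℝ) : Prop :=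
  ∃ L : ℝ, ∀ ε > 0, ∃ δ > 0, ∀ (N : ℕ) (t ξ : ℕ → ℝ),
    t 0 = 0 → t N = 1 →
    (∀ k < N, t k ≤ ξ k ∧ ξ k ≤ t (k + 1) ∧ t (k + 1) - t k < δ) →
    |∑ k ∈ Finset.range N, h (ξ k) * (t (k + 1) - t k) - L| < ε

/-- Assumptions on the nuisance functions: `p` is a probability density supported on
`[0,1]^{1+D}`, the functions `|ln p|` and `|ln σ|` are bounded on `[0,1]^{1+D}` (in particular
`p` and `σ` are positive there), and `𝓘` is Riemann integrable on `[0,1]`. -/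
structure RegularDesign {D : ℕ} (p σ : ℝ → (Fin D → ℝ) → ℝ) : Prop where
  measurable_density : Measurable (Function.uncurry p)
  measurable_scale : Measurable (Function.uncurry σ)
  support_density : ∀ x z, ¬ (x ∈ Set.Icc (0 : ℝ) 1 ∧ z ∈ Set.Icc (0 : Fin D → ℝ) 1) → p x z = 0
  integral_density : ∫ v : ℝ × (Fin D → ℝ), p v.1 v.2 = 1
  log_bounded : ∃ B : ℝ, ∀ x ∈ Set.Icc (0 : ℝ) 1, ∀ z ∈ Set.Icc (0 : Fin D → ℝ) 1,
    0 < p x z ∧ 0 < σ x z ∧ max |Real.log (p x z)| |Real.log (σ x z)| ≤ B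
  riemann_info : RiemannIntegrableUnit (designInfo p σ)

/-- The law of the covariates `(X, Z)`, with density `p`. -/
def designLaw {D : ℕ} (p : ℝ → (Fin D → ℝ) → ℝ) : Measure (ℝ × (Fin D → ℝ)) :=
  volume.withDensity (fun v => ENNReal.ofReal (p v.1 v.2))

/-- The joint law of `((Xₗ, Zₗ), εₗ)`, `l = 1, …, n`: independent copies of `((X, Z), ε)`, where
`(X, Z)` has density `p` and `ε` is standard normal and independent of `(X, Z)`. -/
def sourceLaw {D : ℕ} (p : ℝ → (Fin D → ℝ) → ℝ) (n : ℕ) :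
    Measure (Fin n → (ℝ × (Fin D → ℝ)) × ℝ) :=
  Measure.pi fun _ => (designLaw p).prod (gaussianReal 0 1)

/-- The sample `((Xₗ, Zₗ), Yₗ)`, `l = 1, …, n`, with `Yₗ = f(Xₗ) + g(Zₗ) + σ(Xₗ,Zₗ) εₗ`. -/
def sample {D : ℕ} (f : ℝ → ℝ) (g : (Fin D → ℝ) → ℝ) (σ : ℝ → (Fin D → ℝ) → ℝ) {n : ℕ}
    (ω : Fin n → (ℝ × (Fin D → ℝ)) × ℝ) : Fin n → (ℝ × (Fin D → ℝ)) × ℝ :=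
  fun l => ((ω l).1, f (ω l).1.1 + g (ω l).1.2 + σ (ω l).1.1 (ω l).1.2 * (ω l).2)

/-- The mean integrated squared error `E ∫₀¹ [f̃(x) - f(x)]² dx` of the estimator `est`, which
maps a sample and a point `x` to `f̃(x)`. -/
def mise {D : ℕ} (f : ℝ → ℝ) (g : (Fin D → ℝ) → ℝ) (p σ : ℝ → (Fin D → ℝ) → ℝ) {n : ℕ}
    (est : (Fin n → (ℝ × (Fin D → ℝ)) × ℝ) → ℝ → ℝ) : ℝ≥0∞ :=
  ∫⁻ ω, ∫⁻ x in Set.Icc (0 : ℝ) 1,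
    ENNReal.ofReal ((est (sample f g σ ω) x - f x) ^ 2) ∂volume ∂(sourceLaw p n)

/-- The minimax MISE over a class `F` for dealer-estimators based on `n` observations. The
estimator is chosen when `F` (hence the pivot and all parameters), `g`, `p` and `σ` are already
fixed, so it may depend on all of them in any way; it ranges over all jointly measurable
functions of the sample and the point. -/
def dealerMinimaxRisk {D : ℕ} (F : Set (ℝ → ℝ)) (g : (Fin D → ℝ) → ℝ)
    (p σ : ℝ → (Fin D → ℝ) → ℝ) (n : ℕ) : ℝ≥0∞ :=
  ⨅ (est : (Fin n → (ℝ × (Fin D → ℝ)) × ℝ) → ℝ → ℝ)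
    (_ : Measurable (Function.uncurry est)), ⨆ f ∈ F, mise f g p σ est

end ScaleRegression

end

/-! A minimax risk is at least the Bayes risk of any prior carried by the class, so it suffices to
find a prior with the right Bayes risk. The prior is Gaussian: the pivot below frequency `M` plus u
· ∑ ζⱼ √λⱼ φⱼ, with independent standard normal ζⱼ, frequencies j running from ηK to K ≈ κ
n^{1/(2α+1)}, and λⱼ = ((K/j)^α - 1)/n as in Pinsker's theorem. The modulating function u is a
polynomial in cos(πx) with u² ≈ 1/𝓘. Since 𝓘u² ≈ 1, the design and the noise level act on the draws
as if both were constant, while squared errors and Sobolev energies are multiplied by ∫u² ≈ d; this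
is how d enters the bound. A polynomial of degree m moves a frequency by at most m, so the draws are
finite cosine sums with all frequencies above `M` and nearly unchanged Sobolev weights.

The Bayes risk is bounded without computing a posterior. Given the design points and x, the prior
variables and the noise form one standard Gaussian vector z, the estimand is affine in z, and there
are directions a along which z can be moved without changing the sample. The reflection reversing a
preserves the law of z and the sample but moves the estimand, so the risk is at least 2 a·e - |a|²
(`lintegral_sq_sub_dot_ge`). This expression can be averaged exactly over the design
(`lintegral_mise_ge`), and the shrinkage factors 1/(1+nλⱼ) turn it into ∫u² · ∑ λⱼ/(1+nλⱼ), up to an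
error caused by the excess of 𝓘u² over 1 (`bayes_bound_ge`).

A draw may fall outside the class. Replacing wild estimates by the pivot part costs nothing on the
good event and bounds the loss off it (`bayes_le_dealerMinimaxRisk`). The bad event is rare: the
mean Sobolev energy is kept below (1 - b/2)Q and Chebyshev's inequality applies
(`gaussPi_quadratic_tail`); the sup-norm is controlled on a grid by Gaussian tails
(`gaussPi_grid_tail`) and between grid points by a Lipschitz bound, which needs α ≥ 1.

Finally κ is chosen to use up the energy (1 - b)Q. As b, η and the approximation error tend to 0
together, the constant of the bound converges to P(α,Q) d^{2α/(2α+1)} (`cutoffFactor_zero_mul`,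
`continuousAt_bayesConst`). -/

noncomputable section

namespace ScaleRegression

/-! ### Standard Gaussian vectors: moments, tails, reflections -/

section Gaussian

variable {κ : Type*} [Fintype κ]

/-- The law of a family of independent standard normal variables. -/
abbrev gaussPi (κ : Type*) [Fintype κ] : Measure (κ → ℝ) :=
  Measure.pi fun _ => gaussianReal 0 1

@[fun_prop]
theorem measurable_dot (a : κ → ℝ) : Measurable fun z : κ → ℝ => ∑ i, a i * z i :=
  Finset.measurable_sum _ fun i _ => (measurable_pi_apply i).const_mul _

theorem gaussPi_map_dot (a : κ → ℝ) :
    (gaussPi κ).map (fun z => ∑ i, a i * z i) = gaussianReal 0 (Real.toNNReal (∑ i, a i ^ 2)) := by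
  apply Measure.ext_of_charFun
  ext t
  have h1 : charFun ((gaussPi κ).map (fun z => ∑ i, a i * z i)) t
      = charFun ((gaussPi κ).map (WithLp.toLp 2)) (WithLp.toLp 2 (fun i => t * a i)) := by
    rw [charFun_apply, charFun_apply, integral_map (measurable_dot a).aemeasurable (by fun_prop),
      integral_map (by fun_prop) (by fun_prop)]
    congr 1
    ext z
    congr 3
    simp only [PiLp.inner_apply, RCLike.inner_apply, conj_trivial, Finset.mul_sum]
    exact Finset.sum_congr rfl fun i _ => by ring
  rw [h1, map_pi_eq_stdGaussian, charFun_stdGaussian, charFun_gaussianReal,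
    ← Complex.ofReal_pow, EuclideanSpace.real_norm_sq_eq]
  congr 1
  have h0 : 0 ≤ ∑ i, a i ^ 2 := Finset.sum_nonneg fun i _ => sq_nonneg _
  simp only [mul_pow, ← Finset.mul_sum, Real.coe_toNNReal _ h0]
  push_cast
  ring

theorem integral_pow_four_gaussianReal : ∫ x, x ^ 4 ∂(gaussianReal 0 1) = 3 := by
  have h := iteratedDeriv_mgf_zero (X := id) (μ := gaussianReal 0 1)
    (by rw [integrableExpSet_id_gaussianReal]; simp) 4
  -- The moment is the fourth derivative at 0 of exp(t²/2). Each differentiation keeps the form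
  -- polynomial times exp(t²/2) and sends p to p' + t p.
  have key : ∀ p p' : ℝ → ℝ, (∀ t, HasDerivAt p (p' t) t) →
      deriv (fun t : ℝ => p t * Real.exp (t ^ 2 / 2)) =
        fun t => (p' t + t * p t) * Real.exp (t ^ 2 / 2) := by
    intro p p' hp
    ext t
    have h2 : HasDerivAt (fun t : ℝ => t ^ 2 / 2) t t := by
      have := (hasDerivAt_pow 2 t).div_const 2
      simpa using this
    exact ((hp t).mul h2.exp).deriv.trans (by ring)
  have e0 : mgf id (gaussianReal 0 1) = fun t : ℝ => 1 * Real.exp (t ^ 2 / 2) := by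
    rw [mgf_id_gaussianReal]; ext t; simp
  rw [e0, iteratedDeriv_eq_iterate] at h
  simp only [Function.iterate_succ, Function.iterate_zero, Function.comp_apply, id] at h
  rw [key (fun _ => 1) (fun _ => 0) (fun t => hasDerivAt_const t 1)] at h
  rw [key (fun t => 0 + t * 1) (fun _ => 1) (fun t => by simpa using hasDerivAt_id' t)] at h
  rw [key (fun t => 1 + t * (0 + t * 1)) (fun t => 2 * t) (fun t => by
    have := (hasDerivAt_pow 2 t).const_add 1
    convert! this using 1
    · ext x; ring
    · simp)] at h
  rw [key (fun t => 2 * t + t * (1 + t * (0 + t * 1))) (fun t => 3 + 3 * t ^ 2) (fun t => by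
    have := ((hasDerivAt_id t).const_mul 3).add (hasDerivAt_pow 3 t)
    convert! this using 1
    · ext x; simp; ring
    · simp)] at h
  simpa using h.symm

theorem memLp_dot (a : κ → ℝ) (p : ℝ≥0∞) (hp : p ≠ ∞) :
    MemLp (fun z => ∑ i, a i * z i) p (gaussPi κ) := by
  have h := memLp_id_gaussianReal' (μ := 0) (v := Real.toNNReal (∑ i, a i ^ 2)) p hp
  rw [← gaussPi_map_dot a] at h
  exact h.comp_of_map (measurable_dot a).aemeasurable

theorem integrable_dot_pow (a : κ → ℝ) (k : ℕ) :
    Integrable (fun z => (∑ i, a i * z i) ^ k) (gaussPi κ) := by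
  rcases Nat.eq_zero_or_pos k with rfl | hk
  · simp
  have := (memLp_dot a k (by simp)).integrable_norm_pow hk.ne'
  refine this.mono' ((measurable_dot a).pow_const k).aestronglyMeasurable (Eventually.of_forall fun z => by simp)

theorem integral_dot_pow (a : κ → ℝ) (k : ℕ) :
    ∫ z, (∑ i, a i * z i) ^ k ∂(gaussPi κ)
      = (√(∑ i, a i ^ 2)) ^ k * ∫ x, x ^ k ∂(gaussianReal 0 1) := by
  have h1 : ∫ z, (∑ i, a i * z i) ^ k ∂(gaussPi κ)
      = ∫ x, x ^ k ∂((gaussPi κ).map (fun z => ∑ i, a i * z i)) := by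
    rw [integral_map (measurable_dot a).aemeasurable (by fun_prop)]
  have h2 : gaussianReal 0 (Real.toNNReal (∑ i, a i ^ 2))
      = (gaussianReal 0 1).map (fun x => √(∑ i, a i ^ 2) * x) := by
    rw [gaussianReal_map_const_mul]
    congr 1
    · simp
    · ext
      simp [Real.sq_sqrt, Finset.sum_nonneg, sq_nonneg]
  rw [h1, gaussPi_map_dot, h2, integral_map (by fun_prop) (by fun_prop)]
  simp_rw [mul_pow]
  rw [integral_const_mul]

theorem integral_dot_sq (a : κ → ℝ) :
    ∫ z, (∑ i, a i * z i) ^ 2 ∂(gaussPi κ) = ∑ i, a i ^ 2 := by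
  have h0 : 0 ≤ ∑ i, a i ^ 2 := Finset.sum_nonneg fun i _ => sq_nonneg _
  rw [integral_dot_pow, Real.sq_sqrt h0]
  have h := variance_id_gaussianReal (μ := 0) (v := 1)
  rw [variance_eq_sub (memLp_id_gaussianReal 2)] at h
  simp [integral_id_gaussianReal] at h
  rw [h, mul_one]

theorem integral_dot_pow_four (a : κ → ℝ) :
    ∫ z, (∑ i, a i * z i) ^ 4 ∂(gaussPi κ) = 3 * (∑ i, a i ^ 2) ^ 2 := by
  have h0 : 0 ≤ ∑ i, a i ^ 2 := Finset.sum_nonneg fun i _ => sq_nonneg _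
  rw [integral_dot_pow, integral_pow_four_gaussianReal, show 4 = 2 * 2 from rfl, pow_mul,
    Real.sq_sqrt h0]
  ring

theorem integrable_dot_sq_mul_dot_sq (a b : κ → ℝ) :
    Integrable (fun z => (∑ i, a i * z i) ^ 2 * (∑ i, b i * z i) ^ 2) (gaussPi κ) := by
  refine ((integrable_dot_pow a 4).add (integrable_dot_pow b 4)).mono' (by fun_prop)
    (Eventually.of_forall fun z => ?_)
  rw [Real.norm_eq_abs, abs_of_nonneg (by positivity)]
  simp only [Pi.add_apply]
  nlinarith [sq_nonneg ((∑ i, a i * z i) ^ 2 - (∑ i, b i * z i) ^ 2),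
    sq_nonneg ((∑ i, a i * z i) ^ 2), sq_nonneg ((∑ i, b i * z i) ^ 2)]

/-- Isserlis' formula for squares of two jointly Gaussian variables. -/
theorem integral_dot_sq_mul_dot_sq (a b : κ → ℝ) :
    ∫ z, (∑ i, a i * z i) ^ 2 * (∑ i, b i * z i) ^ 2 ∂(gaussPi κ)
      = (∑ i, a i ^ 2) * (∑ i, b i ^ 2) + 2 * (∑ i, a i * b i) ^ 2 := by
  have hab := integral_dot_pow_four (fun i => a i + b i)
  have hab' := integral_dot_pow_four (fun i => a i - b i)
  have ha := integral_dot_pow_four a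
  have hb := integral_dot_pow_four b
  -- Polarization: 12 A²B² = (A+B)⁴ + (A-B)⁴ - 2A⁴ - 2B⁴ reduces the mixed moment to fourth moments
  -- of single linear forms.
  have h : ∀ z : κ → ℝ, (∑ i, a i * z i) ^ 2 * (∑ i, b i * z i) ^ 2 =
      (1 / 12) * ((∑ i, (a i + b i) * z i) ^ 4 + (∑ i, (a i - b i) * z i) ^ 4
        - 2 * (∑ i, a i * z i) ^ 4 - 2 * (∑ i, b i * z i) ^ 4) := by
    intro z
    simp only [add_mul, sub_mul, Finset.sum_add_distrib, Finset.sum_sub_distrib]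
    ring
  simp_rw [h]
  have i1 := integrable_dot_pow (fun i => a i + b i) 4
  have i2 := integrable_dot_pow (fun i => a i - b i) 4
  have i3 := (integrable_dot_pow a 4).const_mul 2
  have i4 := (integrable_dot_pow b 4).const_mul 2
  rw [integral_const_mul, integral_sub (by exact (i1.add i2).sub i3) i4,
    integral_sub (by exact i1.add i2) i3, integral_add i1 i2, integral_const_mul, integral_const_mul, hab, hab', ha, hb]
  have s1 : ∑ i, (a i + b i) ^ 2 = ∑ i, a i ^ 2 + 2 * ∑ i, a i * b i + ∑ i, b i ^ 2 := by
    rw [Finset.mul_sum, ← Finset.sum_add_distrib, ← Finset.sum_add_distrib]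
    exact Finset.sum_congr rfl fun i _ => by ring
  have s2 : ∑ i, (a i - b i) ^ 2 = ∑ i, a i ^ 2 - 2 * ∑ i, a i * b i + ∑ i, b i ^ 2 := by
    rw [Finset.mul_sum, ← Finset.sum_sub_distrib, ← Finset.sum_add_distrib]
    exact Finset.sum_congr rfl fun i _ => by ring
  rw [s1, s2]
  ring

theorem gaussPi_dot_tail (a : κ → ℝ) {v t : ℝ} (ht : 0 ≤ t) (hv : ∑ i, a i ^ 2 ≤ v) (hv0 : 0 < v) :
    (gaussPi κ).real {z | t ≤ |∑ i, a i * z i|} ≤ 2 * Real.exp (-t ^ 2 / (2 * v)) := by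
  have one : ∀ a : κ → ℝ, ∑ i, a i ^ 2 ≤ v →
      (gaussPi κ).real {z | t ≤ ∑ i, a i * z i} ≤ Real.exp (-t ^ 2 / (2 * v)) := by
    intro a hv
    have h : HasSubgaussianMGF (fun z : κ → ℝ => ∑ i, a i * z i) (Real.toNNReal v) (gaussPi κ) := by
      have hm : ∀ s, mgf (fun z : κ → ℝ => ∑ i, a i * z i) (gaussPi κ) s
          = Real.exp (0 * s + (Real.toNNReal (∑ i, a i ^ 2)) * s ^ 2 / 2) :=
        mgf_gaussianReal (gaussPi_map_dot a)
      refine ⟨fun s => ?_, fun s => ?_⟩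
      · have := integrable_exp_mul_gaussianReal (μ := 0)
          (v := Real.toNNReal (∑ i, a i ^ 2)) s
        rw [← gaussPi_map_dot a] at this
        exact this.comp_measurable (measurable_dot a)
      · rw [hm]
        gcongr
        simp only [zero_mul, zero_add]
        gcongr
    have := h.measure_ge_le ht
    rwa [Real.coe_toNNReal _ hv0.le] at this
  have hsub : {z : κ → ℝ | t ≤ |∑ i, a i * z i|} ⊆
      {z | t ≤ ∑ i, a i * z i} ∪ {z | t ≤ ∑ i, (-a i) * z i} := by
    intro z hz
    simp only [Set.mem_ofPred_eq, neg_mul, Finset.sum_neg_distrib, Set.mem_union] at hz ⊢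
    exact le_abs.1 hz
  calc _ ≤ _ := measureReal_mono hsub
    _ ≤ _ := measureReal_union_le _ _
    _ ≤ _ := by
      rw [two_mul]
      exact add_le_add (one a hv) (one _ (by simpa using hv))

/-- Reflections preserve the standard Gaussian law. -/
theorem measurePreserving_reflect (a : κ → ℝ) :
    MeasurePreserving (fun (z : κ → ℝ) i => z i - 2 * (∑ j, a j * z j) / (∑ j, a j ^ 2) * a i)
      (gaussPi κ) (gaussPi κ) := by
  have m1 : MeasurePreserving (WithLp.toLp 2 : (κ → ℝ) → EuclideanSpace ℝ κ) (gaussPi κ)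
      (stdGaussian (EuclideanSpace ℝ κ)) := ⟨by fun_prop, map_pi_eq_stdGaussian⟩
  have m3 : MeasurePreserving (WithLp.ofLp : EuclideanSpace ℝ κ → (κ → ℝ))
      (stdGaussian (EuclideanSpace ℝ κ)) (gaussPi κ) := by
    refine ⟨by fun_prop, ?_⟩
    rw [← map_pi_eq_stdGaussian, Measure.map_map (by fun_prop) (by fun_prop)]
    exact Measure.map_id
  let v : EuclideanSpace ℝ κ := WithLp.toLp 2 a
  have m2 : MeasurePreserving ((ℝ ∙ v)ᗮ.reflection) (stdGaussian (EuclideanSpace ℝ κ))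
      (stdGaussian (EuclideanSpace ℝ κ)) :=
    ⟨(LinearIsometryEquiv.continuous _).measurable, stdGaussian_map _⟩
  convert! m3.comp (m2.comp m1) using 1
  ext z i
  simp only [Function.comp_apply, Submodule.reflection_orthogonal_apply,
    Submodule.reflection_singleton_apply, v]
  simp [EuclideanSpace.real_norm_sq_eq, PiLp.inner_apply, mul_comm]
  ring

/-- A statistic that does not vary in the direction `a` cannot predict `e · z` well. -/
theorem lintegral_sq_sub_dot_ge (T : (κ → ℝ) → ℝ) (hT : Measurable T) (a e : κ → ℝ)
    (hinv : ∀ z s, T (fun i => z i + s * a i) = T z) :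
    ENNReal.ofReal (2 * ∑ i, a i * e i - ∑ i, a i ^ 2)
      ≤ ∫⁻ z, ENNReal.ofReal ((T z - ∑ i, z i * e i) ^ 2) ∂(gaussPi κ) := by
  set A := ∑ i, a i ^ 2 with hA
  set B := ∑ i, a i * e i with hB
  have hA0 : 0 ≤ A := Finset.sum_nonneg fun i _ => sq_nonneg _
  rcases hA0.eq_or_lt with h0 | hpos
  · have ha : ∀ i, a i = 0 := fun i => by
      have := (Finset.sum_eq_zero_iff_of_nonneg (fun i _ => sq_nonneg (a i))).1 h0.symm i
        (Finset.mem_univ i)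
      simpa using this
    have hB0 : B = 0 := by simp [hB, ha]
    simp [hB0, ← h0]
  set R : (κ → ℝ) → (κ → ℝ) := fun z i => z i - 2 * (∑ j, a j * z j) / A * a i with hR
  have hmp : MeasurePreserving R (gaussPi κ) (gaussPi κ) := measurePreserving_reflect a
  have hm : Measurable fun z : κ → ℝ => ENNReal.ofReal ((T z - ∑ i, z i * e i) ^ 2) := by fun_prop
  have hTR : ∀ z, T (R z) = T z := fun z => by
    rw [← hinv z (-(2 * (∑ j, a j * z j) / A))]
    congr 1; ext i; simp only [hR]; ring
  have hFR : ∀ z, ∑ i, R z i * e i = ∑ i, z i * e i - 2 * (∑ j, a j * z j) / A * B := by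
    intro z
    simp only [hR, sub_mul, Finset.sum_sub_distrib, hB]
    congr 1
    rw [Finset.mul_sum _ _ (2 * (∑ j, a j * z j) / A)]
    exact Finset.sum_congr rfl fun i _ => by ring
  -- Averaging the risk over z and its mirror image: `T` takes the same value at both, so it cannot
  -- be close to both values of the estimand.
  have h2 : 2 * ∫⁻ z, ENNReal.ofReal ((T z - ∑ i, z i * e i) ^ 2) ∂(gaussPi κ)
      = ∫⁻ z, (ENNReal.ofReal ((T z - ∑ i, z i * e i) ^ 2)
        + ENNReal.ofReal ((T (R z) - ∑ i, R z i * e i) ^ 2)) ∂(gaussPi κ) := by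
    rw [lintegral_add_left hm, two_mul]
    congr 1
    exact (hmp.lintegral_comp hm).symm
  have h3 : 2 * ENNReal.ofReal (B ^ 2 / A) ≤
      2 * ∫⁻ z, ENNReal.ofReal ((T z - ∑ i, z i * e i) ^ 2) ∂(gaussPi κ) := by
    rw [h2]
    have h4 : 2 * ENNReal.ofReal (B ^ 2 / A) = ∫⁻ z, ENNReal.ofReal
        (2 * (B / A) ^ 2 * (∑ i, a i * z i) ^ 2) ∂(gaussPi κ) := by
      rw [← ofReal_integral_eq_lintegral_ofReal ((integrable_dot_pow a 2).const_mul _)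
        (Eventually.of_forall fun z => by positivity), integral_const_mul, integral_dot_sq,
        ← ENNReal.ofReal_ofNat, ← ENNReal.ofReal_mul (by norm_num)]
      congr 1
      rw [← hA]; field_simp
    rw [h4]
    refine lintegral_mono fun z => ?_
    rw [← ENNReal.ofReal_add (by positivity) (by positivity)]
    apply ENNReal.ofReal_le_ofReal
    rw [hTR, hFR]
    have : 2 * (B / A) ^ 2 * (∑ i, a i * z i) ^ 2
        = (2 * (∑ j, a j * z j) / A * B) ^ 2 / 2 := by field_simp
    rw [this]
    nlinarith [sq_nonneg (2 * (T z - ∑ i, z i * e i) + 2 * (∑ j, a j * z j) / A * B)]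
  have h5 := (ENNReal.mul_le_mul_iff_right (by norm_num : (2 : ℝ≥0∞) ≠ 0) (by norm_num)).1 h3
  refine le_trans (ENNReal.ofReal_le_ofReal ?_) h5
  rw [le_div_iff₀ hpos]
  -- B²/A ≥ 2B - A. The weaker bound is kept because it has no denominator, so it can be averaged
  -- over the design.
  nlinarith [sq_nonneg (B - A)]

end Gaussian

/-- Negative parts only lower the left side, and a non-integrable function has integral 0. Hence
pointwise Bayes bounds, which may be negative, can be integrated without checking integrability. -/
theorem ofReal_integral_le_lintegral {Ω : Type*} [MeasurableSpace Ω] {μ : Measure Ω} (f : Ω → ℝ) :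
    ENNReal.ofReal (∫ x, f x ∂μ) ≤ ∫⁻ x, ENNReal.ofReal (f x) ∂μ := by
  by_cases hf : Integrable f μ
  · rw [integral_eq_lintegral_pos_part_sub_lintegral_neg_part hf]
    refine (ENNReal.ofReal_le_ofReal (sub_le_self _ ENNReal.toReal_nonneg)).trans ?_
    exact ENNReal.ofReal_toReal_le
  · simp [integral_undef hf]

/-! ### The design law and the information function -/

section Design

variable {D : ℕ} {p σ : ℝ → (Fin D → ℝ) → ℝ}

theorem volume_unitCube (D : ℕ) : volume (Set.Icc (0 : Fin D → ℝ) 1) = 1 := by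
  rw [Real.volume_Icc_pi]; simp

theorem RegularDesign.density_nonneg (h : RegularDesign p σ) (x : ℝ) (z : Fin D → ℝ) :
    0 ≤ p x z := by
  obtain ⟨B, hB⟩ := h.log_bounded
  by_cases hx : x ∈ Set.Icc (0 : ℝ) 1 ∧ z ∈ Set.Icc (0 : Fin D → ℝ) 1
  · exact (hB x hx.1 z hx.2).1.le
  · exact (h.support_density x z hx).ge

theorem RegularDesign.exists_bounds (h : RegularDesign p σ) :
    ∃ b : ℝ, 1 ≤ b ∧ ∀ x ∈ Set.Icc (0 : ℝ) 1, ∀ z ∈ Set.Icc (0 : Fin D → ℝ) 1,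
      b⁻¹ ≤ p x z ∧ p x z ≤ b ∧ b⁻¹ ≤ σ x z ∧ σ x z ≤ b := by
  obtain ⟨B, hB⟩ := h.log_bounded
  refine ⟨Real.exp (max B 0), Real.one_le_exp (le_max_right _ _), fun x hx z hz => ?_⟩
  obtain ⟨hp, hs, hm⟩ := hB x hx z hz
  have h1 := abs_le.1 (((le_max_left _ _).trans hm).trans (le_max_left B 0))
  have h2 := abs_le.1 (((le_max_right _ _).trans hm).trans (le_max_left B 0))
  rw [← Real.exp_neg]
  exact ⟨(Real.le_log_iff_exp_le hp).1 h1.1, (Real.log_le_iff_le_exp hp).1 h1.2,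
    (Real.le_log_iff_exp_le hs).1 h2.1, (Real.log_le_iff_le_exp hs).1 h2.2⟩

theorem RegularDesign.isProbabilityMeasure (h : RegularDesign p σ) :
    IsProbabilityMeasure (designLaw p) := by
  constructor
  have hi : Integrable (fun v : ℝ × (Fin D → ℝ) => p v.1 v.2) := by
    by_contra hn
    have := h.integral_density
    rw [integral_undef hn] at this
    exact zero_ne_one this
  rw [designLaw, withDensity_apply _ MeasurableSet.univ, Measure.restrict_univ,
    ← ofReal_integral_eq_lintegral_ofReal hi
      (Eventually.of_forall fun v => h.density_nonneg v.1 v.2), h.integral_density]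
  simp

theorem RegularDesign.ae_mem (h : RegularDesign p σ) :
    ∀ᵐ v ∂(designLaw p), v.1 ∈ Set.Icc (0 : ℝ) 1 ∧ v.2 ∈ Set.Icc (0 : Fin D → ℝ) 1 := by
  have hm : Measurable fun v : ℝ × (Fin D → ℝ) => ENNReal.ofReal (p v.1 v.2) :=
    h.measurable_density.ennreal_ofReal
  rw [designLaw, ae_withDensity_iff hm]
  refine Eventually.of_forall fun v hv => ?_
  by_contra hc
  exact hv (by simp [h.support_density _ _ hc])

theorem RegularDesign.measurable_info (h : RegularDesign p σ) : Measurable (designInfo p σ) := by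
  have : StronglyMeasurable (Function.uncurry fun x z => p x z / σ x z ^ 2) :=
    (h.measurable_density.div (h.measurable_scale.pow_const 2)).stronglyMeasurable
  exact (this.integral_prod_right).measurable

theorem RegularDesign.exists_info_bounds (h : RegularDesign p σ) :
    ∃ b : ℝ, 1 ≤ b ∧ ∀ x ∈ Set.Icc (0 : ℝ) 1,
      b⁻¹ ≤ designInfo p σ x ∧ designInfo p σ x ≤ b := by
  obtain ⟨b, hb, hbd⟩ := h.exists_bounds
  have hb0 : 0 < b := by linarith
  refine ⟨b ^ 3, one_le_pow₀ hb, fun x hx => ?_⟩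
  have hz : ∀ z ∈ Set.Icc (0 : Fin D → ℝ) 1,
      (b ^ 3)⁻¹ ≤ p x z / σ x z ^ 2 ∧ p x z / σ x z ^ 2 ≤ b ^ 3 := by
    intro z hz
    obtain ⟨h1, h2, h3, h4⟩ := hbd x hx z hz
    have hs : 0 < σ x z := (inv_pos.2 hb0).trans_le h3
    constructor
    · rw [show (b ^ 3)⁻¹ = b⁻¹ / b ^ 2 by field_simp]
      gcongr
      exact (inv_pos.2 hb0).le.trans h1
    · rw [show b ^ 3 = b / (b⁻¹) ^ 2 by field_simp]
      gcongr
  have hm : Measurable fun z => p x z / σ x z ^ 2 :=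
    (h.measurable_density.comp (measurable_const.prodMk measurable_id)).div
      ((h.measurable_scale.comp (measurable_const.prodMk measurable_id)).pow_const 2)
  have hint : IntegrableOn (fun z => p x z / σ x z ^ 2) (Set.Icc (0 : Fin D → ℝ) 1) := by
    refine Measure.integrableOn_of_bounded (M := b ^ 3) (by simp [volume_unitCube])
      hm.aestronglyMeasurable ?_
    filter_upwards [ae_restrict_mem measurableSet_Icc] with z hz'
    rw [Real.norm_eq_abs, abs_of_nonneg ((inv_nonneg.2 (by positivity)).trans (hz z hz').1)]
    exact (hz z hz').2
  have hc : ∀ c : ℝ, ∫ _ in Set.Icc (0 : Fin D → ℝ) 1, c = c := by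
    intro c; simp [Measure.real, volume_unitCube]
  have hic : ∀ c : ℝ, IntegrableOn (fun _ => c) (Set.Icc (0 : Fin D → ℝ) 1) := fun c =>
    integrableOn_const (by simp [volume_unitCube])
  constructor
  · rw [← hc (b ^ 3)⁻¹]
    exact setIntegral_mono_on (hic _) hint measurableSet_Icc fun z hz' => (hz z hz').1
  · rw [← hc (b ^ 3)]
    exact setIntegral_mono_on hint (hic _) measurableSet_Icc fun z hz' => (hz z hz').2

/-- Under the design law, the mean of `k(X) / σ²` is `∫ 𝓘 k`. -/
theorem RegularDesign.integral_div_scale_sq (h : RegularDesign p σ) {k : ℝ → ℝ}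
    (hk : Measurable k) {C : ℝ} (hC : ∀ y, |k y| ≤ C) :
    Integrable (fun v : ℝ × (Fin D → ℝ) => k v.1 / σ v.1 v.2 ^ 2) (designLaw p) ∧
    ∫ v, k v.1 / σ v.1 v.2 ^ 2 ∂(designLaw p)
      = ∫ y in Set.Icc (0 : ℝ) 1, designInfo p σ y * k y := by
  have := h.isProbabilityMeasure
  obtain ⟨b, hb, hbd⟩ := h.exists_bounds
  have hb0 : 0 < b := by linarith
  have hm : Measurable fun v : ℝ × (Fin D → ℝ) => k v.1 / σ v.1 v.2 ^ 2 :=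
    (hk.comp measurable_fst).div (h.measurable_scale.pow_const 2)
  have hint : Integrable (fun v : ℝ × (Fin D → ℝ) => k v.1 / σ v.1 v.2 ^ 2) (designLaw p) := by
    refine (integrable_const (C * b ^ 2)).mono' hm.aestronglyMeasurable ?_
    filter_upwards [h.ae_mem] with v hv
    obtain ⟨-, -, h3, -⟩ := hbd _ hv.1 _ hv.2
    have hs : 0 < σ v.1 v.2 := (inv_pos.2 hb0).trans_le h3
    rw [Real.norm_eq_abs, abs_div, abs_of_pos (pow_pos hs 2), div_le_iff₀ (pow_pos hs 2)]
    have h1 : 1 ≤ b * σ v.1 v.2 := by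
      have := mul_le_mul_of_nonneg_left h3 hb0.le
      rwa [mul_inv_cancel₀ hb0.ne'] at this
    have hC0 : 0 ≤ C := (abs_nonneg _).trans (hC 0)
    calc |k v.1| ≤ C * 1 := by simpa using hC v.1
      _ ≤ C * (b * σ v.1 v.2) ^ 2 := by gcongr; exact one_le_pow₀ h1
      _ = _ := by ring
  refine ⟨hint, ?_⟩
  have hpm : Measurable fun v : ℝ × (Fin D → ℝ) => ENNReal.ofReal (p v.1 v.2) :=
    h.measurable_density.ennreal_ofReal
  have e1 : ∫ v, k v.1 / σ v.1 v.2 ^ 2 ∂(designLaw p)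
      = ∫ v : ℝ × (Fin D → ℝ), p v.1 v.2 * (k v.1 / σ v.1 v.2 ^ 2) := by
    rw [designLaw, integral_withDensity_eq_integral_toReal_smul hpm (by simp)]
    refine integral_congr_ae (Eventually.of_forall fun v => ?_)
    simp [ENNReal.toReal_ofReal (h.density_nonneg _ _)]
  have hint2 : Integrable (fun v : ℝ × (Fin D → ℝ) => p v.1 v.2 * (k v.1 / σ v.1 v.2 ^ 2)) := by
    have := (integrable_withDensity_iff_integrable_smul' hpm (by simp)).1 hint
    refine this.congr (Eventually.of_forall fun v => ?_)
    simp [ENNReal.toReal_ofReal (h.density_nonneg _ _)]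
  rw [e1, Measure.volume_eq_prod, integral_prod _ hint2, ← integral_indicator measurableSet_Icc]
  congr 1
  ext x
  by_cases hx : x ∈ Set.Icc (0 : ℝ) 1
  · rw [Set.indicator_of_mem hx, designInfo, ← integral_mul_const,
      ← integral_indicator measurableSet_Icc]
    congr 1
    ext z
    by_cases hz : z ∈ Set.Icc (0 : Fin D → ℝ) 1
    · rw [Set.indicator_of_mem hz]; ring
    · rw [Set.indicator_of_notMem hz, h.support_density x z (fun hc => hz hc.2)]; simp
  · rw [Set.indicator_of_notMem hx]
    simp [h.support_density x _ (fun hc => hx hc.1)]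

end Design

/-! ### Bayes risk of a Gaussian prior -/

section Bayes

variable {D : ℕ} {p σ : ℝ → (Fin D → ℝ) → ℝ} {g : (Fin D → ℝ) → ℝ} {n : ℕ}

theorem lintegral_sourceLaw (h : RegularDesign p σ)
    (Φ : (Fin n → (ℝ × (Fin D → ℝ)) × ℝ) → ℝ≥0∞) (hΦ : Measurable Φ) :
    ∫⁻ ω, Φ ω ∂(sourceLaw p n) = ∫⁻ V, ∫⁻ ε, Φ (fun l => (V l, ε l)) ∂(gaussPi (Fin n))
      ∂(Measure.pi fun _ : Fin n => designLaw p) := by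
  have := h.isProbabilityMeasure
  have hmp := (measurePreserving_arrowProdEquivProdArrow (ℝ × (Fin D → ℝ)) ℝ (Fin n)
    (fun _ => designLaw p) (fun _ => gaussianReal 0 1)).symm
  rw [sourceLaw, ← hmp.lintegral_comp hΦ, lintegral_prod]
  · rfl
  · exact (hΦ.comp (MeasurableEquiv.measurable _)).aemeasurable

/-- Prior variables and noise become a single Gaussian vector, so that a direction may mix the two.
-/
theorem lintegral_gaussPi_sum {ι κ : Type*} [Fintype ι] [Fintype κ]
    (Φ : (ι → ℝ) × (κ → ℝ) → ℝ≥0∞) (hΦ : Measurable Φ) :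
    ∫⁻ ζ, ∫⁻ ε, Φ (ζ, ε) ∂(gaussPi κ) ∂(gaussPi ι)
      = ∫⁻ z, Φ (fun i => z (Sum.inl i), fun j => z (Sum.inr j)) ∂(gaussPi (ι ⊕ κ)) := by
  have hmp := measurePreserving_sumPiEquivProdPi (X := fun _ : ι ⊕ κ => ℝ)
    (fun _ => gaussianReal 0 1)
  rw [← lintegral_prod _ hΦ.aemeasurable, ← hmp.lintegral_comp hΦ]
  rfl

/-- The regression functions of the Gaussian prior: a shift of the pivot by a random linear
combination of the functions `e i`. -/
def priorFun {ι : Type*} [Fintype ι] (b : ℝ → ℝ) (e : ι → ℝ → ℝ) (ζ : ι → ℝ) (x : ℝ) : ℝ :=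
  b x + ∑ i, ζ i * e i x

variable {ι : Type*} [Fintype ι] {b : ℝ → ℝ} {e : ι → ℝ → ℝ}

theorem measurable_priorFun (hb : Measurable b) (he : ∀ i, Measurable (e i)) :
    Measurable fun q : (ι → ℝ) × ℝ => priorFun b e q.1 q.2 := by
  unfold priorFun
  refine (hb.comp measurable_snd).add (Finset.measurable_sum _ fun i _ => ?_)
  exact ((measurable_pi_apply i).comp measurable_fst).mul ((he i).comp measurable_snd)

theorem measurable_sample_priorFun (h : RegularDesign p σ) (hg : Measurable g)
    (hb : Measurable b) (he : ∀ i, Measurable (e i)) :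
    Measurable fun q : (ι → ℝ) × (Fin n → (ℝ × (Fin D → ℝ)) × ℝ) =>
      sample (priorFun b e q.1) g σ q.2 := by
  refine measurable_pi_lambda _ fun l => ?_
  have h1 : Measurable fun q : (ι → ℝ) × (Fin n → (ℝ × (Fin D → ℝ)) × ℝ) => q.2 l :=
    (measurable_pi_apply l).comp measurable_snd
  have h2 : Measurable fun q : (ι → ℝ) × (Fin n → (ℝ × (Fin D → ℝ)) × ℝ) =>
      priorFun b e q.1 (q.2 l).1.1 :=
    (measurable_priorFun hb he).comp (measurable_fst.prodMk h1.fst.fst)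
  have h3 : Measurable fun q : (ι → ℝ) × (Fin n → (ℝ × (Fin D → ℝ)) × ℝ) =>
      σ (q.2 l).1.1 (q.2 l).1.2 := h.measurable_scale.comp h1.fst
  exact h1.fst.prodMk ((h2.add (hg.comp h1.fst.snd)).add (h3.mul h1.snd))

/-- Squared error at the point `x` when the prior draws `ζ` and the sources are `ω`. -/
def priorLoss (b : ℝ → ℝ) (e : ι → ℝ → ℝ) (g : (Fin D → ℝ) → ℝ) (σ : ℝ → (Fin D → ℝ) → ℝ)
    (est : (Fin n → (ℝ × (Fin D → ℝ)) × ℝ) → ℝ → ℝ) (ζ : ι → ℝ)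
    (ω : Fin n → (ℝ × (Fin D → ℝ)) × ℝ) (x : ℝ) : ℝ≥0∞ :=
  ENNReal.ofReal ((est (sample (priorFun b e ζ) g σ ω) x - priorFun b e ζ x) ^ 2)

variable {est : (Fin n → (ℝ × (Fin D → ℝ)) × ℝ) → ℝ → ℝ}

theorem measurable_priorLoss (h : RegularDesign p σ) (hg : Measurable g)
    (hb : Measurable b) (he : ∀ i, Measurable (e i)) (hest : Measurable (Function.uncurry est))
    {A : Type*} [MeasurableSpace A] {fζ : A → ι → ℝ}
    {fω : A → Fin n → (ℝ × (Fin D → ℝ)) × ℝ} {fx : A → ℝ} (hζ : Measurable fζ)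
    (hω : Measurable fω) (hx : Measurable fx) :
    Measurable fun q => priorLoss b e g σ est (fζ q) (fω q) (fx q) := by
  have h1 : Measurable fun q => est (sample (priorFun b e (fζ q)) g σ (fω q)) (fx q) :=
    hest.comp (((measurable_sample_priorFun h hg hb he).comp (hζ.prodMk hω)).prodMk hx)
  have h2 : Measurable fun q => priorFun b e (fζ q) (fx q) :=
    (measurable_priorFun hb he).comp (hζ.prodMk hx)
  exact ((h1.sub h2).pow_const 2).ennreal_ofReal

theorem measurable_lintegral_priorLoss (h : RegularDesign p σ) (hg : Measurable g)
    (hb : Measurable b) (he : ∀ i, Measurable (e i)) (hest : Measurable (Function.uncurry est))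
    {A : Type*} [MeasurableSpace A] {fζ : A → ι → ℝ}
    {fω : A → Fin n → (ℝ × (Fin D → ℝ)) × ℝ} (hζ : Measurable fζ) (hω : Measurable fω) :
    Measurable fun q => ∫⁻ x in Set.Icc (0 : ℝ) 1, priorLoss b e g σ est (fζ q) (fω q) x :=
  Measurable.lintegral_prod_right'
    (f := fun q : A × ℝ => priorLoss b e g σ est (fζ q.1) (fω q.1) q.2)
    (measurable_priorLoss h hg hb he hest (hζ.comp measurable_fst) (hω.comp measurable_fst)
      measurable_snd)

theorem measurable_zip : Measurable fun q : (Fin n → ℝ × (Fin D → ℝ)) × (Fin n → ℝ) =>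
    (fun l => (q.1 l, q.2 l) : Fin n → (ℝ × (Fin D → ℝ)) × ℝ) :=
  measurable_pi_lambda _ fun l => ((measurable_pi_apply l).comp measurable_fst).prodMk
    ((measurable_pi_apply l).comp measurable_snd)

/-- Tonelli brings x and the design outside. What remains inside is the prediction of one linear
form of a Gaussian vector. -/
theorem lintegral_mise_eq (h : RegularDesign p σ) (hg : Measurable g)
    (hb : Measurable b) (he : ∀ i, Measurable (e i)) (hest : Measurable (Function.uncurry est)) :
    ∫⁻ ζ, mise (priorFun b e ζ) g p σ est ∂(gaussPi ι)
      = ∫⁻ x in Set.Icc (0 : ℝ) 1, ∫⁻ V, ∫⁻ z,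
          priorLoss b e g σ est (fun i => z (Sum.inl i)) (fun l => (V l, z (Sum.inr l))) x
          ∂(gaussPi (ι ⊕ Fin n)) ∂(Measure.pi fun _ : Fin n => designLaw p) := by
  have := h.isProbabilityMeasure
  have hinl : Measurable fun z : ι ⊕ Fin n → ℝ => fun i => z (Sum.inl i) :=
    measurable_pi_lambda _ fun i => measurable_pi_apply _
  have hinr : Measurable fun z : ι ⊕ Fin n → ℝ => fun l => z (Sum.inr l) :=
    measurable_pi_lambda _ fun l => measurable_pi_apply _
  have e1 : ∀ ζ, mise (priorFun b e ζ) g p σ est = ∫⁻ V, ∫⁻ ε, ∫⁻ x in Set.Icc (0 : ℝ) 1,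
      priorLoss b e g σ est ζ (fun l => (V l, ε l)) x ∂volume
      ∂(gaussPi (Fin n)) ∂(Measure.pi fun _ : Fin n => designLaw p) := fun ζ =>
    lintegral_sourceLaw h (fun ω => ∫⁻ x in Set.Icc (0 : ℝ) 1, priorLoss b e g σ est ζ ω x)
      (measurable_lintegral_priorLoss h hg hb he hest measurable_const measurable_id)
  have e2 : ∀ V : Fin n → ℝ × (Fin D → ℝ),
      ∫⁻ ζ, ∫⁻ ε, ∫⁻ x in Set.Icc (0 : ℝ) 1, priorLoss b e g σ est ζ (fun l => (V l, ε l)) x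
        ∂volume ∂(gaussPi (Fin n)) ∂(gaussPi ι)
      = ∫⁻ x in Set.Icc (0 : ℝ) 1, ∫⁻ z,
          priorLoss b e g σ est (fun i => z (Sum.inl i)) (fun l => (V l, z (Sum.inr l))) x
          ∂(gaussPi (ι ⊕ Fin n)) := by
    intro V
    rw [lintegral_gaussPi_sum (fun q : (ι → ℝ) × (Fin n → ℝ) => ∫⁻ x in Set.Icc (0 : ℝ) 1,
      priorLoss b e g σ est q.1 (fun l => (V l, q.2 l)) x)
      (measurable_lintegral_priorLoss h hg hb he hest measurable_fst
        (measurable_zip.comp (measurable_const.prodMk measurable_snd)))]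
    rw [lintegral_lintegral_swap]
    have := measurable_priorLoss h hg hb he hest
      (A := (ι ⊕ Fin n → ℝ) × ℝ) (hinl.comp measurable_fst) (measurable_zip.comp
        ((measurable_const (a := V)).prodMk (hinr.comp measurable_fst))) measurable_snd
    exact this.aemeasurable
  simp_rw [e1]
  rw [lintegral_lintegral_swap]
  · simp_rw [e2]
    rw [lintegral_lintegral_swap]
    have := measurable_priorLoss h hg hb he hest
      (A := ((Fin n → ℝ × (Fin D → ℝ)) × ℝ) × (ι ⊕ Fin n → ℝ)) (hinl.comp measurable_snd)
        (measurable_zip.comp (measurable_fst.fst.prodMk (hinr.comp measurable_snd)))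
        measurable_fst.snd
    exact (this.lintegral_prod_right' (ν := gaussPi (ι ⊕ Fin n))).aemeasurable
  · have := measurable_lintegral_priorLoss h hg hb he hest
      (A := ((ι → ℝ) × (Fin n → ℝ × (Fin D → ℝ))) × (Fin n → ℝ)) measurable_fst.fst
        (measurable_zip.comp (measurable_fst.snd.prodMk measurable_snd))
    exact (this.lintegral_prod_right' (ν := gaussPi (Fin n))).aemeasurable

/-- Lower bound for the Bayes risk of the Gaussian prior: `β` parametrizes the direction in which
the sample is blind. -/
theorem lintegral_mise_ge (h : RegularDesign p σ) (hg : Measurable g)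
    (hb : Measurable b) (he : ∀ i, Measurable (e i)) {C : ℝ} (hC : ∀ i x, |e i x| ≤ C)
    (hest : Measurable (Function.uncurry est)) (β : ι → ℝ) :
    ENNReal.ofReal (∫ x in Set.Icc (0 : ℝ) 1, (∑ i, (2 * β i - β i ^ 2) * e i x ^ 2
        - n * ∫ y in Set.Icc (0 : ℝ) 1, designInfo p σ y * (∑ i, β i * e i x * e i y) ^ 2))
      ≤ ∫⁻ ζ, mise (priorFun b e ζ) g p σ est ∂(gaussPi ι) := by
  have := h.isProbabilityMeasure
  rw [lintegral_mise_eq h hg hb he hest]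
  refine (ofReal_integral_le_lintegral _).trans (lintegral_mono fun x => ?_)
  set k : ℝ → ℝ := fun y => ∑ i, β i * e i x * e i y with hk
  have hkm : Measurable k := Finset.measurable_sum _ fun i _ => (he i).const_mul _
  have hkC : ∀ y, |k y ^ 2| ≤ (∑ i, |β i| * C * C) ^ 2 := by
    intro y
    rw [abs_pow]
    gcongr
    refine (Finset.abs_sum_le_sum_abs _ _).trans (Finset.sum_le_sum fun i _ => ?_)
    rw [abs_mul, abs_mul]
    have hC0 : 0 ≤ C := (abs_nonneg _).trans (hC i 0)
    gcongr
    · exact hC i x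
    · exact hC i y
  obtain ⟨hi, hI⟩ := h.integral_div_scale_sq (hkm.pow_const 2) hkC
  have hil : ∀ l : Fin n, Integrable (fun V : Fin n → ℝ × (Fin D → ℝ) =>
      k (V l).1 ^ 2 / σ (V l).1 (V l).2 ^ 2) (Measure.pi fun _ => designLaw p) := fun l =>
    (measurePreserving_eval (fun _ : Fin n => designLaw p) l).integrable_comp_of_integrable hi
  have hIl : ∀ l : Fin n, ∫ V : Fin n → ℝ × (Fin D → ℝ),
      k (V l).1 ^ 2 / σ (V l).1 (V l).2 ^ 2 ∂(Measure.pi fun _ => designLaw p)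
      = ∫ y in Set.Icc (0 : ℝ) 1, designInfo p σ y * k y ^ 2 := fun l => by
    have hmp := measurePreserving_eval (fun _ : Fin n => designLaw p) l
    have := integral_map hmp.measurable.aemeasurable
      (f := fun v : ℝ × (Fin D → ℝ) => k v.1 ^ 2 / σ v.1 v.2 ^ 2)
      (by rw [hmp.map_eq]; exact hi.aestronglyMeasurable)
    rw [hmp.map_eq] at this
    rw [← hI, this]
  have e1 : (∑ i, (2 * β i - β i ^ 2) * e i x ^ 2
        - n * ∫ y in Set.Icc (0 : ℝ) 1, designInfo p σ y * k y ^ 2)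
      = ∫ V : Fin n → ℝ × (Fin D → ℝ), (∑ i, (2 * β i - β i ^ 2) * e i x ^ 2
          - ∑ l, k (V l).1 ^ 2 / σ (V l).1 (V l).2 ^ 2) ∂(Measure.pi fun _ => designLaw p) := by
    rw [integral_sub (integrable_const _) (integrable_finsetSum _ fun l _ => hil l),
      integral_finsetSum _ fun l _ => hil l]
    simp [hIl]
  rw [e1]
  refine (ofReal_integral_le_lintegral _).trans (lintegral_mono_ae ?_)
  have hae : ∀ᵐ V ∂(Measure.pi fun _ : Fin n => designLaw p), ∀ l,
      (V l).1 ∈ Set.Icc (0 : ℝ) 1 ∧ (V l).2 ∈ Set.Icc (0 : Fin D → ℝ) 1 := by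
    rw [ae_all_iff]
    intro l
    exact (measurePreserving_eval (fun _ : Fin n => designLaw p) l).quasiMeasurePreserving.ae
      h.ae_mem
  filter_upwards [hae] with V hV
  obtain ⟨B, hB⟩ := h.log_bounded
  have hσ : ∀ l, σ (V l).1 (V l).2 ≠ 0 := fun l => (hB _ (hV l).1 _ (hV l).2).2.1.ne'
  -- The blind direction: moving ζ by s βᵢ eᵢ(x) changes the regression function at `X_l` by s
  -- k(`X_l`), and moving the noise by -s k(`X_l`)/σ cancels this in `Y_l`.
  set a : ι ⊕ Fin n → ℝ := Sum.elim (fun i => β i * e i x) (fun l => -(k (V l).1 / σ (V l).1 (V l).2))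
    with ha
  set T : (ι ⊕ Fin n → ℝ) → ℝ := fun z =>
    est (sample (priorFun b e (fun i => z (Sum.inl i))) g σ (fun l => (V l, z (Sum.inr l)))) x - b x
    with hT
  have hTm : Measurable T := by
    refine (hest.comp (Measurable.prodMk ?_ measurable_const)).sub_const _
    refine (measurable_sample_priorFun h hg hb he).comp (Measurable.prodMk ?_ ?_)
    · exact measurable_pi_lambda _ fun i => measurable_pi_apply _
    · exact measurable_pi_lambda _ fun l => measurable_const.prodMk (measurable_pi_apply _)
  have hinv : ∀ z s, T (fun i => z i + s * a i) = T z := by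
    intro z s
    simp only [hT]
    congr 2
    ext l : 1
    simp only [sample, priorFun, ha, Sum.elim_inl, Sum.elim_inr]
    congr 1
    have : ∑ i, (z (Sum.inl i) + s * (β i * e i x)) * e i (V l).1
        = ∑ i, z (Sum.inl i) * e i (V l).1 + s * k (V l).1 := by
      simp only [hk, Finset.mul_sum, ← Finset.sum_add_distrib]
      exact Finset.sum_congr rfl fun i _ => by ring
    rw [this]
    have := hσ l
    field_simp
    ring
  have key := lintegral_sq_sub_dot_ge T hTm a (Sum.elim (fun i => e i x) 0) hinv
  refine le_trans (ENNReal.ofReal_le_ofReal (le_of_eq ?_)) (key.trans (le_of_eq ?_))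
  · simp only [ha, Fintype.sum_sum_type, Sum.elim_inl, Sum.elim_inr, Pi.zero_apply, mul_zero,
      Finset.sum_const_zero, add_zero, Finset.mul_sum, neg_sq, div_pow]
    rw [← sub_sub, ← Finset.sum_sub_distrib]
    congr 1
    exact Finset.sum_congr rfl fun i _ => by ring
  · refine lintegral_congr fun z => ?_
    simp only [priorLoss, hT, Fintype.sum_sum_type, Sum.elim_inl, Sum.elim_inr, Pi.zero_apply,
      mul_zero, Finset.sum_const_zero, add_zero, priorFun]
    congr 2
    ring

end Bayes

/-! ### From Bayes risk to minimax risk when draws may leave the class -/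

section Truncation

theorem lintegral_sq_sub_le {Ω : Type*} [MeasurableSpace Ω] (μ : Measure Ω) {f g h : Ω → ℝ}
    (hf : Measurable f) (hg : Measurable g) :
    ∫⁻ x, ENNReal.ofReal ((f x - h x) ^ 2) ∂μ
      ≤ 2 * ∫⁻ x, ENNReal.ofReal ((f x - g x) ^ 2) ∂μ
        + 2 * ∫⁻ x, ENNReal.ofReal ((h x - g x) ^ 2) ∂μ := by
  have hm : Measurable fun x => ENNReal.ofReal ((f x - g x) ^ 2) :=
    ((hf.sub hg).pow_const 2).ennreal_ofReal
  rw [← lintegral_const_mul _ hm, ← lintegral_const_mul' _ _ (by norm_num),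
    ← lintegral_add_left (hm.const_mul 2)]
  refine lintegral_mono fun x => ?_
  simp only
  rw [← ENNReal.ofReal_ofNat, ← ENNReal.ofReal_mul (by norm_num), ← ENNReal.ofReal_mul (by norm_num),
    ← ENNReal.ofReal_add (by positivity) (by positivity)]
  apply ENNReal.ofReal_le_ofReal
  nlinarith [sq_nonneg ((f x - g x) + (h x - g x))]

variable {D : ℕ} {p σ : ℝ → (Fin D → ℝ) → ℝ} {g : (Fin D → ℝ) → ℝ} {n : ℕ}
variable {ι : Type*} [Fintype ι] {b : ℝ → ℝ} {e : ι → ℝ → ℝ}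

/-- The minimax risk over a class containing the prior draws from `Γ` is at least the Bayes bound,
up to the contribution of `Γᶜ`. -/
theorem bayes_le_dealerMinimaxRisk (h : RegularDesign p σ) (hg : Measurable g)
    (hb : Measurable b) (he : ∀ i, Measurable (e i)) {C : ℝ} (hC : ∀ i x, |e i x| ≤ C)
    (β : ι → ℝ) {F : Set (ℝ → ℝ)} {Γ : Set (ι → ℝ)} (hΓ : MeasurableSet Γ)
    (hF : ∀ ζ ∈ Γ, priorFun b e ζ ∈ F) {R : ℝ≥0∞}
    (hR : ∀ ζ ∈ Γ, ∫⁻ x in Set.Icc (0 : ℝ) 1, ENNReal.ofReal ((∑ i, ζ i * e i x) ^ 2) ≤ R) :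
    ENNReal.ofReal (∫ x in Set.Icc (0 : ℝ) 1, (∑ i, (2 * β i - β i ^ 2) * e i x ^ 2
        - n * ∫ y in Set.Icc (0 : ℝ) 1, designInfo p σ y * (∑ i, β i * e i x * e i y) ^ 2))
      ≤ dealerMinimaxRisk F g p σ n + (8 * R * gaussPi ι Γᶜ
        + 2 * ∫⁻ ζ in Γᶜ, ∫⁻ x in Set.Icc (0 : ℝ) 1, ENNReal.ofReal ((∑ i, ζ i * e i x) ^ 2)
          ∂volume ∂(gaussPi ι)) := by
  have := h.isProbabilityMeasure
  have : IsProbabilityMeasure (sourceLaw p n) := by unfold sourceLaw; infer_instance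
  rw [dealerMinimaxRisk, ENNReal.iInf_add]
  refine le_iInf fun est => ?_
  rw [ENNReal.iInf_add]
  refine le_iInf fun hest => ?_
  set N : (Fin n → (ℝ × (Fin D → ℝ)) × ℝ) → ℝ≥0∞ := fun y =>
    ∫⁻ x in Set.Icc (0 : ℝ) 1, ENNReal.ofReal ((est y x - b x) ^ 2) with hN
  have hNm : Measurable N := by
    refine Measurable.lintegral_prod_right'
      (f := fun q : (Fin n → (ℝ × (Fin D → ℝ)) × ℝ) × ℝ =>
        ENNReal.ofReal ((est q.1 q.2 - b q.2) ^ 2)) ?_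
    exact ((hest.sub (hb.comp measurable_snd)).pow_const 2).ennreal_ofReal
  -- An estimate whose squared distance from `b` exceeds 4R is replaced by `b`. For a draw in `Γ`,
  -- `b` itself has loss at most R, and such an estimate has loss at least R, so the change does no
  -- harm.
  set T : (Fin n → (ℝ × (Fin D → ℝ)) × ℝ) → ℝ → ℝ := fun y x =>
    if N y ≤ 4 * R then est y x else b x with hT
  have hTm : Measurable (Function.uncurry T) := by
    refine Measurable.ite ?_ hest (hb.comp measurable_snd)
    exact measurableSet_le (hNm.comp measurable_fst) measurable_const
  have hestx : ∀ y, Measurable (est y) := fun y => hest.comp (measurable_const.prodMk measurable_id)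
  have hTx : ∀ y, Measurable (T y) := fun y => hTm.comp (measurable_const.prodMk measurable_id)
  have hFx : ∀ ζ, Measurable (priorFun b e ζ) := fun ζ =>
    (measurable_priorFun hb he).comp (measurable_const.prodMk measurable_id)
  have hTN : ∀ y, ∫⁻ x in Set.Icc (0 : ℝ) 1, ENNReal.ofReal ((T y x - b x) ^ 2) ≤ 4 * R := by
    intro y
    by_cases hy : N y ≤ 4 * R
    · simp only [hT, if_pos hy]
      exact hy
    · simp [hT, hy]
  have hdiff : ∀ ζ x, priorFun b e ζ x - b x = ∑ i, ζ i * e i x := fun ζ x => by simp [priorFun]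
  have hgood : ∀ ζ ∈ Γ, mise (priorFun b e ζ) g p σ T ≤ mise (priorFun b e ζ) g p σ est := by
    intro ζ hζ
    refine lintegral_mono fun ω => ?_
    set y := sample (priorFun b e ζ) g σ ω
    by_cases hy : N y ≤ 4 * R
    · simp [hT, hy]
    · simp only [hT, hy, if_false]
      have h1 : ∫⁻ x in Set.Icc (0 : ℝ) 1, ENNReal.ofReal ((b x - priorFun b e ζ x) ^ 2) ≤ R := by
        refine le_trans (le_of_eq (lintegral_congr fun x => ?_)) (hR ζ hζ)
        rw [← hdiff, ← neg_sub, neg_sq]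
      refine h1.trans ?_
      have h2 := lintegral_sq_sub_le (volume.restrict (Set.Icc (0 : ℝ) 1)) (h := b) (hestx y)
        (hFx ζ)
      by_contra hlt
      apply hy
      refine h2.trans ?_
      calc _ ≤ 2 * R + 2 * R := by gcongr; exact (not_le.1 hlt).le
        _ = 4 * R := by ring
  -- Off `Γ` the loss is at most 2 · 4R plus twice the squared norm of the draw, for every sample.
  have hbad : ∀ ζ, mise (priorFun b e ζ) g p σ T ≤ 8 * R
      + 2 * ∫⁻ x in Set.Icc (0 : ℝ) 1, ENNReal.ofReal ((∑ i, ζ i * e i x) ^ 2) := by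
    intro ζ
    have : ∀ ω, ∫⁻ x in Set.Icc (0 : ℝ) 1, ENNReal.ofReal
        ((T (sample (priorFun b e ζ) g σ ω) x - priorFun b e ζ x) ^ 2) ≤ 8 * R
      + 2 * ∫⁻ x in Set.Icc (0 : ℝ) 1, ENNReal.ofReal ((∑ i, ζ i * e i x) ^ 2) := by
      intro ω
      refine (lintegral_sq_sub_le _ (hTx _) hb).trans ?_
      simp_rw [hdiff]
      refine add_le_add ?_ le_rfl
      calc _ ≤ 2 * (4 * R) := by gcongr; exact hTN _
        _ = 8 * R := by ring
    refine (lintegral_mono this).trans ?_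
    simp
  refine (lintegral_mise_ge h hg hb he hC hTm β).trans ?_
  rw [← lintegral_add_compl _ hΓ]
  refine add_le_add ?_ ?_
  · calc ∫⁻ ζ in Γ, mise (priorFun b e ζ) g p σ T ∂(gaussPi ι)
        ≤ ∫⁻ ζ in Γ, (⨆ f ∈ F, mise f g p σ est) ∂(gaussPi ι) := by
          refine setLIntegral_mono measurable_const fun ζ hζ => (hgood ζ hζ).trans ?_
          exact le_iSup₂ (f := fun f (_ : f ∈ F) => mise f g p σ est) _ (hF ζ hζ)
      _ ≤ _ := by
          rw [setLIntegral_const]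
          exact mul_le_of_le_one_right' prob_le_one
  · refine (lintegral_mono hbad).trans ?_
    rw [lintegral_add_left measurable_const, setLIntegral_const,
      lintegral_const_mul' _ _ (by norm_num)]

end Truncation

/-! ### The cosine system and multiplication by cosine polynomials -/

section Cosine

theorem continuous_cosBasis (j : ℕ) : Continuous (cosBasis j) := by
  unfold cosBasis
  split_ifs <;> fun_prop

theorem abs_cosBasis_le (j : ℕ) (x : ℝ) : |cosBasis j x| ≤ √2 := by
  unfold cosBasis
  split_ifs
  · rw [abs_one]; exact Real.one_le_sqrt.2 (by norm_num)
  · rw [abs_mul, abs_of_nonneg (Real.sqrt_nonneg _)]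
    exact mul_le_of_le_one_right (Real.sqrt_nonneg _) (Real.abs_cos_le_one _)

theorem cosBasis_sq_le (j : ℕ) (x : ℝ) : cosBasis j x ^ 2 ≤ 2 := by
  rw [← sq_abs, ← Real.sq_sqrt (show (0 : ℝ) ≤ 2 by norm_num)]
  gcongr
  exact abs_cosBasis_le j x

theorem abs_cosBasis_sub_le (j : ℕ) (x y : ℝ) :
    |cosBasis j x - cosBasis j y| ≤ √2 * (Real.pi * j) * |x - y| := by
  unfold cosBasis
  split_ifs with hj
  · simp [hj]
  · rw [← mul_sub, abs_mul, abs_of_nonneg (Real.sqrt_nonneg _), mul_assoc √2]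
    gcongr
    refine (Real.abs_cos_sub_cos_le _ _).trans ?_
    rw [← mul_sub, abs_mul, abs_of_nonneg (by positivity)]

theorem integral_cos_int_mul_pi {m : ℤ} (hm : m ≠ 0) :
    ∫ x in (0 : ℝ)..1, Real.cos (Real.pi * m * x) = 0 := by
  have h0 : Real.pi * m ≠ 0 := mul_ne_zero Real.pi_ne_zero (by exact_mod_cast hm)
  rw [intervalIntegral.integral_comp_mul_left (fun x => Real.cos x) h0]
  simp [mul_comm Real.pi, Real.sin_int_mul_pi]

theorem integral_cosBasis_mul (j k : ℕ) :
    ∫ x in (0 : ℝ)..1, cosBasis j x * cosBasis k x = if j = k then 1 else 0 := by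
  have hs : √2 * √2 = (2 : ℝ) := Real.mul_self_sqrt (by norm_num)
  have h0 : ∀ m : ℕ, m ≠ 0 → ∫ x in (0 : ℝ)..1, Real.cos (Real.pi * m * x) = 0 := fun m hm => by
    have := integral_cos_int_mul_pi (m := m) (by exact_mod_cast hm)
    simpa using this
  rcases eq_or_ne j 0 with rfl | hj <;> rcases eq_or_ne k 0 with rfl | hk
  · simp [cosBasis]
  · simp [cosBasis, hk, hk.symm, h0 k hk]
  · simp [cosBasis, hj, h0 j hj]
  · simp only [cosBasis, hj, hk, if_false]
    have e : ∀ x : ℝ, √2 * Real.cos (Real.pi * j * x) * (√2 * Real.cos (Real.pi * k * x))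
        = Real.cos (Real.pi * (j - k : ℤ) * x) + Real.cos (Real.pi * (j + k : ℤ) * x) := by
      intro x
      push_cast
      have := Real.two_mul_cos_mul_cos (Real.pi * j * x) (Real.pi * k * x)
      rw [show √2 * Real.cos (Real.pi * j * x) * (√2 * Real.cos (Real.pi * k * x))
        = (√2 * √2) * Real.cos (Real.pi * j * x) * Real.cos (Real.pi * k * x) by ring, hs, this]
      congr 2 <;> ring
    simp_rw [e]
    rw [intervalIntegral.integral_add (Continuous.intervalIntegrable (by fun_prop) _ _)
      (Continuous.intervalIntegrable (by fun_prop) _ _),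
      integral_cos_int_mul_pi (m := (j + k : ℤ)) (by omega), add_zero]
    split_ifs with hjk
    · simp [hjk]
    · exact integral_cos_int_mul_pi (by omega)

theorem cosCoef_finset_sum (s : Finset ℕ) (c : ℕ → ℝ) (j : ℕ) :
    cosCoef (fun x => ∑ k ∈ s, c k * cosBasis k x) j = if j ∈ s then c j else 0 := by
  unfold cosCoef
  simp_rw [Finset.sum_mul, mul_assoc]
  rw [intervalIntegral.integral_finsetSum]
  · simp_rw [intervalIntegral.integral_const_mul, integral_cosBasis_mul]
    simp
  · intro k _
    exact (continuous_const.mul ((continuous_cosBasis k).mul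
      (continuous_cosBasis j))).intervalIntegrable _ _

theorem integral_sq_finset_sum (s : Finset ℕ) (c : ℕ → ℝ) :
    ∫ x in (0 : ℝ)..1, (∑ k ∈ s, c k * cosBasis k x) ^ 2 = ∑ k ∈ s, c k ^ 2 := by
  have e : ∀ x, (∑ k ∈ s, c k * cosBasis k x) ^ 2
      = ∑ j ∈ s, c j * ((∑ k ∈ s, c k * cosBasis k x) * cosBasis j x) := by
    intro x
    rw [sq, Finset.sum_mul]
    exact Finset.sum_congr rfl fun j _ => by ring
  simp_rw [e]
  rw [intervalIntegral.integral_finsetSum]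
  · refine Finset.sum_congr rfl fun j hj => ?_
    rw [intervalIntegral.integral_const_mul]
    have := cosCoef_finset_sum s c j
    rw [if_pos hj] at this
    rw [cosCoef] at this
    rw [this]; ring
  · intro k _
    refine Continuous.intervalIntegrable (continuous_const.mul (Continuous.mul ?_
      (continuous_cosBasis k))) _ _
    exact continuous_finsetSum _ fun i _ => continuous_const.mul (continuous_cosBasis i)

/-- Bessel's inequality for the cosine system. -/
theorem sum_cosCoef_sq_le {f : ℝ → ℝ} (hf : Continuous f) (s : Finset ℕ) :
    ∑ k ∈ s, cosCoef f k ^ 2 ≤ ∫ x in (0 : ℝ)..1, f x ^ 2 := by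
  set P : ℝ → ℝ := fun x => ∑ k ∈ s, cosCoef f k * cosBasis k x with hP
  have hPc : Continuous P :=
    continuous_finsetSum _ fun i _ => continuous_const.mul (continuous_cosBasis i)
  have h1 : ∫ x in (0 : ℝ)..1, f x * P x = ∑ k ∈ s, cosCoef f k ^ 2 := by
    simp_rw [hP, Finset.mul_sum]
    rw [intervalIntegral.integral_finsetSum]
    · refine Finset.sum_congr rfl fun k _ => ?_
      have e : ∀ x, f x * (cosCoef f k * cosBasis k x)
          = cosCoef f k * (f x * cosBasis k x) := fun x => by ring
      simp_rw [e]
      rw [intervalIntegral.integral_const_mul, sq]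
      rfl
    · intro k _
      exact (hf.mul (continuous_const.mul (continuous_cosBasis k))).intervalIntegrable _ _
  have h2 := integral_sq_finset_sum s (cosCoef f)
  have h3 : 0 ≤ ∫ x in (0 : ℝ)..1, (f x - P x) ^ 2 :=
    intervalIntegral.integral_nonneg zero_le_one fun x _ => sq_nonneg _
  have e : ∀ x, (f x - P x) ^ 2 = f x ^ 2 - 2 * (f x * P x) + P x ^ 2 := fun x => by ring
  simp_rw [e] at h3
  rw [intervalIntegral.integral_add, intervalIntegral.integral_sub,
    intervalIntegral.integral_const_mul, h1, h2] at h3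
  · linarith
  all_goals exact Continuous.intervalIntegrable (by fun_prop) _ _

/-- Linear combinations of the basis cosines with indices in `S`. -/
def cosSpan (S : Set ℕ) : Submodule ℝ (ℝ → ℝ) := Submodule.span ℝ (cosBasis '' S)

theorem cosSpan_mono {S T : Set ℕ} (h : S ⊆ T) : cosSpan S ≤ cosSpan T :=
  Submodule.span_mono (Set.image_mono h)

theorem cosBasis_mem_cosSpan {S : Set ℕ} {j : ℕ} (hj : j ∈ S) : cosBasis j ∈ cosSpan S :=
  Submodule.subset_span (Set.mem_image_of_mem _ hj)

/-- Orthonormality identifies the coefficients of a finite cosine sum with its Fourier coefficients;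
membership in the span therefore carries the whole expansion. -/
theorem cosSpan_expansion {s : Finset ℕ} {f : ℝ → ℝ} (hf : f ∈ cosSpan (s : Set ℕ)) :
    (f = fun x => ∑ k ∈ s, cosCoef f k * cosBasis k x) ∧ ∀ k ∉ s, cosCoef f k = 0 := by
  obtain ⟨c, rfl⟩ : ∃ c : ℕ → ℝ, f = fun x => ∑ k ∈ s, c k * cosBasis k x := by
    obtain ⟨c, hc⟩ := (Submodule.mem_span_image_finset_iff_exists_fun' ℝ).1 hf
    refine ⟨c, ?_⟩
    rw [← hc]
    ext x
    simp
  constructor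
  · ext x
    refine Finset.sum_congr rfl fun k hk => ?_
    rw [cosCoef_finset_sum, if_pos hk]
  · intro k hk
    rw [cosCoef_finset_sum, if_neg hk]

/-- Product-to-sum: cos(πx) cos(πkx) is the mean of the cosines of frequencies k - 1 and k + 1. The
condition 1 ≤ a keeps k - 1 free of natural number truncation. -/
theorem cos_mul_mem_cosSpan {a b : ℕ} (ha : 1 ≤ a) {f : ℝ → ℝ}
    (hf : f ∈ cosSpan (Set.Icc a b)) :
    (fun x => Real.cos (Real.pi * x) * f x) ∈ cosSpan (Set.Icc (a - 1) (b + 1)) := by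
  refine Submodule.span_induction (p := fun f _ => (fun x => Real.cos (Real.pi * x) * f x) ∈
    cosSpan (Set.Icc (a - 1) (b + 1))) ?_ ?_ ?_ ?_ hf
  · rintro _ ⟨k, ⟨hk1, hk2⟩, rfl⟩
    have m1 : cosBasis (k + 1) ∈ cosSpan (Set.Icc (a - 1) (b + 1)) :=
      cosBasis_mem_cosSpan ⟨by omega, by omega⟩
    have m2 : cosBasis (k - 1) ∈ cosSpan (Set.Icc (a - 1) (b + 1)) :=
      cosBasis_mem_cosSpan ⟨by omega, by omega⟩
    have hs : √2 * √2 = (2 : ℝ) := Real.mul_self_sqrt (by norm_num)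
    -- The frequency k = 1 is special: its lower neighbour φ₀ = 1 lacks the factor √2.
    rcases Nat.lt_or_ge k 2 with hk | hk
    · obtain rfl : k = 1 := by omega
      convert! Submodule.add_mem _ (Submodule.smul_mem _ (1 / 2 : ℝ) m1)
        (Submodule.smul_mem _ (√2 / 2 : ℝ) m2) using 1
      ext x
      simp only [cosBasis, Pi.add_apply, Pi.smul_apply, smul_eq_mul]
      have := Real.cos_sq (Real.pi * x)
      rw [sq] at this
      norm_num
      rw [show Real.cos (Real.pi * x) * (√2 * Real.cos (Real.pi * x))
        = √2 * (Real.cos (Real.pi * x) * Real.cos (Real.pi * x)) by ring, this,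
        show Real.pi * 2 * x = 2 * (Real.pi * x) by ring]
      ring
    · convert! Submodule.add_mem _ (Submodule.smul_mem _ (1 / 2 : ℝ) m1)
        (Submodule.smul_mem _ (1 / 2 : ℝ) m2) using 1
      ext x
      have h1 : k ≠ 0 := by omega
      have h2 : k - 1 ≠ 0 := by omega
      simp only [cosBasis, Pi.add_apply, Pi.smul_apply, smul_eq_mul, h1, h2, if_false,
        Nat.succ_ne_zero]
      rw [Nat.cast_sub (by omega)]
      push_cast
      have := Real.two_mul_cos_mul_cos (Real.pi * k * x) (Real.pi * x)
      rw [show Real.pi * (k + 1) * x = Real.pi * k * x + Real.pi * x by ring,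
        show Real.pi * (k - 1) * x = Real.pi * k * x - Real.pi * x by ring]
      linear_combination (√2 / 2) * this
  · simp only [Pi.zero_apply, mul_zero]
    exact Submodule.zero_mem _
  · intro f g _ _ hf hg
    convert! Submodule.add_mem _ hf hg using 1
    ext x; simp [mul_add]
  · intro c f _ hf
    convert! Submodule.smul_mem _ c hf using 1
    ext x; simp only [Pi.smul_apply, smul_eq_mul]; ring

/-- The polynomial `q` evaluated at `cos(π x)`. -/
def cosPoly (q : Polynomial ℝ) (x : ℝ) : ℝ := q.eval (Real.cos (Real.pi * x))

theorem continuous_cosPoly (q : Polynomial ℝ) : Continuous (cosPoly q) := by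
  unfold cosPoly; fun_prop

theorem cosPoly_mul_mem_cosSpan (q : Polynomial ℝ) {j : ℕ} (hj : q.natDegree < j) :
    (fun x => cosPoly q x * cosBasis j x)
      ∈ cosSpan (Set.Icc (j - q.natDegree) (j + q.natDegree)) := by
  have hpow : ∀ i : ℕ, i < j → (fun x => Real.cos (Real.pi * x) ^ i * cosBasis j x)
      ∈ cosSpan (Set.Icc (j - i) (j + i)) := by
    intro i
    induction i with
    | zero => intro _; simpa using cosBasis_mem_cosSpan (Set.mem_singleton j)
    | succ i ih =>
      intro hi
      have := cos_mul_mem_cosSpan (a := j - i) (by omega) (ih (by omega))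
      convert! this using 1
      ext x; ring
  have e : (fun x => cosPoly q x * cosBasis j x) = ∑ i ∈ Finset.range (q.natDegree + 1),
      q.coeff i • (fun x => Real.cos (Real.pi * x) ^ i * cosBasis j x) := by
    ext x
    simp only [cosPoly, Polynomial.eval_eq_sum_range, Finset.sum_mul, Finset.sum_apply,
      Pi.smul_apply, smul_eq_mul, mul_assoc]
  rw [e]
  refine Submodule.sum_mem _ fun i hi => Submodule.smul_mem _ _ ?_
  have hi' := Finset.mem_range.1 hi
  exact cosSpan_mono (Set.Icc_subset_Icc (by omega) (by omega)) (hpow i (by omega))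

/-- One has φⱼ² = 1 + φ₂ⱼ/√2, and u² φ₂ⱼ has no constant term because u² has degree below 2j. The
identity is exact, so every modulated basis function has the same norm. -/
theorem integral_cosPoly_sq_mul_cosBasis_sq (q : Polynomial ℝ) {j : ℕ} (hj : q.natDegree < j) :
    ∫ x in (0 : ℝ)..1, cosPoly q x ^ 2 * cosBasis j x ^ 2
      = ∫ x in (0 : ℝ)..1, cosPoly q x ^ 2 := by
  have hd : (q ^ 2).natDegree < 2 * j := by rw [Polynomial.natDegree_pow]; omega
  have h1 := cosPoly_mul_mem_cosSpan (q ^ 2) hd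
  have h2 : cosCoef (fun x => cosPoly (q ^ 2) x * cosBasis (2 * j) x) 0 = 0 := by
    rw [← Finset.coe_Icc] at h1
    refine (cosSpan_expansion h1).2 0 ?_
    simp; omega
  have hj0 : j ≠ 0 := by omega
  have hs : √2 * √2 = (2 : ℝ) := Real.mul_self_sqrt (by norm_num)
  have e : ∀ x, cosPoly q x ^ 2 * cosBasis j x ^ 2 = cosPoly q x ^ 2
      + (1 / √2) * (cosPoly (q ^ 2) x * cosBasis (2 * j) x * cosBasis 0 x) := by
    intro x
    simp only [cosPoly, cosBasis, Polynomial.eval_pow, hj0, if_false, if_true, mul_eq_zero,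
      OfNat.ofNat_ne_zero, or_self, mul_one]
    have h3 := Real.cos_sq (Real.pi * j * x)
    rw [mul_pow, Real.sq_sqrt (by norm_num), h3]
    push_cast
    rw [show Real.pi * (2 * j) * x = 2 * (Real.pi * j * x) by ring]
    field_simp
  have hc : Continuous fun x => cosPoly (q ^ 2) x * cosBasis (2 * j) x * cosBasis 0 x :=
    ((continuous_cosPoly _).mul (continuous_cosBasis _)).mul (continuous_cosBasis _)
  simp_rw [e]
  rw [intervalIntegral.integral_add (by exact ((continuous_cosPoly q).pow 2).intervalIntegrable _ _)
    (by exact (continuous_const.mul hc).intervalIntegrable _ _), intervalIntegral.integral_const_mul]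
  rw [cosCoef] at h2
  rw [h2]; ring

end Cosine

/-! ### Finite cosine perturbations of the pivot lie in the class -/

section Membership

theorem hasSum_shift_of_support {G : ℕ → ℝ} {s : Finset ℕ} {M : ℕ} (hs : ∀ k ∈ s, M ≤ k)
    (hG : ∀ k ∉ s, G k = 0) : HasSum (fun k => G (M + k)) (∑ k ∈ s, G k) := by
  have hinj : Function.Injective fun k : ℕ => M + k := add_right_injective M
  refine (hinj.hasSum_iff (f := G) fun k hk => hG k fun hks => hk ?_).2 (hasSum_sum_of_ne_finset_zero hG)
  exact ⟨k - M, by have := hs k hks; simp only; omega⟩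

/-- The part of the cosine expansion of the pivot below frequency `M`. -/
def pivotPart (f₀ : ℝ → ℝ) (M : ℕ) (x : ℝ) : ℝ :=
  ∑ j ∈ Finset.range M, cosCoef f₀ j * cosBasis j x

theorem continuous_pivotPart (f₀ : ℝ → ℝ) (M : ℕ) : Continuous (pivotPart f₀ M) :=
  continuous_finsetSum _ fun i _ => continuous_const.mul (continuous_cosBasis i)

/-- A perturbation with all frequencies at least `M` leaves the pivot coefficients alone, and every
series in the definition of the class reduces to a finite sum. -/
theorem pivotPart_add_mem_pivotClass {f₀ : ℝ → ℝ} {ρ : ℝ≥0∞} {M : ℕ} {α Q : ℝ} {s : Finset ℕ}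
    (hs : ∀ k ∈ s, M ≤ k) {h : ℝ → ℝ} (hh : h ∈ cosSpan (s : Set ℕ))
    (hS : ∑ k ∈ s, (1 + (Real.pi * (k : ℝ)) ^ (2 * α)) * cosCoef h k ^ 2 ≤ Q) {t : ℝ}
    (ht : ∀ x ∈ Set.Icc (0 : ℝ) 1, |h x| ≤ t) (htρ : ENNReal.ofReal t < ρ) :
    (fun x => pivotPart f₀ M x + h x) ∈ pivotClass f₀ ρ M α Q := by
  obtain ⟨hexp, hzero⟩ := cosSpan_expansion hh
  set f : ℝ → ℝ := fun x => pivotPart f₀ M x + h x with hf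
  set c : ℕ → ℝ := fun k => if k < M then cosCoef f₀ k else cosCoef h k with hc
  have hdisj : Disjoint (Finset.range M) s := by
    rw [Finset.disjoint_left]
    intro k hk hks
    exact absurd (hs k hks) (not_le.2 (Finset.mem_range.1 hk))
  have hfc : f = fun x => ∑ k ∈ Finset.range M ∪ s, c k * cosBasis k x := by
    ext x
    rw [Finset.sum_union hdisj, hf]
    simp only [pivotPart]
    congr 1
    · exact Finset.sum_congr rfl fun k hk => by simp [hc, Finset.mem_range.1 hk]
    · refine (congrFun hexp x).trans (Finset.sum_congr rfl fun k hk => ?_)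
      simp [hc, not_lt.2 (hs k hk)]
  have hcoef : ∀ k, M ≤ k → cosCoef f k = cosCoef h k := by
    intro k hk
    rw [hfc, cosCoef_finset_sum]
    split_ifs with hm
    · simp [hc, not_lt.2 hk]
    · exact (hzero k fun hks => hm (Finset.mem_union_right _ hks)).symm
  have hcoef' : ∀ k, cosCoef f (M + k) = cosCoef h (M + k) := fun k => hcoef _ (by omega)
  have hsob := hasSum_shift_of_support
    (G := fun k : ℕ => (1 + (Real.pi * (k : ℝ)) ^ (2 * α)) * cosCoef h k ^ 2) hs
    (fun k hk => by simp [hzero k hk])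
  refine ⟨fun x _ => ?_, ?_, ?_, ?_⟩
  · have e : ∀ j, (if j < M then cosCoef f₀ j else cosCoef f j) = c j := by
      intro j
      by_cases hj : j < M
      · simp [hc, hj]
      · simp [hc, hj, hcoef j (not_lt.1 hj)]
    simp_rw [e]
    rw [hfc]
    refine hasSum_sum_of_ne_finset_zero fun j hj => ?_
    simp only [Finset.mem_union, Finset.mem_range, not_or] at hj
    simp [hc, hj.1, hzero j hj.2]
  · simp_rw [hcoef']; exact hsob.summable
  · simp_rw [hcoef']; rw [hsob.tsum_eq]; exact hS
  · refine lt_of_le_of_lt (iSup₂_le fun x hx => ENNReal.ofReal_le_ofReal ?_) htρ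
    have := hasSum_shift_of_support (G := fun k : ℕ => cosCoef h k * cosBasis k x) hs
      (fun k hk => by simp [hzero k hk])
    simp_rw [hcoef']
    rw [this.tsum_eq]
    exact (congrArg abs (congrFun hexp x)).ge.trans (ht x hx)

end Membership

/-! ### The modulated prior and its Bayes bound -/

section Prior

/-- The functions spanning the prior: scaled products of `cosPoly q` and basis cosines. -/
def modBasis (q : Polynomial ℝ) (lam : ℕ → ℝ) (j : ℕ) (x : ℝ) : ℝ :=
  √(lam j) * (cosPoly q x * cosBasis j x)

theorem continuous_modBasis (q : Polynomial ℝ) (lam : ℕ → ℝ) (j : ℕ) :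
    Continuous (modBasis q lam j) :=
  continuous_const.mul ((continuous_cosPoly q).mul (continuous_cosBasis j))

theorem sum_modBasis_eq (q : Polynomial ℝ) (lam : ℕ → ℝ) (s : Finset ℕ) (y : ℕ → ℝ) (x : ℝ) :
    ∑ j ∈ s, y j * modBasis q lam j x
      = cosPoly q x * ∑ j ∈ s, (y j * √(lam j)) * cosBasis j x := by
  rw [Finset.mul_sum]
  exact Finset.sum_congr rfl fun j _ => by rw [modBasis]; ring

variable {q : Polynomial ℝ} {C : ℝ}

theorem integral_cosPoly_mul_sum_sq_le (hC : ∀ x, |cosPoly q x| ≤ C) (s : Finset ℕ) (y : ℕ → ℝ) :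
    ∫ x in (0 : ℝ)..1, (cosPoly q x * ∑ j ∈ s, y j * cosBasis j x) ^ 2
      ≤ C ^ 2 * ∑ j ∈ s, y j ^ 2 := by
  have hc : Continuous fun x => ∑ j ∈ s, y j * cosBasis j x :=
    continuous_finsetSum _ fun i _ => continuous_const.mul (continuous_cosBasis i)
  rw [← integral_sq_finset_sum, ← intervalIntegral.integral_const_mul]
  refine intervalIntegral.integral_mono_on zero_le_one
    ((((continuous_cosPoly q).mul hc).pow 2).intervalIntegrable _ _)
    ((continuous_const.mul (hc.pow 2)).intervalIntegrable _ _) fun x _ => ?_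
  rw [mul_pow]
  exact mul_le_mul_of_nonneg_right (sq_le_sq' (neg_le_of_abs_le (hC x)) (le_of_abs_le (hC x)))
    (sq_nonneg _)

theorem integral_Icc_eq_interval (f : ℝ → ℝ) :
    ∫ x in Set.Icc (0 : ℝ) 1, f x = ∫ x in (0 : ℝ)..1, f x := by
  rw [integral_Icc_eq_integral_Ioc, intervalIntegral.integral_of_le zero_le_one]

theorem integrableOn_unit {f : ℝ → ℝ} (hf : Continuous f) :
    Integrable f (volume.restrict (Set.Icc (0 : ℝ) 1)) :=
  hf.continuousOn.integrableOn_compact isCompact_Icc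

/-- The quadratic information term, when `𝓘 u²` exceeds `1` by at most `τ` in mean. -/
theorem integral_info_le {I : ℝ → ℝ} {τ : ℝ}
    (hI : Integrable I (volume.restrict (Set.Icc (0 : ℝ) 1))) (hC : ∀ x, |cosPoly q x| ≤ C)
    (hτ : ∫ y in Set.Icc (0 : ℝ) 1, max (I y * cosPoly q y ^ 2 - 1) 0 ≤ τ)
    (s : Finset ℕ) (hs : ∀ j ∈ s, q.natDegree < j) (γ : ℕ → ℝ) :
    Integrable (fun x => ∫ y in Set.Icc (0 : ℝ) 1, I y * (∑ j ∈ s, γ j *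
      (cosPoly q x * cosBasis j x) * (cosPoly q y * cosBasis j y)) ^ 2)
      (volume.restrict (Set.Icc (0 : ℝ) 1)) ∧
    ∫ x in Set.Icc (0 : ℝ) 1, ∫ y in Set.Icc (0 : ℝ) 1, I y * (∑ j ∈ s, γ j *
      (cosPoly q x * cosBasis j x) * (cosPoly q y * cosBasis j y)) ^ 2
      ≤ (∫ x in (0 : ℝ)..1, cosPoly q x ^ 2) * ∑ j ∈ s, γ j ^ 2
        + 2 * C ^ 2 * τ * ∑ j ∈ s, γ j ^ 2 := by
  set μ := volume.restrict (Set.Icc (0 : ℝ) 1) with hμ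
  have : IsProbabilityMeasure μ := ⟨by simp [hμ]⟩
  set u := cosPoly q with hu
  have huc : Continuous u := continuous_cosPoly q
  have hC0 : 0 ≤ C := (abs_nonneg _).trans (hC 0)
  set K : ℝ → ℝ → ℝ := fun x y => ∑ j ∈ s, γ j * cosBasis j x * cosBasis j y with hK
  have hKc : Continuous fun z : ℝ × ℝ => K z.1 z.2 :=
    continuous_finsetSum _ fun j _ => (continuous_const.mul
      ((continuous_cosBasis j).comp continuous_fst)).mul ((continuous_cosBasis j).comp continuous_snd)
  have hKsym : ∀ x y, K x y = K y x := fun x y => Finset.sum_congr rfl fun j _ => by ring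
  have hKint : ∀ x, ∫ y in (0 : ℝ)..1, K x y ^ 2 = ∑ j ∈ s, γ j ^ 2 * cosBasis j x ^ 2 := by
    intro x
    rw [integral_sq_finset_sum s (fun j => γ j * cosBasis j x)]
    exact Finset.sum_congr rfl fun j _ => by ring
  have hKB : ∃ B, ∀ x y, |K x y| ≤ B := by
    refine ⟨∑ j ∈ s, |γ j| * √2 * √2, fun x y => (Finset.abs_sum_le_sum_abs _ _).trans
      (Finset.sum_le_sum fun j _ => ?_)⟩
    rw [abs_mul, abs_mul]
    gcongr
    · exact abs_cosBasis_le j x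
    · exact abs_cosBasis_le j y
  obtain ⟨B, hB⟩ := hKB
  have hB0 : 0 ≤ B := (abs_nonneg _).trans (hB 0 0)
  set r : ℝ → ℝ := fun y => max (I y * u y ^ 2 - 1) 0 with hr
  have hIu : Integrable (fun y => I y * u y ^ 2) μ := by
    refine hI.mul_bdd (c := C ^ 2) (huc.pow 2).aestronglyMeasurable
      (Eventually.of_forall fun y => ?_)
    rw [norm_pow, Real.norm_eq_abs]
    gcongr
    exact hC y
  have hri : Integrable r μ := (hIu.sub (integrable_const 1)).pos_part
  have hr0 : ∀ y, 0 ≤ r y := fun y => le_max_right _ _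
  have prodInt : ∀ w : ℝ → ℝ, Integrable w μ →
      Integrable (fun z : ℝ × ℝ => w z.2 * (u z.1 ^ 2 * K z.1 z.2 ^ 2)) (μ.prod μ) := by
    intro w hw
    refine (hw.comp_snd μ).mul_bdd (c := C ^ 2 * B ^ 2)
      (((huc.comp continuous_fst).pow 2).mul (hKc.pow 2)).aestronglyMeasurable
      (Eventually.of_forall fun z => ?_)
    rw [norm_mul, norm_pow, norm_pow, Real.norm_eq_abs, Real.norm_eq_abs]
    gcongr
    · exact hC _
    · exact hB _ _
  have e1 : ∀ x y, I y * (∑ j ∈ s, γ j * (u x * cosBasis j x) * (u y * cosBasis j y)) ^ 2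
      = (I y * u y ^ 2) * (u x ^ 2 * K x y ^ 2) := by
    intro x y
    have : ∑ j ∈ s, γ j * (u x * cosBasis j x) * (u y * cosBasis j y) = u x * u y * K x y := by
      rw [hK, Finset.mul_sum]
      exact Finset.sum_congr rfl fun j _ => by ring
    rw [this]; ring
  simp_rw [e1]
  refine ⟨(prodInt _ hIu).integral_prod_left, ?_⟩
  have hr1 := prodInt r hri
  have h1 := prodInt (fun _ => 1) (integrable_const 1)
  -- With 𝓘u² replaced by 1, Parseval in y and the exact norms of u φⱼ in x evaluate the double
  -- integral.
  have e2 : ∫ x, ∫ y, (1 : ℝ) * (u x ^ 2 * K x y ^ 2) ∂μ ∂μ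
      = (∫ x in (0 : ℝ)..1, u x ^ 2) * ∑ j ∈ s, γ j ^ 2 := by
    simp_rw [one_mul, integral_const_mul]
    simp_rw [hμ, integral_Icc_eq_interval, hKint, Finset.mul_sum]
    rw [intervalIntegral.integral_finsetSum]
    · refine Finset.sum_congr rfl fun j hj => ?_
      rw [← integral_cosPoly_sq_mul_cosBasis_sq q (hs j hj), ← intervalIntegral.integral_mul_const]
      exact intervalIntegral.integral_congr fun x _ => by ring
    · intro j _
      exact Continuous.intervalIntegrable ((huc.pow 2).mul (continuous_const.mul
        ((continuous_cosBasis j).pow 2))) _ _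
  -- For the excess r = (𝓘u² - 1)⁺ the integral over x is taken first: it is bounded uniformly in y,
  -- so only the mean of r matters.
  have e3 : ∫ x, ∫ y, r y * (u x ^ 2 * K x y ^ 2) ∂μ ∂μ ≤ 2 * C ^ 2 * τ * ∑ j ∈ s, γ j ^ 2 := by
    rw [integral_integral_swap (f := fun x y => r y * (u x ^ 2 * K x y ^ 2)) hr1]
    have hin : ∀ y, ∫ x, r y * (u x ^ 2 * K x y ^ 2) ∂μ ≤ r y * (C ^ 2 * (2 * ∑ j ∈ s, γ j ^ 2)) := by
      intro y
      rw [integral_const_mul]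
      refine mul_le_mul_of_nonneg_left ?_ (hr0 y)
      have hx : Continuous fun x => K x y := continuous_finsetSum _ fun j _ =>
        (continuous_const.mul (continuous_cosBasis j)).mul continuous_const
      calc ∫ x, u x ^ 2 * K x y ^ 2 ∂μ ≤ ∫ x, C ^ 2 * K x y ^ 2 ∂μ := by
            refine integral_mono (integrableOn_unit ((huc.pow 2).mul (hx.pow 2)))
              (integrableOn_unit (continuous_const.mul (hx.pow 2))) fun x => ?_
            exact mul_le_mul_of_nonneg_right
              (sq_le_sq' (neg_le_of_abs_le (hC x)) (le_of_abs_le (hC x))) (sq_nonneg _)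
        _ = C ^ 2 * ∑ j ∈ s, γ j ^ 2 * cosBasis j y ^ 2 := by
            rw [integral_const_mul, hμ, integral_Icc_eq_interval, ← hKint]
            simp_rw [hKsym y]
        _ ≤ C ^ 2 * (2 * ∑ j ∈ s, γ j ^ 2) := by
            gcongr
            rw [Finset.mul_sum]
            refine Finset.sum_le_sum fun j _ => ?_
            rw [mul_comm]
            gcongr
            exact cosBasis_sq_le j y
    have hr2 : Integrable (fun y => ∫ x, r y * (u x ^ 2 * K x y ^ 2) ∂μ) μ :=
      Integrable.integral_prod_right (f := fun z : ℝ × ℝ => r z.2 * (u z.1 ^ 2 * K z.1 z.2 ^ 2)) hr1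
    have hm : ∫ y, ∫ x, r y * (u x ^ 2 * K x y ^ 2) ∂μ ∂μ
        ≤ ∫ y, r y * (C ^ 2 * (2 * ∑ j ∈ s, γ j ^ 2)) ∂μ :=
      integral_mono hr2 (hri.mul_const _) hin
    refine hm.trans ?_
    rw [integral_mul_const]
    have h2 : 0 ≤ C ^ 2 * (2 * ∑ j ∈ s, γ j ^ 2) := by positivity
    calc _ ≤ τ * (C ^ 2 * (2 * ∑ j ∈ s, γ j ^ 2)) := mul_le_mul_of_nonneg_right hτ h2
      _ = _ := by ring
  rw [← e2]
  refine le_trans ?_ (add_le_add_right e3 _)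
  rw [← integral_add h1.integral_prod_left hr1.integral_prod_left]
  refine integral_mono_ae (prodInt _ hIu).integral_prod_left
    (h1.integral_prod_left.add hr1.integral_prod_left) ?_
  filter_upwards [(prodInt _ hIu).prod_right_ae, h1.prod_right_ae, hr1.prod_right_ae]
    with x hx1 hx2 hx3
  rw [← integral_add hx2 hx3]
  refine integral_mono hx1 (hx2.add hx3) fun y => ?_
  rw [← add_mul]
  refine mul_le_mul_of_nonneg_right ?_ (by positivity)
  have := le_max_left (I y * u y ^ 2 - 1) 0
  simp only [hr]
  linarith

/-- The Bayes bound of the prior with variances `lam`, evaluated. -/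
theorem bayes_bound_ge {I : ℝ → ℝ} {τ : ℝ}
    (hI : Integrable I (volume.restrict (Set.Icc (0 : ℝ) 1))) (hC : ∀ x, |cosPoly q x| ≤ C)
    (hτ : ∫ y in Set.Icc (0 : ℝ) 1, max (I y * cosPoly q y ^ 2 - 1) 0 ≤ τ)
    (s : Finset ℕ) (hs : ∀ j ∈ s, q.natDegree < j) {lam : ℕ → ℝ} (hlam : ∀ j, 0 ≤ lam j) (n : ℕ) :
    (∫ x in (0 : ℝ)..1, cosPoly q x ^ 2) * ∑ j ∈ s, lam j / (1 + n * lam j)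
        - 2 * C ^ 2 * τ * n * ∑ j ∈ s, (lam j / (1 + n * lam j)) ^ 2
      ≤ ∫ x in Set.Icc (0 : ℝ) 1, (∑ j : s, (2 * (1 / (1 + n * lam j)) - (1 / (1 + n * lam j)) ^ 2)
          * modBasis q lam j x ^ 2
        - n * ∫ y in Set.Icc (0 : ℝ) 1, I y *
          (∑ j : s, 1 / (1 + n * lam j) * modBasis q lam j x * modBasis q lam j y) ^ 2) := by
  set γ : ℕ → ℝ := fun j => lam j / (1 + n * lam j) with hγ
  obtain ⟨hi, hle⟩ := integral_info_le hI hC hτ s hs γ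
  have e1 : ∀ x y, ∑ j : s, 1 / (1 + n * lam j) * modBasis q lam j x * modBasis q lam j y
      = ∑ j ∈ s, γ j * (cosPoly q x * cosBasis j x) * (cosPoly q y * cosBasis j y) := by
    intro x y
    rw [Finset.sum_coe_sort s
      (fun j => 1 / (1 + n * lam j) * modBasis q lam j x * modBasis q lam j y)]
    refine Finset.sum_congr rfl fun j _ => ?_
    have := Real.mul_self_sqrt (hlam j)
    simp only [hγ, modBasis]
    rw [div_eq_mul_one_div, ← this, Real.sqrt_mul_self (Real.sqrt_nonneg _)]
    ring
  -- With β = 1/(1+nλ) and γ = λ/(1+nλ), λ(2β - β²) = γ + nγ². The surplus nγ² is what the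
  -- information term takes away when 𝓘u² = 1.
  have e2 : ∀ x, ∑ j : s, (2 * (1 / (1 + n * lam j)) - (1 / (1 + n * lam j)) ^ 2)
      * modBasis q lam j x ^ 2
      = ∑ j ∈ s, (γ j + n * γ j ^ 2) * (cosPoly q x ^ 2 * cosBasis j x ^ 2) := by
    intro x
    rw [Finset.sum_coe_sort s (fun j => (2 * (1 / (1 + n * lam j)) - (1 / (1 + n * lam j)) ^ 2)
      * modBasis q lam j x ^ 2)]
    refine Finset.sum_congr rfl fun j _ => ?_
    simp only [hγ, modBasis, mul_pow, Real.sq_sqrt (hlam j)]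
    have : 1 + n * lam j ≠ 0 := by have := hlam j; positivity
    field_simp
    ring
  simp_rw [e1, e2]
  have hci : ∀ j, Continuous fun x => cosPoly q x ^ 2 * cosBasis j x ^ 2 := fun j =>
    ((continuous_cosPoly q).pow 2).mul ((continuous_cosBasis j).pow 2)
  have hsum : Integrable (fun x => ∑ j ∈ s, (γ j + n * γ j ^ 2) *
      (cosPoly q x ^ 2 * cosBasis j x ^ 2)) (volume.restrict (Set.Icc (0 : ℝ) 1)) :=
    integrableOn_unit (continuous_finsetSum _ fun j _ => continuous_const.mul (hci j))
  rw [integral_sub hsum (hi.const_mul _), integral_const_mul, integral_finsetSum s (f := fun j x =>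
    (γ j + n * γ j ^ 2) * (cosPoly q x ^ 2 * cosBasis j x ^ 2)) fun j _ =>
    integrableOn_unit (continuous_const.mul (hci j))]
  have e3 : ∀ j ∈ s, ∫ x in Set.Icc (0 : ℝ) 1, (γ j + n * γ j ^ 2) *
      (cosPoly q x ^ 2 * cosBasis j x ^ 2)
      = (γ j + n * γ j ^ 2) * ∫ x in (0 : ℝ)..1, cosPoly q x ^ 2 := by
    intro j hj
    rw [integral_const_mul, integral_Icc_eq_interval,
      integral_cosPoly_sq_mul_cosBasis_sq q (hs j hj)]
  rw [Finset.sum_congr rfl e3, ← Finset.sum_mul, Finset.sum_add_distrib, ← Finset.mul_sum]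
  have hn : (0 : ℝ) ≤ n := Nat.cast_nonneg n
  have := mul_le_mul_of_nonneg_left hle hn
  nlinarith [this]

theorem lintegral_prior_sq_le (hC : ∀ x, |cosPoly q x| ≤ C) (s : Finset ℕ) {lam : ℕ → ℝ}
    (hlam : ∀ j, 0 ≤ lam j) (ζ : s → ℝ) :
    ∫⁻ x in Set.Icc (0 : ℝ) 1, ENNReal.ofReal ((∑ j, ζ j * modBasis q lam j x) ^ 2)
      ≤ ENNReal.ofReal (C ^ 2 * ∑ j : s, lam j * ζ j ^ 2) := by
  set y : ℕ → ℝ := fun j => if hj : j ∈ s then ζ ⟨j, hj⟩ else 0 with hy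
  have hyζ : ∀ j : s, y j = ζ j := fun j => by simp [hy]
  simp_rw [← hyζ]
  have e1 : ∀ x, ∑ j : s, y j * modBasis q lam j x
      = cosPoly q x * ∑ j ∈ s, (y j * √(lam j)) * cosBasis j x := fun x => by
    rw [Finset.sum_coe_sort s (fun j => y j * modBasis q lam j x), sum_modBasis_eq]
  rw [Finset.sum_coe_sort s (fun j => lam j * y j ^ 2)]
  simp_rw [e1]
  have hc : Continuous fun x => (cosPoly q x * ∑ j ∈ s, (y j * √(lam j)) * cosBasis j x) ^ 2 :=
    ((continuous_cosPoly q).mul (continuous_finsetSum _ fun i _ =>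
      continuous_const.mul (continuous_cosBasis i))).pow 2
  rw [← ofReal_integral_eq_lintegral_ofReal (integrableOn_unit hc)
    (Eventually.of_forall fun x => sq_nonneg _), integral_Icc_eq_interval]
  refine ENNReal.ofReal_le_ofReal ((integral_cosPoly_mul_sum_sq_le hC s _).trans (le_of_eq ?_))
  congr 1
  refine Finset.sum_congr rfl fun j _ => ?_
  rw [mul_pow, Real.sq_sqrt (hlam j)]; ring

end Prior

/-! ### Tails of Gaussian quadratic forms -/

section Tail

variable {ι : Type*} [Fintype ι]

/-- Variance of a weighted sum of squares of jointly Gaussian variables. -/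
theorem integral_sq_sum_dot_sq_sub (t : Finset ℕ) (w : ℕ → ℝ) (G : ℕ → ι → ℝ) :
    Integrable (fun z => (∑ k ∈ t, w k * (∑ j, G k j * z j) ^ 2
        - ∑ k ∈ t, w k * ∑ j, G k j ^ 2) ^ 2) (gaussPi ι) ∧
    ∫ z, (∑ k ∈ t, w k * (∑ j, G k j * z j) ^ 2 - ∑ k ∈ t, w k * ∑ j, G k j ^ 2) ^ 2 ∂(gaussPi ι)
      = 2 * ∑ k ∈ t, w k * ∑ l ∈ t, w l * (∑ j, G l j * G k j) ^ 2 := by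
  obtain ⟨A, hA⟩ : ∃ A : ℕ → ℝ, ∀ k, ∑ j, G k j ^ 2 = A k := ⟨_, fun _ => rfl⟩
  simp only [hA]
  have e : ∀ z : ι → ℝ, (∑ k ∈ t, w k * (∑ j, G k j * z j) ^ 2 - ∑ k ∈ t, w k * A k) ^ 2
      = ∑ k ∈ t, ∑ l ∈ t, w k * w l * ((∑ j, G k j * z j) ^ 2 * (∑ j, G l j * z j) ^ 2
        - A l * (∑ j, G k j * z j) ^ 2 - A k * (∑ j, G l j * z j) ^ 2 + A k * A l) := by
    intro z
    rw [← Finset.sum_sub_distrib, sq, Finset.sum_mul_sum]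
    exact Finset.sum_congr rfl fun k _ => Finset.sum_congr rfl fun l _ => by ring
  have hint : ∀ k l, Integrable (fun z : ι → ℝ => (∑ j, G k j * z j) ^ 2 * (∑ j, G l j * z j) ^ 2
        - A l * (∑ j, G k j * z j) ^ 2 - A k * (∑ j, G l j * z j) ^ 2 + A k * A l) (gaussPi ι) :=
    fun k l => (((integrable_dot_sq_mul_dot_sq (G k) (G l)).sub
      ((integrable_dot_pow (G k) 2).const_mul _)).sub
        ((integrable_dot_pow (G l) 2).const_mul _)).add (integrable_const _)
  have hval : ∀ k l, ∫ z, ((∑ j, G k j * z j) ^ 2 * (∑ j, G l j * z j) ^ 2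
        - A l * (∑ j, G k j * z j) ^ 2 - A k * (∑ j, G l j * z j) ^ 2 + A k * A l) ∂(gaussPi ι)
      = 2 * (∑ j, G k j * G l j) ^ 2 := by
    intro k l
    have i1 := integrable_dot_sq_mul_dot_sq (G k) (G l)
    have i2 := (integrable_dot_pow (G k) 2).const_mul (A l)
    have i3 := (integrable_dot_pow (G l) 2).const_mul (A k)
    rw [integral_add (by exact (i1.sub i2).sub i3) (integrable_const _),
      integral_sub (by exact i1.sub i2) i3, integral_sub i1 i2, integral_const_mul,
      integral_const_mul, integral_dot_sq_mul_dot_sq, integral_dot_sq, integral_dot_sq]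
    simp only [hA, integral_const, probReal_univ, one_smul]
    ring
  simp_rw [e]
  refine ⟨integrable_finsetSum _ fun k _ => integrable_finsetSum _ fun l _ =>
    (hint k l).const_mul _, ?_⟩
  rw [integral_finsetSum _ fun k _ => integrable_finsetSum _ fun l _ => (hint k l).const_mul _,
    Finset.mul_sum]
  refine Finset.sum_congr rfl fun k _ => ?_
  rw [integral_finsetSum _ fun l _ => (hint k l).const_mul _, Finset.mul_sum, Finset.mul_sum]
  refine Finset.sum_congr rfl fun l _ => ?_
  rw [integral_const_mul, hval]
  simp_rw [mul_comm (G l _)]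
  ring

/-- Chebyshev's inequality for a weighted sum of squares of jointly Gaussian variables. -/
theorem gaussPi_quadratic_tail (t : Finset ℕ) {w : ℕ → ℝ} {G : ℕ → ι → ℝ} {wmax H m Q : ℝ}
    (hw0 : ∀ k ∈ t, 0 ≤ w k) (hw : ∀ k ∈ t, w k ≤ wmax) (hwmax : 0 ≤ wmax) (hH0 : 0 ≤ H)
    (hH : ∀ y : ι → ℝ, ∑ l ∈ t, (∑ j, G l j * y j) ^ 2 ≤ H * ∑ j, y j ^ 2)
    (hm : ∑ k ∈ t, w k * ∑ j, G k j ^ 2 ≤ m) (hmQ : m < Q) :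
    (gaussPi ι).real {z | Q < ∑ k ∈ t, w k * (∑ j, G k j * z j) ^ 2}
      ≤ 2 * wmax * H * m / (Q - m) ^ 2 := by
  obtain ⟨hi, hv⟩ := integral_sq_sum_dot_sq_sub t w G
  -- The squared covariances against row k are summed by applying the operator bound `hH` to the row
  -- `G k` itself; the variance is then of order wmax · H · m.
  have hCS : ∑ k ∈ t, w k * ∑ l ∈ t, w l * (∑ j, G l j * G k j) ^ 2
      ≤ wmax * H * m := by
    calc ∑ k ∈ t, w k * ∑ l ∈ t, w l * (∑ j, G l j * G k j) ^ 2
        ≤ ∑ k ∈ t, w k * (wmax * (H * ∑ j, G k j ^ 2)) := by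
          refine Finset.sum_le_sum fun k hk => mul_le_mul_of_nonneg_left ?_ (hw0 k hk)
          refine le_trans ?_ (mul_le_mul_of_nonneg_left (hH (G k)) hwmax)
          rw [Finset.mul_sum]
          exact Finset.sum_le_sum fun l hl => mul_le_mul_of_nonneg_right (hw l hl) (sq_nonneg _)
      _ = wmax * H * ∑ k ∈ t, w k * ∑ j, G k j ^ 2 := by
          rw [Finset.mul_sum]
          exact Finset.sum_congr rfl fun k _ => by ring
      _ ≤ _ := mul_le_mul_of_nonneg_left hm (mul_nonneg hwmax hH0)
  obtain ⟨m₀, hm₀⟩ : ∃ m₀, ∑ k ∈ t, w k * ∑ j, G k j ^ 2 = m₀ := ⟨_, rfl⟩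
  obtain ⟨S, hS⟩ : ∃ S : (ι → ℝ) → ℝ, ∀ z, ∑ k ∈ t, w k * (∑ j, G k j * z j) ^ 2 = S z :=
    ⟨_, fun _ => rfl⟩
  simp only [hm₀, hS] at hi hv hm hCS ⊢
  have hpos : 0 < Q - m := sub_pos.2 hmQ
  have hmk := mul_meas_ge_le_integral_of_nonneg
    (Eventually.of_forall fun z => sq_nonneg (S z - m₀)) hi ((Q - m) ^ 2)
  have hsub : (gaussPi ι).real {z | Q < S z} ≤ (gaussPi ι).real {z | (Q - m) ^ 2 ≤ (S z - m₀) ^ 2} :=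
    measureReal_mono fun z (hz : Q < S z) => pow_le_pow_left₀ hpos.le (by linarith) 2
  rw [le_div_iff₀ (pow_pos hpos 2)]
  have h1 := mul_le_mul_of_nonneg_right hsub (sq_nonneg (Q - m))
  rw [hv] at hmk
  linarith

/-- The pointwise inequality ζ² ≤ L + ζ⁴/L with Eζ⁴ = 3 trades the second moment on a rare event for
its probability, with L free. -/
theorem setLIntegral_sq_le (Γ : Set (ι → ℝ)) (i : ι) {L : ℝ} (hL : 0 < L) :
    ∫⁻ ζ in Γ, ENNReal.ofReal (ζ i ^ 2) ∂(gaussPi ι)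
      ≤ ENNReal.ofReal (L * (gaussPi ι).real Γ + 3 / L) := by
  classical
  have h4 : ∫ ζ, ζ i ^ 4 ∂(gaussPi ι) = 3 ∧ Integrable (fun ζ : ι → ℝ => ζ i ^ 4) (gaussPi ι) := by
    have h1 := integral_dot_pow_four (Pi.single i 1 : ι → ℝ)
    have h2 := integrable_dot_pow (Pi.single i 1 : ι → ℝ) 4
    simp [Pi.single_apply] at h1 h2
    exact ⟨h1, h2⟩
  have hle : ∀ ζ : ι → ℝ, ENNReal.ofReal (ζ i ^ 2)
      ≤ ENNReal.ofReal L + ENNReal.ofReal (ζ i ^ 4 / L) := by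
    intro ζ
    rw [← ENNReal.ofReal_add hL.le (by positivity)]
    apply ENNReal.ofReal_le_ofReal
    rw [← sub_nonneg]
    have : L + ζ i ^ 4 / L - ζ i ^ 2 = ((L - ζ i ^ 2 / 2) ^ 2 + 3 / 4 * (ζ i ^ 2) ^ 2) / L := by
      field_simp; ring
    rw [this]; positivity
  have hmi : Measurable fun ζ : ι → ℝ => ζ i := measurable_pi_apply i
  have hm : Measurable fun ζ : ι → ℝ => ENNReal.ofReal (ζ i ^ 4 / L) :=
    ((hmi.pow_const 4).div_const L).ennreal_ofReal
  calc _ ≤ ∫⁻ ζ in Γ, (ENNReal.ofReal L + ENNReal.ofReal (ζ i ^ 4 / L)) ∂(gaussPi ι) :=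
        lintegral_mono hle
    _ = ENNReal.ofReal L * gaussPi ι Γ + ∫⁻ ζ in Γ, ENNReal.ofReal (ζ i ^ 4 / L) ∂(gaussPi ι) := by
        rw [lintegral_add_right _ hm, setLIntegral_const]
    _ ≤ ENNReal.ofReal (L * (gaussPi ι).real Γ) + ENNReal.ofReal (3 / L) := by
        refine add_le_add (le_of_eq ?_) ((setLIntegral_le_lintegral _ _).trans (le_of_eq ?_))
        · rw [ENNReal.ofReal_mul hL.le, ofReal_measureReal]
        · rw [← ofReal_integral_eq_lintegral_ofReal (h4.2.div_const L)
            (Eventually.of_forall fun ζ => by positivity), integral_div, h4.1]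
    _ = _ := (ENNReal.ofReal_add (by positivity) (by positivity)).symm

end Tail

/-! ### Fourier coefficients of prior draws -/

section Coefficients

variable {q : Polynomial ℝ} {C : ℝ}

/-- Cosine coefficients of `cosPoly q * φⱼ`. -/
def modCoef (q : Polynomial ℝ) (k j : ℕ) : ℝ := cosCoef (fun x => cosPoly q x * cosBasis j x) k

theorem cosCoef_sum_modBasis (q : Polynomial ℝ) (lam : ℕ → ℝ) (s : Finset ℕ) (y : s → ℝ) (k : ℕ) :
    cosCoef (fun x => ∑ j, y j * modBasis q lam j x) k
      = ∑ j : s, √(lam j) * modCoef q k j * y j := by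
  unfold cosCoef
  simp_rw [Finset.sum_mul]
  rw [intervalIntegral.integral_finsetSum]
  · refine Finset.sum_congr rfl fun j _ => ?_
    have e : ∀ x, y j * modBasis q lam j x * cosBasis k x
        = (y j * √(lam j)) * (cosPoly q x * cosBasis j x * cosBasis k x) := fun x => by
      rw [modBasis]; ring
    simp_rw [e]
    rw [intervalIntegral.integral_const_mul, modCoef, cosCoef]
    ring
  · intro j _
    exact ((continuous_const.mul (continuous_modBasis q lam j)).mul
      (continuous_cosBasis k)).intervalIntegrable _ _

theorem continuous_sum_modBasis (q : Polynomial ℝ) (lam : ℕ → ℝ) (s : Finset ℕ) (y : s → ℝ) :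
    Continuous fun x => ∑ j, y j * modBasis q lam j x :=
  continuous_finsetSum _ fun j _ => continuous_const.mul (continuous_modBasis q lam j)

theorem sum_modBasis_mem_cosSpan {lam : ℕ → ℝ} {s t : Finset ℕ}
    (hs : ∀ j ∈ s, q.natDegree < j)
    (ht : ∀ j ∈ s, Finset.Icc (j - q.natDegree) (j + q.natDegree) ⊆ t) (y : s → ℝ) :
    (fun x => ∑ j, y j * modBasis q lam j x) ∈ cosSpan (t : Set ℕ) := by
  have e : (fun x => ∑ j, y j * modBasis q lam j x)
      = ∑ j : s, (y j * √(lam j)) • fun x => cosPoly q x * cosBasis j x := by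
    ext x
    simp [modBasis, mul_assoc]
  rw [e]
  refine Submodule.sum_mem _ fun j _ => Submodule.smul_mem _ _ ?_
  refine cosSpan_mono ?_ (cosPoly_mul_mem_cosSpan q (hs j j.2))
  rw [← Finset.coe_Icc]
  exact_mod_cast ht j j.2

/-- Bessel's inequality for the function with coordinates y. This is the operator bound required by
the Chebyshev estimate. -/
theorem sum_sq_modCoef_le {lam : ℕ → ℝ} {s : Finset ℕ} (t : Finset ℕ) {Λ : ℝ} (hlam : ∀ j, 0 ≤ lam j)
    (hΛ : ∀ j ∈ s, lam j ≤ Λ) (hC : ∀ x, |cosPoly q x| ≤ C) (y : s → ℝ) :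
    ∑ k ∈ t, (∑ j : s, √(lam j) * modCoef q k j * y j) ^ 2 ≤ C ^ 2 * Λ * ∑ j, y j ^ 2 := by
  simp_rw [← cosCoef_sum_modBasis]
  refine (sum_cosCoef_sq_le (continuous_sum_modBasis q lam s y) t).trans ?_
  have h1 := lintegral_prior_sq_le hC s hlam y
  rw [← ofReal_integral_eq_lintegral_ofReal
    (by exact integrableOn_unit ((continuous_sum_modBasis q lam s y).pow 2))
    (Eventually.of_forall fun x => sq_nonneg _), integral_Icc_eq_interval] at h1
  have h0 : 0 ≤ C ^ 2 * ∑ j : s, lam j * y j ^ 2 :=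
    mul_nonneg (sq_nonneg _) (Finset.sum_nonneg fun j _ => mul_nonneg (hlam j) (sq_nonneg _))
  refine ((ENNReal.ofReal_le_ofReal_iff h0).1 h1).trans ?_
  rw [mul_assoc]
  refine mul_le_mul_of_nonneg_left ?_ (sq_nonneg _)
  rw [Finset.mul_sum]
  exact Finset.sum_le_sum fun j _ => mul_le_mul_of_nonneg_right (hΛ j j.2) (sq_nonneg _)

/-- Bound for the mean of the weighted sum of squared coefficients of a prior draw. -/
theorem sum_weight_modCoef_le {lam : ℕ → ℝ} {s t : Finset ℕ} {w W : ℕ → ℝ} (hlam : ∀ j, 0 ≤ lam j)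
    (hs : ∀ j ∈ s, q.natDegree < j) (hW0 : ∀ j ∈ s, 0 ≤ W j)
    (hW : ∀ j ∈ s, ∀ k ∈ Finset.Icc (j - q.natDegree) (j + q.natDegree), w k ≤ W j) :
    ∑ k ∈ t, w k * ∑ j : s, (√(lam j) * modCoef q k j) ^ 2
      ≤ (∫ x in (0 : ℝ)..1, cosPoly q x ^ 2) * ∑ j ∈ s, lam j * W j := by
  have e : ∀ k, ∑ j : s, (√(lam j) * modCoef q k j) ^ 2 = ∑ j ∈ s, lam j * modCoef q k j ^ 2 := by
    intro k
    rw [Finset.sum_coe_sort s (fun j => (√(lam j) * modCoef q k j) ^ 2)]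
    exact Finset.sum_congr rfl fun j _ => by rw [mul_pow, Real.sq_sqrt (hlam j)]
  simp_rw [e, Finset.mul_sum]
  rw [Finset.sum_comm]
  refine Finset.sum_le_sum fun j hj => ?_
  -- The coefficient matrix is banded with width given by the degree of `q`, so only weights at
  -- frequencies near j occur.
  have hzero : ∀ k, k ∉ Finset.Icc (j - q.natDegree) (j + q.natDegree) → modCoef q k j = 0 := by
    have h1 := cosPoly_mul_mem_cosSpan q (hs j hj)
    rw [← Finset.coe_Icc] at h1
    exact (cosSpan_expansion h1).2
  have hB : ∑ k ∈ t, modCoef q k j ^ 2 ≤ ∫ x in (0 : ℝ)..1, cosPoly q x ^ 2 := by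
    refine (sum_cosCoef_sq_le ((continuous_cosPoly q).mul (continuous_cosBasis j)) t).trans
      (le_of_eq ?_)
    rw [← integral_cosPoly_sq_mul_cosBasis_sq q (hs j hj)]
    exact intervalIntegral.integral_congr fun x _ => mul_pow _ _ 2
  calc ∑ k ∈ t, w k * (lam j * modCoef q k j ^ 2)
      ≤ ∑ k ∈ t, (lam j * W j) * modCoef q k j ^ 2 := by
        refine Finset.sum_le_sum fun k _ => ?_
        by_cases hk : k ∈ Finset.Icc (j - q.natDegree) (j + q.natDegree)
        · have := mul_le_mul_of_nonneg_right (hW j hj k hk)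
            (mul_nonneg (hlam j) (sq_nonneg (modCoef q k j)))
          linarith
        · simp [hzero k hk]
    _ ≤ _ := by
        rw [← Finset.mul_sum, mul_comm (∫ x in (0 : ℝ)..1, cosPoly q x ^ 2)]
        exact mul_le_mul_of_nonneg_left hB (mul_nonneg (hlam j) (hW0 j hj))

end Coefficients

/-! ### Lipschitz bounds and grids -/

section CosineSums

/-- Each φₖ is √2πk-Lipschitz; Cauchy–Schwarz over the finitely many frequencies converts a
first-order Sobolev bound into a Lipschitz constant. -/
theorem abs_sub_le_of_weighted_coef {t : Finset ℕ} {h : ℝ → ℝ} (hh : h ∈ cosSpan (t : Set ℕ)) {Q : ℝ}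
    (hQ : ∑ k ∈ t, (Real.pi * k) ^ 2 * cosCoef h k ^ 2 ≤ Q) (x y : ℝ) :
    |h x - h y| ≤ √(2 * t.card * Q) * |x - y| := by
  have hexp := (cosSpan_expansion hh).1
  have h1 : |h x - h y| ≤ ∑ k ∈ t, |cosCoef h k| * (√2 * (Real.pi * k) * |x - y|) := by
    have e : h x - h y = ∑ k ∈ t, cosCoef h k * (cosBasis k x - cosBasis k y) := by
      simp_rw [mul_sub]
      rw [Finset.sum_sub_distrib]
      exact congrArg₂ _ (congrFun hexp x) (congrFun hexp y)
    rw [e]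
    refine (Finset.abs_sum_le_sum_abs _ _).trans (Finset.sum_le_sum fun k _ => ?_)
    rw [abs_mul]
    gcongr
    exact abs_cosBasis_sub_le k x y
  refine h1.trans ?_
  have e2 : ∑ k ∈ t, |cosCoef h k| * (√2 * (Real.pi * k) * |x - y|)
      = (√2 * ∑ k ∈ t, (Real.pi * k) * |cosCoef h k|) * |x - y| := by
    rw [Finset.mul_sum, Finset.sum_mul]
    exact Finset.sum_congr rfl fun k _ => by ring
  rw [e2]
  refine mul_le_mul_of_nonneg_right ?_ (abs_nonneg _)
  rw [mul_assoc, Real.sqrt_mul zero_le_two]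
  refine mul_le_mul_of_nonneg_left ?_ (Real.sqrt_nonneg _)
  apply Real.le_sqrt_of_sq_le
  refine (sq_sum_le_card_mul_sum_sq).trans (mul_le_mul_of_nonneg_left ?_ (Nat.cast_nonneg _))
  refine le_trans (le_of_eq (Finset.sum_congr rfl fun k _ => ?_)) hQ
  rw [mul_pow, sq_abs]

theorem integral_sq_of_mem_cosSpan {t : Finset ℕ} {h : ℝ → ℝ} (hh : h ∈ cosSpan (t : Set ℕ)) :
    ∫ x in (0 : ℝ)..1, h x ^ 2 = ∑ k ∈ t, cosCoef h k ^ 2 := by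
  rw [← integral_sq_finset_sum]
  exact intervalIntegral.integral_congr fun x _ =>
    congrArg (· ^ 2) (congrFun (cosSpan_expansion hh).1 x)

theorem exists_grid_near {N : ℕ} (hN : 0 < N) {x : ℝ} (hx : x ∈ Set.Icc (0 : ℝ) 1) :
    ∃ i ∈ Finset.range (N + 1), |x - i / N| ≤ 1 / N := by
  have hN' : (0 : ℝ) < N := by exact_mod_cast hN
  have h0 : 0 ≤ x * N := mul_nonneg hx.1 hN'.le
  refine ⟨⌊x * N⌋₊, Finset.mem_range.2 (Nat.lt_succ_of_le ?_), ?_⟩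
  · have : x * N ≤ N := mul_le_of_le_one_left hN'.le hx.2
    exact Nat.floor_le_of_le this
  · have e : x - ⌊x * N⌋₊ / N = (x * N - ⌊x * N⌋₊) / N := by field_simp
    rw [e, abs_div, abs_of_pos hN']
    gcongr
    rw [abs_le]
    exact ⟨by linarith [Nat.floor_le h0], by linarith [Nat.lt_floor_add_one (x * N)]⟩

end CosineSums

/-! ### The lower bound for one sample size -/

section FixedSampleSize

variable {D : ℕ} {p σ : ℝ → (Fin D → ℝ) → ℝ} {g : (Fin D → ℝ) → ℝ}
variable {q : Polynomial ℝ} {C Λ : ℝ} {s : Finset ℕ} {lam : ℕ → ℝ}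

theorem abs_modBasis_le (hC : ∀ x, |cosPoly q x| ≤ C) (j : ℕ) (x : ℝ) :
    |modBasis q lam j x| ≤ √(lam j) * (C * √2) := by
  rw [modBasis, abs_mul, abs_mul, abs_of_nonneg (Real.sqrt_nonneg _)]
  have := (abs_nonneg _).trans (hC x)
  exact mul_le_mul_of_nonneg_left (mul_le_mul (hC x) (abs_cosBasis_le j x) (abs_nonneg _) this)
    (Real.sqrt_nonneg _)

/-- Grid values of a prior draw exceed `r` with small probability. -/
theorem gaussPi_grid_tail (hC : ∀ x, |cosPoly q x| ≤ C) (hlam : ∀ j, 0 ≤ lam j)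
    (hΛ : ∀ j ∈ s, lam j ≤ Λ) {v r : ℝ} (hv0 : 0 < v) (hv : 2 * C ^ 2 * Λ * s.card ≤ v) (hr : 0 ≤ r)
    (N : ℕ) :
    (gaussPi s).real {ζ | ∃ i ∈ Finset.range (N + 1),
        r ≤ |∑ j : s, ζ j * modBasis q lam j ((i : ℝ) / N)|}
      ≤ (N + 1) * (2 * Real.exp (-r ^ 2 / (2 * v))) := by
  -- The left side is the variance at x of a prior draw.
  have hpt : ∀ x, ∑ j : s, modBasis q lam j x ^ 2 ≤ v := by
    intro x
    refine le_trans ?_ hv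
    rw [Finset.sum_coe_sort s (fun j => modBasis q lam j x ^ 2)]
    have : ∀ j ∈ s, modBasis q lam j x ^ 2 ≤ 2 * C ^ 2 * Λ := by
      intro j hj
      have h1 : modBasis q lam j x ^ 2 ≤ (√(lam j) * (C * √2)) ^ 2 := by
        rw [← sq_abs]
        exact pow_le_pow_left₀ (abs_nonneg _) (abs_modBasis_le hC j x) 2
      rw [mul_pow, mul_pow, Real.sq_sqrt (hlam j), Real.sq_sqrt zero_le_two] at h1
      have := mul_le_mul_of_nonneg_right (hΛ j hj) (show 0 ≤ C ^ 2 * 2 by positivity)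
      linarith
    refine (Finset.sum_le_card_nsmul s _ _ this).trans (le_of_eq ?_)
    rw [nsmul_eq_mul]; ring
  have hset : {ζ : s → ℝ | ∃ i ∈ Finset.range (N + 1),
      r ≤ |∑ j : s, ζ j * modBasis q lam j ((i : ℝ) / N)|}
      = ⋃ i ∈ Finset.range (N + 1), {ζ : s → ℝ | r ≤ |∑ j : s, modBasis q lam j ((i : ℝ) / N) * ζ j|} := by
    ext ζ
    simp only [Set.mem_iUnion, Set.mem_ofPred_eq, exists_prop, mul_comm]
  rw [hset]
  refine (measureReal_biUnion_finset_le _ _).trans ?_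
  refine (Finset.sum_le_card_nsmul _ _ _ fun i _ => gaussPi_dot_tail _ hr (hpt _) hv0).trans
    (le_of_eq ?_)
  rw [nsmul_eq_mul, Finset.card_range]
  push_cast
  ring

/-- For k ≥ 1 the base πk exceeds 1, so the exponent 2α ≥ 2 helps; the summand 1 settles k = 0.
Through this the Sobolev ball controls Lipschitz constants. -/
theorem sq_le_one_add_rpow {α : ℝ} (hα : 1 ≤ α) (k : ℕ) :
    (Real.pi * k) ^ 2 ≤ 1 + (Real.pi * k) ^ (2 * α) := by
  rcases Nat.eq_zero_or_pos k with rfl | hk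
  · have : (0 : ℝ) ≤ (Real.pi * ((0 : ℕ) : ℝ)) ^ (2 * α) := by positivity
    simp at this ⊢
    linarith
  · have h1 : (1 : ℝ) ≤ Real.pi * k := by
      have := Real.pi_gt_three
      have : (1 : ℝ) ≤ k := by exact_mod_cast hk
      nlinarith
    have := Real.rpow_le_rpow_of_exponent_le h1 (show (2 : ℝ) ≤ 2 * α by linarith)
    rw [Real.rpow_two] at this
    linarith

/-- Minimax lower bound for a single sample size in terms of the parameters of the prior. -/
theorem bayes_bound_le_dealerMinimaxRisk (h : RegularDesign p σ) (hg : Measurable g)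
    (f₀ : ℝ → ℝ) {ρ : ℝ≥0∞} {M n : ℕ} {α Q τ : ℝ} (hα : 1 ≤ α)
    (hC : ∀ x, |cosPoly q x| ≤ C)
    (hτ : ∫ y in Set.Icc (0 : ℝ) 1, max (designInfo p σ y * cosPoly q y ^ 2 - 1) 0 ≤ τ)
    (hs : ∀ j ∈ s, q.natDegree < j) {t : Finset ℕ}
    (ht : ∀ j ∈ s, Finset.Icc (j - q.natDegree) (j + q.natDegree) ⊆ t)
    (hlam : ∀ j, 0 ≤ lam j) (hΛ0 : 0 ≤ Λ) (hΛ : ∀ j ∈ s, lam j ≤ Λ) {k₀ : ℕ} (hM : ∀ k ∈ t, M ≤ k)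
    (hk₀ : ∀ k ∈ t, k₀ ≤ k) {wmax : ℝ} (hwmax0 : 0 ≤ wmax)
    (hwmax : ∀ k ∈ t, 1 + (Real.pi * k) ^ (2 * α) ≤ wmax) {W : ℕ → ℝ} (hW0 : ∀ j ∈ s, 0 ≤ W j)
    (hW : ∀ j ∈ s, ∀ k ∈ Finset.Icc (j - q.natDegree) (j + q.natDegree),
      1 + (Real.pi * k) ^ (2 * α) ≤ W j)
    {m : ℝ} (hm : (∫ x in (0 : ℝ)..1, cosPoly q x ^ 2) * ∑ j ∈ s, lam j * W j ≤ m) (hmQ : m < Q)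
    {N : ℕ} (hN : 0 < N) {r v t₀ : ℝ} (hr : 0 ≤ r) (hv0 : 0 < v)
    (hv : 2 * C ^ 2 * Λ * s.card ≤ v) (ht₀ : r + √(2 * t.card * Q) / N ≤ t₀)
    (htρ : ENNReal.ofReal t₀ < ρ) {δ : ℝ}
    (hδ : 2 * wmax * (C ^ 2 * Λ) * m / (Q - m) ^ 2
      + (N + 1) * (2 * Real.exp (-r ^ 2 / (2 * v))) ≤ δ)
    {R L : ℝ} (hR : Q / (1 + (Real.pi * k₀) ^ (2 * α)) ≤ R) (hL : 0 < L) :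
    ENNReal.ofReal ((∫ x in (0 : ℝ)..1, cosPoly q x ^ 2) * ∑ j ∈ s, lam j / (1 + n * lam j)
        - 2 * C ^ 2 * τ * n * ∑ j ∈ s, (lam j / (1 + n * lam j)) ^ 2)
      ≤ dealerMinimaxRisk (pivotClass f₀ ρ M α Q) g p σ n
        + ENNReal.ofReal (8 * R * δ + 2 * C ^ 2 * (∑ j ∈ s, lam j) * (L * δ + 3 / L)) := by
  set w : ℕ → ℝ := fun k => 1 + (Real.pi * k) ^ (2 * α) with hw
  have hw1 : ∀ k, 1 ≤ w k := fun k => by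
    have : (0 : ℝ) ≤ (Real.pi * k) ^ (2 * α) := by positivity
    simp only [hw]; linarith
  -- The good event: the Sobolev energy respects `Q`, and the draw is below `r` at all grid points.
  set Γ : Set (s → ℝ) := {ζ | ∑ k ∈ t, w k * (∑ j : s, √(lam j) * modCoef q k j * ζ j) ^ 2 ≤ Q} ∩
    {ζ | ∃ i ∈ Finset.range (N + 1), r ≤ |∑ j : s, ζ j * modBasis q lam j ((i : ℝ) / N)|}ᶜ with hΓ
  have hΓm : MeasurableSet Γ := by
    refine MeasurableSet.inter (measurableSet_le ?_ measurable_const) (MeasurableSet.compl ?_)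
    · exact Finset.measurable_sum _ fun k _ => ((measurable_dot _).pow_const 2).const_mul _
    · have : {ζ : s → ℝ | ∃ i ∈ Finset.range (N + 1),
          r ≤ |∑ j : s, ζ j * modBasis q lam j ((i : ℝ) / N)|}
          = ⋃ i ∈ Finset.range (N + 1),
            {ζ : s → ℝ | r ≤ |∑ j : s, modBasis q lam j ((i : ℝ) / N) * ζ j|} := by
        ext ζ
        simp only [Set.mem_iUnion, Set.mem_ofPred_eq, exists_prop, mul_comm]
      rw [this]
      exact Finset.measurableSet_biUnion _ fun i _ =>
        measurableSet_le measurable_const (measurable_dot _).abs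
  have hCΛ : 0 ≤ C ^ 2 * Λ := by positivity
  have hbad : (gaussPi s).real Γᶜ ≤ δ := by
    refine le_trans ?_ hδ
    rw [hΓ, Set.compl_inter, compl_compl]
    refine (measureReal_union_le _ _).trans (add_le_add ?_ (gaussPi_grid_tail hC hlam hΛ hv0 hv hr N))
    refine le_trans (measureReal_mono fun ζ hζ => ?_) (gaussPi_quadratic_tail t
      (G := fun k (j : s) => √(lam j) * modCoef q k j) (fun k _ => zero_le_one.trans (hw1 k)) hwmax
      hwmax0 hCΛ (sum_sq_modCoef_le t hlam hΛ hC)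
      ((sum_weight_modCoef_le hlam hs hW0 hW).trans hm) hmQ)
    have hζ' : ¬ ∑ k ∈ t, w k * (∑ j : s, √(lam j) * modCoef q k j * ζ j) ^ 2 ≤ Q := hζ
    exact not_le.1 hζ'
  have hspan := sum_modBasis_mem_cosSpan (lam := lam) hs ht
  have hmem : ∀ ζ ∈ Γ, priorFun (pivotPart f₀ M) (fun (j : s) => modBasis q lam j) ζ
      ∈ pivotClass f₀ ρ M α Q := by
    intro ζ hζ
    have hS : ∑ k ∈ t, w k * cosCoef (fun x => ∑ j : s, ζ j * modBasis q lam j x) k ^ 2 ≤ Q := by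
      simp_rw [cosCoef_sum_modBasis]
      exact hζ.1
    refine pivotPart_add_mem_pivotClass hM (hspan ζ) hS (t := t₀) (fun x hx => ?_) htρ
    obtain ⟨i, hi, hxi⟩ := exists_grid_near hN hx
    have hgrid : |∑ j : s, ζ j * modBasis q lam j ((i : ℝ) / N)| < r := by
      by_contra hc
      exact hζ.2 ⟨i, hi, not_lt.1 hc⟩
    have hlip := abs_sub_le_of_weighted_coef (hspan ζ) (Q := Q) (le_trans (Finset.sum_le_sum
      fun k _ => mul_le_mul_of_nonneg_right (sq_le_one_add_rpow hα k) (sq_nonneg _)) hS) x (i / N)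
    have h2 := mul_le_mul_of_nonneg_left hxi (Real.sqrt_nonneg (2 * t.card * Q))
    have h3 := abs_sub_abs_le_abs_sub (∑ j : s, ζ j * modBasis q lam j x)
      (∑ j : s, ζ j * modBasis q lam j ((i : ℝ) / N))
    rw [mul_one_div] at h2
    linarith
  have hQ0 : 0 ≤ Q := by
    have : 0 ≤ m := le_trans (mul_nonneg (intervalIntegral.integral_nonneg zero_le_one
      fun x _ => sq_nonneg _) (Finset.sum_nonneg fun j hj => mul_nonneg (hlam j) (hW0 j hj))) hm
    linarith
  have hR0 : 0 ≤ R := le_trans (div_nonneg hQ0 (zero_le_one.trans (hw1 k₀))) hR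
  -- All frequencies are at least `k₀`, so the energy bound `Q` divided by the smallest weight
  -- bounds the L² norm.
  have hnorm : ∀ ζ ∈ Γ, ∫⁻ x in Set.Icc (0 : ℝ) 1,
      ENNReal.ofReal ((∑ j : s, ζ j * modBasis q lam j x) ^ 2) ≤ ENNReal.ofReal R := by
    intro ζ hζ
    have hS : ∑ k ∈ t, w k * cosCoef (fun x => ∑ j : s, ζ j * modBasis q lam j x) k ^ 2 ≤ Q := by
      simp_rw [cosCoef_sum_modBasis]
      exact hζ.1
    rw [← ofReal_integral_eq_lintegral_ofReal
      (by exact integrableOn_unit ((continuous_sum_modBasis q lam s ζ).pow 2))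
      (Eventually.of_forall fun x => sq_nonneg _), integral_Icc_eq_interval,
      integral_sq_of_mem_cosSpan (hspan ζ)]
    refine ENNReal.ofReal_le_ofReal (le_trans ?_ hR)
    rw [le_div_iff₀ (zero_lt_one.trans_le (hw1 k₀)), Finset.sum_mul]
    refine le_trans (Finset.sum_le_sum fun k hk => ?_) hS
    rw [mul_comm]
    refine mul_le_mul_of_nonneg_right ?_ (sq_nonneg _)
    have : (k₀ : ℝ) ≤ k := by exact_mod_cast hk₀ k hk
    simp only [hw]
    gcongr
  have hI : Integrable (designInfo p σ) (volume.restrict (Set.Icc (0 : ℝ) 1)) := by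
    obtain ⟨b, hb, hbd⟩ := h.exists_info_bounds
    refine (integrable_const b).mono' h.measurable_info.aestronglyMeasurable ?_
    filter_upwards [ae_restrict_mem measurableSet_Icc] with x hx
    obtain ⟨h1, h2⟩ := hbd x hx
    rw [Real.norm_eq_abs, abs_of_nonneg ((inv_nonneg.2 (by linarith)).trans h1)]
    exact h2
  have hCbd : ∀ (j : s) x, |modBasis q lam j x| ≤ √Λ * (C * √2) := by
    intro j x
    refine (abs_modBasis_le hC j x).trans ?_
    have : 0 ≤ C := (abs_nonneg _).trans (hC 0)
    gcongr
    exact hΛ j j.2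
  have key := bayes_le_dealerMinimaxRisk (n := n) h hg (continuous_pivotPart f₀ M).measurable
    (fun j : s => (continuous_modBasis q lam j).measurable) hCbd
    (fun j : s => 1 / (1 + n * lam j)) hΓm hmem hnorm
  refine (ENNReal.ofReal_le_ofReal (bayes_bound_ge hI hC hτ s hs hlam n)).trans (key.trans ?_)
  refine add_le_add le_rfl ?_
  have hδ0 : 0 ≤ δ := measureReal_nonneg.trans hbad
  have hlsum0 : 0 ≤ ∑ j ∈ s, lam j := Finset.sum_nonneg fun j _ => hlam j
  rw [ENNReal.ofReal_add (by positivity) (by positivity)]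
  refine add_le_add ?_ ?_
  · rw [ENNReal.ofReal_mul (by positivity), ENNReal.ofReal_mul (by norm_num), ENNReal.ofReal_ofNat,
      ← ofReal_measureReal]
    gcongr
  · have e1 : ∫⁻ ζ in Γᶜ, ∫⁻ x in Set.Icc (0 : ℝ) 1,
        ENNReal.ofReal ((∑ j : s, ζ j * modBasis q lam j x) ^ 2) ∂volume ∂(gaussPi s)
        ≤ ENNReal.ofReal (C ^ 2 * (∑ j ∈ s, lam j) * (L * δ + 3 / L)) := by
      refine (lintegral_mono fun ζ => lintegral_prior_sq_le hC s hlam ζ).trans ?_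
      have e2 : ∀ ζ : s → ℝ, ENNReal.ofReal (C ^ 2 * ∑ j : s, lam j * ζ j ^ 2)
          = ENNReal.ofReal (C ^ 2) * ∑ j : s, ENNReal.ofReal (lam j) * ENNReal.ofReal (ζ j ^ 2) := by
        intro ζ
        rw [ENNReal.ofReal_mul (sq_nonneg C), ENNReal.ofReal_sum_of_nonneg
          fun (j : s) _ => mul_nonneg (hlam j) (sq_nonneg (ζ j))]
        congr 1
        exact Finset.sum_congr rfl fun j _ => ENNReal.ofReal_mul (hlam j)
      have hmj : ∀ j : s, Measurable fun ζ : s → ℝ => ENNReal.ofReal (ζ j ^ 2) := fun j => by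
        have hmi : Measurable fun ζ : s → ℝ => ζ j := measurable_pi_apply j
        exact (hmi.pow_const 2).ennreal_ofReal
      simp_rw [e2]
      rw [lintegral_const_mul' _ _ ENNReal.ofReal_ne_top,
        lintegral_finsetSum _ fun j _ => (hmj j).const_mul _, mul_assoc,
        ENNReal.ofReal_mul (sq_nonneg C), ENNReal.ofReal_mul hlsum0,
        ENNReal.ofReal_sum_of_nonneg fun j _ => hlam j, Finset.sum_mul,
        ← Finset.sum_coe_sort s]
      refine mul_le_mul_right (Finset.sum_le_sum fun j _ => ?_) _
      rw [lintegral_const_mul _ (hmj j)]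
      refine mul_le_mul_right ((setLIntegral_sq_le Γᶜ j hL).trans ?_) _
      apply ENNReal.ofReal_le_ofReal
      gcongr
    refine (mul_le_mul_right e1 2).trans (le_of_eq ?_)
    rw [← ENNReal.ofReal_ofNat, ← ENNReal.ofReal_mul (by norm_num)]
    congr 1; ring

end FixedSampleSize

/-! ### Approximating 1/√𝓘 by cosine polynomials -/

section Approximation

variable {D : ℕ} {p σ : ℝ → (Fin D → ℝ) → ℝ}

/-- Approximation in mean on `[0,1]` by polynomials in `cos(π x)` under a uniform bound. -/
theorem exists_cosPoly_near {v : ℝ → ℝ} (hv : Measurable v) {B : ℝ} (hB : 0 ≤ B)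
    (hvB : ∀ x ∈ Set.Icc (0 : ℝ) 1, v x ∈ Set.Icc 0 B) {ε : ℝ} (hε : 0 < ε) (hε1 : ε ≤ 1) :
    ∃ q : Polynomial ℝ, (∀ x, |cosPoly q x| ≤ B + 1) ∧
      ∫ x in Set.Icc (0 : ℝ) 1, |v x - cosPoly q x| ≤ 2 * ε := by
  set μ := volume.restrict (Set.Icc (0 : ℝ) 1) with hμ
  have : IsProbabilityMeasure μ := ⟨by simp [hμ]⟩
  have hvi : Integrable v μ := by
    refine (integrable_const B).mono' hv.aestronglyMeasurable ?_
    filter_upwards [ae_restrict_mem measurableSet_Icc] with x hx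
    rw [Real.norm_eq_abs, abs_of_nonneg (hvB x hx).1]
    exact (hvB x hx).2
  obtain ⟨g₀, hg₀, hg₀i⟩ := hvi.exists_boundedContinuous_integral_sub_le hε
  -- Clipping to [0,B] does not increase the distance to `v` on [0,1] and yields the uniform bound.
  set g : ℝ → ℝ := fun x => max 0 (min (g₀ x) B) with hg
  have hgc : Continuous g := continuous_const.max (g₀.continuous.min continuous_const)
  have hgB : ∀ x, |g x| ≤ B := fun x => by
    rw [abs_of_nonneg (le_max_left _ _)]
    exact max_le hB (min_le_right _ _)
  have hgv : ∀ x ∈ Set.Icc (0 : ℝ) 1, |v x - g x| ≤ ‖v x - g₀ x‖ := by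
    intro x hx
    obtain ⟨h1, h2⟩ := hvB x hx
    rw [Real.norm_eq_abs]
    have e : v x = max 0 (min (v x) B) := by rw [min_eq_left h2, max_eq_right h1]
    calc |v x - g x| = |max 0 (min (v x) B) - max 0 (min (g₀ x) B)| := by rw [← e]
      _ ≤ |min (v x) B - min (g₀ x) B| := by
          simpa using abs_max_sub_max_le_max 0 (min (v x) B) 0 (min (g₀ x) B)
      _ ≤ |v x - g₀ x| := by
          simpa using abs_min_sub_min_le_max (v x) B (g₀ x) B
  -- Weierstrass in the variable cos(πx): on [0,1], x = arccos(cos πx)/π. As cosines lie in [-1,1],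
  -- the bound on the polynomial holds for every real x.
  obtain ⟨q, hq⟩ := exists_polynomial_near_of_continuousOn (-1) 1
    (fun y => g (Real.arccos y / Real.pi))
    (hgc.comp (Real.continuous_arccos.div_const _)).continuousOn ε hε
  refine ⟨q, fun x => ?_, ?_⟩
  · have h1 := hq (Real.cos (Real.pi * x)) ⟨Real.neg_one_le_cos _, Real.cos_le_one _⟩
    have h2 := hgB (Real.arccos (Real.cos (Real.pi * x)) / Real.pi)
    rw [cosPoly]
    have := abs_sub_abs_le_abs_sub (q.eval (Real.cos (Real.pi * x)))
      (g (Real.arccos (Real.cos (Real.pi * x)) / Real.pi))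
    linarith
  · have hqg : ∀ x ∈ Set.Icc (0 : ℝ) 1, |g x - cosPoly q x| ≤ ε := by
      intro x hx
      have h1 := hq (Real.cos (Real.pi * x)) ⟨Real.neg_one_le_cos _, Real.cos_le_one _⟩
      rw [Real.arccos_cos (mul_nonneg Real.pi_pos.le hx.1)
        (mul_le_of_le_one_right Real.pi_pos.le hx.2), mul_div_cancel_left₀ _ Real.pi_ne_zero,
        abs_sub_comm] at h1
      exact h1.le
    have hqi : Integrable (cosPoly q) μ := integrableOn_unit (continuous_cosPoly q)
    calc ∫ x, |v x - cosPoly q x| ∂μ ≤ ∫ x, (‖v x - g₀ x‖ + ε) ∂μ := by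
          refine integral_mono_ae (hvi.sub hqi).abs ((hvi.sub hg₀i).norm.add (integrable_const _)) ?_
          filter_upwards [ae_restrict_mem measurableSet_Icc] with x hx
          have := abs_sub_le (v x) (g x) (cosPoly q x)
          have h1 := hgv x hx
          have h2 := hqg x hx
          linarith
      _ = ∫ x, ‖v x - g₀ x‖ ∂μ + ε := by
          rw [integral_add (by exact (hvi.sub hg₀i).norm) (integrable_const _)]
          simp
      _ ≤ 2 * ε := by linarith

/-- Cosine polynomials `u` with `u² ≈ 1 / 𝓘` in mean. -/
theorem RegularDesign.exists_cosPoly (h : RegularDesign p σ) :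
    ∃ C : ℝ, 1 ≤ C ∧ ∀ τ > 0, ∃ q : Polynomial ℝ, (∀ x, |cosPoly q x| ≤ C) ∧
      ∫ y in Set.Icc (0 : ℝ) 1, max (designInfo p σ y * cosPoly q y ^ 2 - 1) 0 ≤ τ ∧
      |(∫ x in (0 : ℝ)..1, cosPoly q x ^ 2) - difficulty p σ| ≤ τ := by
  obtain ⟨b, hb, hbd⟩ := h.exists_info_bounds
  have hb0 : 0 < b := by linarith
  set μ := volume.restrict (Set.Icc (0 : ℝ) 1) with hμ
  have : IsProbabilityMeasure μ := ⟨by simp [hμ]⟩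
  set v : ℝ → ℝ := fun x => 1 / √(designInfo p σ x) with hv
  have hvm : Measurable v := measurable_const.div h.measurable_info.sqrt
  have hI0 : ∀ x ∈ Set.Icc (0 : ℝ) 1, 0 < designInfo p σ x := fun x hx =>
    (inv_pos.2 hb0).trans_le (hbd x hx).1
  have hvB : ∀ x ∈ Set.Icc (0 : ℝ) 1, v x ∈ Set.Icc 0 (√b) := by
    intro x hx
    refine ⟨by positivity, ?_⟩
    simp only [hv]
    rw [one_div, ← Real.sqrt_inv]
    apply Real.sqrt_le_sqrt
    rw [inv_le_comm₀ (hI0 x hx) hb0]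
    exact (hbd x hx).1
  have hv2 : ∀ x ∈ Set.Icc (0 : ℝ) 1, v x ^ 2 = 1 / designInfo p σ x := fun x hx => by
    simp only [hv]
    rw [div_pow, Real.sq_sqrt (hI0 x hx).le, one_pow]
  set C := √b + 1 with hC
  have hC1 : 1 ≤ C := by have := Real.sqrt_nonneg b; linarith
  refine ⟨C, hC1, fun τ hτ => ?_⟩
  have hden : 0 < 4 * b * C := by positivity
  -- An L¹ error 2ε for u becomes 4Cε for u² and 4bCε after multiplication by 𝓘 ≤ b; both are at
  -- most τ since b ≥ 1.
  obtain ⟨q, hqC, hq⟩ := exists_cosPoly_near hvm (Real.sqrt_nonneg b) hvB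
    (ε := min 1 (τ / (4 * b * C))) (lt_min one_pos (div_pos hτ hden)) (min_le_left _ _)
  have hε : min 1 (τ / (4 * b * C)) * (4 * b * C) ≤ τ :=
    (le_div_iff₀ hden).1 (min_le_right _ _)
  set ε := min 1 (τ / (4 * b * C))
  set u := cosPoly q with hu
  have huc : Continuous u := continuous_cosPoly q
  have hvi : Integrable v μ := by
    refine (integrable_const (√b)).mono' hvm.aestronglyMeasurable ?_
    filter_upwards [ae_restrict_mem measurableSet_Icc] with x hx
    rw [Real.norm_eq_abs, abs_of_nonneg (hvB x hx).1]
    exact (hvB x hx).2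
  have hdi : Integrable (fun x => |v x - u x|) μ := (hvi.sub (integrableOn_unit huc)).abs
  have hsq : ∀ x ∈ Set.Icc (0 : ℝ) 1, |u x ^ 2 - v x ^ 2| ≤ 2 * C * |v x - u x| := by
    intro x hx
    have e : u x ^ 2 - v x ^ 2 = (u x + v x) * (u x - v x) := by ring
    rw [e, abs_mul, abs_sub_comm (u x)]
    refine mul_le_mul_of_nonneg_right ?_ (abs_nonneg _)
    have h1 := hqC x
    have h2 := hvB x hx
    have h3 := abs_add_le (u x) (v x)
    rw [abs_of_nonneg h2.1] at h3
    have h4 := h2.2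
    linarith
  have hv2i : Integrable (fun x => v x ^ 2) μ := by
    refine (integrable_const (√b ^ 2)).mono' (hvm.pow_const 2).aestronglyMeasurable ?_
    filter_upwards [ae_restrict_mem measurableSet_Icc] with x hx
    rw [norm_pow, Real.norm_eq_abs, abs_of_nonneg (hvB x hx).1]
    exact pow_le_pow_left₀ (hvB x hx).1 (hvB x hx).2 2
  have hu2i : Integrable (fun x => u x ^ 2) μ := integrableOn_unit (huc.pow 2)
  have hC0 : 0 ≤ C := by linarith
  have hIi : Integrable (designInfo p σ) μ := by
    refine (integrable_const b).mono' h.measurable_info.aestronglyMeasurable ?_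
    filter_upwards [ae_restrict_mem measurableSet_Icc] with x hx
    rw [Real.norm_eq_abs, abs_of_pos (hI0 x hx)]
    exact (hbd x hx).2
  refine ⟨q, hqC, ?_, ?_⟩
  · have hm : ∫ y, max (designInfo p σ y * u y ^ 2 - 1) 0 ∂μ
        ≤ ∫ y, b * (2 * C) * |v y - u y| ∂μ := by
      refine integral_mono_of_nonneg (Eventually.of_forall fun y => le_max_right _ _)
        (hdi.const_mul _) ?_
      filter_upwards [ae_restrict_mem measurableSet_Icc] with x hx
      refine max_le ?_ (by positivity)
      have e : designInfo p σ x * u x ^ 2 - 1 = designInfo p σ x * (u x ^ 2 - v x ^ 2) := by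
        rw [hv2 x hx, mul_sub, mul_one_div_cancel (hI0 x hx).ne']
      rw [e]
      calc designInfo p σ x * (u x ^ 2 - v x ^ 2)
          ≤ designInfo p σ x * (2 * C * |v x - u x|) :=
            mul_le_mul_of_nonneg_left ((le_abs_self _).trans (hsq x hx)) (hI0 x hx).le
        _ ≤ b * (2 * C * |v x - u x|) :=
            mul_le_mul_of_nonneg_right (hbd x hx).2 (by positivity)
        _ = _ := by ring
    refine hm.trans ?_
    rw [integral_const_mul]
    have := mul_le_mul_of_nonneg_left hq (show 0 ≤ b * (2 * C) by positivity)
    linarith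
  · have e1 : difficulty p σ = ∫ x, v x ^ 2 ∂μ := by
      rw [difficulty, ← integral_Icc_eq_interval]
      exact setIntegral_congr_fun measurableSet_Icc fun x hx => (hv2 x hx).symm
    rw [e1, ← integral_Icc_eq_interval, ← integral_sub hu2i hv2i]
    refine abs_integral_le_integral_abs.trans ?_
    have hm : ∫ x, |u x ^ 2 - v x ^ 2| ∂μ ≤ ∫ x, 2 * C * |v x - u x| ∂μ := by
      refine integral_mono_ae (hu2i.sub hv2i).abs (hdi.const_mul _) ?_
      filter_upwards [ae_restrict_mem measurableSet_Icc] with x hx using hsq x hx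
    refine hm.trans ?_
    rw [integral_const_mul]
    have h1 := mul_le_mul_of_nonneg_left hq (show 0 ≤ 2 * C by positivity)
    have hεpos : 0 < ε := lt_min one_pos (div_pos hτ hden)
    have h2 : ε * (4 * 1 * C) ≤ ε * (4 * b * C) := by gcongr
    linarith

theorem RegularDesign.difficulty_pos (h : RegularDesign p σ) : 0 < difficulty p σ := by
  obtain ⟨b, hb, hbd⟩ := h.exists_info_bounds
  have hb0 : 0 < b := by linarith
  have hle : ∀ x ∈ Set.Icc (0 : ℝ) 1, b⁻¹ ≤ 1 / designInfo p σ x ∧ 1 / designInfo p σ x ≤ b := by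
    intro x hx
    have h0 : 0 < designInfo p σ x := (inv_pos.2 hb0).trans_le (hbd x hx).1
    rw [one_div]
    exact ⟨inv_anti₀ h0 (hbd x hx).2, inv_le_of_inv_le₀ hb0 (hbd x hx).1⟩
  have hi : IntegrableOn (fun x => 1 / designInfo p σ x) (Set.Icc (0 : ℝ) 1) := by
    refine Measure.integrableOn_of_bounded (M := b) (by simp)
      (measurable_const.div h.measurable_info).aestronglyMeasurable ?_
    filter_upwards [ae_restrict_mem measurableSet_Icc] with x hx
    rw [Real.norm_eq_abs, abs_of_nonneg ((inv_pos.2 hb0).le.trans (hle x hx).1)]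
    exact (hle x hx).2
  have := setIntegral_mono_on (integrableOn_const (C := b⁻¹) (by simp)) hi measurableSet_Icc
    fun x hx => (hle x hx).1
  rw [integral_Icc_eq_interval, integral_Icc_eq_interval] at this
  simp only [intervalIntegral.integral_const, sub_zero, one_smul] at this
  exact (inv_pos.2 hb0).trans_le this

end Approximation

/-! ### Sums over the Pinsker variances -/

section PriorSums

theorem sum_range_rpow_le {a : ℝ} (ha : 0 ≤ a) (K : ℕ) :
    ∑ j ∈ Finset.range K, (j : ℝ) ^ a ≤ (K : ℝ) ^ (a + 1) / (a + 1) := by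
  have h := MonotoneOn.sum_le_integral (f := fun x : ℝ => x ^ a) (x₀ := 0) (a := K)
    fun x hx y _ hxy => Real.rpow_le_rpow hx.1 hxy ha
  simp only [zero_add] at h
  rwa [integral_rpow (Or.inl (by linarith)), Real.zero_rpow (by linarith), sub_zero] at h

theorem le_sum_range_rpow {a : ℝ} (ha : 0 ≤ a) (K : ℕ) :
    (K : ℝ) ^ (a + 1) / (a + 1) - (K : ℝ) ^ a ≤ ∑ j ∈ Finset.range K, (j : ℝ) ^ a := by
  have h := MonotoneOn.integral_le_sum (f := fun x : ℝ => x ^ a) (x₀ := 0) (a := K)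
    fun x hx y _ hxy => Real.rpow_le_rpow hx.1 hxy ha
  simp only [zero_add] at h
  rw [integral_rpow (Or.inl (by linarith)), Real.zero_rpow (by linarith), sub_zero] at h
  have h2 := Finset.sum_range_succ' (fun j : ℕ => (j : ℝ) ^ a) K
  have h3 := Finset.sum_range_succ (fun j : ℕ => (j : ℝ) ^ a) K
  have h4 : (0 : ℝ) ≤ ((0 : ℕ) : ℝ) ^ a := by positivity
  linarith

/-- The variances of the prior: Pinsker weights with bandwidth `K`, cut off below `j₀`. -/
def priorVar (α : ℝ) (n K j₀ j : ℕ) : ℝ :=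
  if j ∈ Finset.Ico j₀ K then (((K : ℝ) / j) ^ α - 1) / n else 0

variable {α : ℝ} {n K j₀ : ℕ}

theorem priorVar_nonneg (hα : 0 ≤ α) (hj₀ : 0 < j₀) (j : ℕ) : 0 ≤ priorVar α n K j₀ j := by
  unfold priorVar
  split_ifs with hj
  · obtain ⟨h1, h2⟩ := Finset.mem_Ico.1 hj
    have hj0 : (0 : ℝ) < j := by exact_mod_cast hj₀.trans_le h1
    have : (1 : ℝ) ≤ (K : ℝ) / j := by
      rw [le_div_iff₀ hj0, one_mul]; exact_mod_cast h2.le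
    have := Real.one_le_rpow this hα
    exact div_nonneg (by linarith) (Nat.cast_nonneg n)
  · exact le_rfl

/-- This is the purpose of cutting off frequencies below ηK: all variances are then of order 1/n,
which the tail estimates need. -/
theorem priorVar_le (hα : 0 ≤ α) (hj₀ : 0 < j₀) {η : ℝ} (hη : 0 < η) (hηK : η * K ≤ j₀) {j : ℕ}
    (hj : j ∈ Finset.Ico j₀ K) : priorVar α n K j₀ j ≤ η⁻¹ ^ α / n := by
  rw [priorVar, if_pos hj]
  obtain ⟨h1, h2⟩ := Finset.mem_Ico.1 hj
  have hj0 : (0 : ℝ) < j := by exact_mod_cast hj₀.trans_le h1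
  have h3 : (K : ℝ) / j ≤ η⁻¹ := by
    rw [div_le_iff₀ hj0, inv_mul_eq_div, le_div_iff₀ hη, mul_comm]
    exact hηK.trans (by exact_mod_cast h1)
  have h4 : ((K : ℝ) / j) ^ α ≤ η⁻¹ ^ α := Real.rpow_le_rpow (by positivity) h3 hα
  gcongr
  linarith

/-- Since 1 + nλⱼ = (K/j)^α, the shrunken variance is the Pinsker filter weight 1 - (j/K)^α divided
by n. -/
theorem priorVar_shrink (hn : 0 < n) (hj₀ : 0 < j₀) {j : ℕ} (hj : j ∈ Finset.Ico j₀ K) :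
    priorVar α n K j₀ j / (1 + n * priorVar α n K j₀ j) = (1 - ((j : ℝ) / K) ^ α) / n := by
  obtain ⟨h1, h2⟩ := Finset.mem_Ico.1 hj
  have hj0 : (0 : ℝ) < j := by exact_mod_cast hj₀.trans_le h1
  have hK : (0 : ℝ) < K := hj0.trans (by exact_mod_cast h2)
  have hn' : (0 : ℝ) < n := by exact_mod_cast hn
  rw [priorVar, if_pos hj]
  have e : ((K : ℝ) / j) ^ α = (((j : ℝ) / K) ^ α)⁻¹ := by
    rw [← Real.inv_rpow (by positivity), inv_div]
  have hp : 0 < ((j : ℝ) / K) ^ α := by positivity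
  rw [e]
  field_simp
  ring

/-- Extending the sum down to j = 0 adds at most j₀, and comparison with ∫ x^α bounds the full sum.
-/
theorem le_sum_priorVar_shrink (hα : 0 ≤ α) (hn : 0 < n) (hj₀ : 0 < j₀) (hjK : j₀ ≤ K) :
    (K * (α / (α + 1)) - j₀) / n
      ≤ ∑ j ∈ Finset.Ico j₀ K, priorVar α n K j₀ j / (1 + n * priorVar α n K j₀ j) := by
  rw [Finset.sum_congr rfl fun j hj => priorVar_shrink hn hj₀ hj, ← Finset.sum_div]
  have hK : (0 : ℝ) < K := by exact_mod_cast hj₀.trans_le hjK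
  refine div_le_div_of_nonneg_right ?_ (Nat.cast_nonneg n)
  have h1 := Finset.sum_range_add_sum_Ico (fun j : ℕ => 1 - ((j : ℝ) / K) ^ α) hjK
  have h2 : ∑ j ∈ Finset.range j₀, (1 - ((j : ℝ) / K) ^ α) ≤ j₀ := by
    refine (Finset.sum_le_card_nsmul _ _ 1 fun j _ => ?_).trans (by simp)
    have : 0 ≤ ((j : ℝ) / K) ^ α := by positivity
    linarith
  have h3 : K * (α / (α + 1)) ≤ ∑ j ∈ Finset.range K, (1 - ((j : ℝ) / K) ^ α) := by
    have e : ∀ j ∈ Finset.range K, 1 - ((j : ℝ) / K) ^ α = 1 - (j : ℝ) ^ α / (K : ℝ) ^ α :=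
      fun j _ => by rw [Real.div_rpow (by positivity) hK.le]
    rw [Finset.sum_congr rfl e, Finset.sum_sub_distrib, ← Finset.sum_div]
    simp only [Finset.sum_const, Finset.card_range, nsmul_eq_mul, mul_one]
    have h4 := sum_range_rpow_le hα K
    have hKα : 0 < (K : ℝ) ^ α := by positivity
    have h5 : (∑ j ∈ Finset.range K, (j : ℝ) ^ α) / (K : ℝ) ^ α ≤ K / (α + 1) := by
      rw [div_le_iff₀ hKα]
      refine h4.trans (le_of_eq ?_)
      rw [Real.rpow_add_one hK.ne']
      ring
    have e2 : K * (α / (α + 1)) = K - K / (α + 1) := by field_simp; ring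
    linarith
  linarith

theorem sum_sq_priorVar_shrink_le (hα : 0 ≤ α) (hn : 0 < n) (hj₀ : 0 < j₀) :
    ∑ j ∈ Finset.Ico j₀ K, (priorVar α n K j₀ j / (1 + n * priorVar α n K j₀ j)) ^ 2
      ≤ K / (n : ℝ) ^ 2 := by
  have h1 : ∀ j ∈ Finset.Ico j₀ K, (priorVar α n K j₀ j / (1 + n * priorVar α n K j₀ j)) ^ 2
      ≤ 1 / (n : ℝ) ^ 2 := by
    intro j hj
    rw [priorVar_shrink hn hj₀ hj, div_pow]
    have hp : 0 ≤ ((j : ℝ) / K) ^ α := by positivity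
    have hp1 : ((j : ℝ) / K) ^ α ≤ 1 := by
      refine Real.rpow_le_one (by positivity) ?_ hα
      refine div_le_one_of_le₀ ?_ (Nat.cast_nonneg K)
      exact_mod_cast (Finset.mem_Ico.1 hj).2.le
    gcongr
    nlinarith
  refine (Finset.sum_le_card_nsmul _ _ _ h1).trans ?_
  rw [nsmul_eq_mul, Nat.card_Ico, mul_one_div]
  gcongr
  exact Nat.sub_le K j₀

/-- The summands K^α j^α - j^{2α} are nonnegative below K, so the sum may start at 0; the constant
is 1/(α+1) - 1/(2α+1). -/
theorem sum_priorVar_mul_rpow_le (hα : 0 ≤ α) (hj₀ : 0 < j₀) (hjK : j₀ ≤ K) :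
    ∑ j ∈ Finset.Ico j₀ K, priorVar α n K j₀ j * (j : ℝ) ^ (2 * α)
      ≤ ((K : ℝ) ^ (2 * α + 1) * (α / ((α + 1) * (2 * α + 1))) + (K : ℝ) ^ (2 * α)) / n := by
  have hK : (0 : ℝ) < K := by exact_mod_cast hj₀.trans_le hjK
  have e : ∀ j ∈ Finset.Ico j₀ K, priorVar α n K j₀ j * (j : ℝ) ^ (2 * α)
      = ((K : ℝ) ^ α * (j : ℝ) ^ α - (j : ℝ) ^ (2 * α)) / n := by
    intro j hj
    have hj0 : (0 : ℝ) < j := by exact_mod_cast hj₀.trans_le (Finset.mem_Ico.1 hj).1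
    rw [priorVar, if_pos hj, Real.div_rpow hK.le hj0.le, two_mul, Real.rpow_add hj0]
    have : 0 < (j : ℝ) ^ α := by positivity
    field_simp
  rw [Finset.sum_congr rfl e, ← Finset.sum_div]
  refine div_le_div_of_nonneg_right ?_ (Nat.cast_nonneg n)
  have h0 : ∑ j ∈ Finset.Ico j₀ K, ((K : ℝ) ^ α * (j : ℝ) ^ α - (j : ℝ) ^ (2 * α))
      ≤ ∑ j ∈ Finset.range K, ((K : ℝ) ^ α * (j : ℝ) ^ α - (j : ℝ) ^ (2 * α)) := by
    refine Finset.sum_le_sum_of_subset_of_nonneg (fun j hj => ?_) fun j hj _ => ?_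
    · exact Finset.mem_range.2 (Finset.mem_Ico.1 hj).2
    · rw [two_mul, Real.rpow_add_of_nonneg (Nat.cast_nonneg j) hα hα, ← sub_mul]
      have : (j : ℝ) ^ α ≤ (K : ℝ) ^ α := Real.rpow_le_rpow (Nat.cast_nonneg j)
        (by exact_mod_cast (Finset.mem_range.1 hj).le) hα
      exact mul_nonneg (by linarith) (by positivity)
  refine h0.trans ?_
  rw [Finset.sum_sub_distrib, ← Finset.mul_sum]
  have h1 := sum_range_rpow_le hα K
  have h2 := le_sum_range_rpow (a := 2 * α) (by linarith) K
  have h3 := mul_le_mul_of_nonneg_left h1 (show 0 ≤ (K : ℝ) ^ α by positivity)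
  have e1 : (K : ℝ) ^ α * ((K : ℝ) ^ (α + 1) / (α + 1)) = (K : ℝ) ^ (2 * α + 1) / (α + 1) := by
    rw [← mul_div_assoc, ← Real.rpow_add hK]; congr 2; ring
  have e2 : (K : ℝ) ^ (2 * α + 1) * (α / ((α + 1) * (2 * α + 1)))
      = (K : ℝ) ^ (2 * α + 1) / (α + 1) - (K : ℝ) ^ (2 * α + 1) / (2 * α + 1) := by
    field_simp; ring
  rw [e1] at h3
  linarith

end PriorSums

/-! ### The scale n^{1/(2α+1)} -/

section Bandwidth

variable {α : ℝ}

/-- The order `n^{1/(2α+1)}` of the optimal number of frequencies. -/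
def bandwidth (α : ℝ) (n : ℕ) : ℝ := (n : ℝ) ^ (1 / (2 * α + 1))

theorem tendsto_bandwidth (hα : 1 ≤ α) : Tendsto (bandwidth α) atTop atTop :=
  (tendsto_rpow_atTop (by positivity)).comp tendsto_natCast_atTop_atTop

theorem bandwidth_pos {n : ℕ} (hn : 0 < n) : 0 < bandwidth α n :=
  Real.rpow_pos_of_pos (by exact_mod_cast hn) _

theorem bandwidth_rpow_add_one (hα : 1 ≤ α) (n : ℕ) : bandwidth α n ^ (2 * α + 1) = n := by
  rw [bandwidth, ← Real.rpow_mul (Nat.cast_nonneg n), one_div_mul_cancel (by linarith),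
    Real.rpow_one]

theorem bandwidth_rpow (hα : 1 ≤ α) {n : ℕ} (hn : 0 < n) :
    bandwidth α n ^ (2 * α) = n / bandwidth α n := by
  rw [eq_div_iff (bandwidth_pos hn).ne', ← Real.rpow_add_one (bandwidth_pos hn).ne',
    bandwidth_rpow_add_one hα]

theorem bandwidth_pow_three_le (hα : 1 ≤ α) {n : ℕ} (hn : 0 < n) : bandwidth α n ^ 3 ≤ n := by
  rw [bandwidth, ← Real.rpow_natCast, ← Real.rpow_mul (Nat.cast_nonneg n)]
  conv_rhs => rw [← Real.rpow_one (n : ℝ)]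
  refine Real.rpow_le_rpow_of_exponent_le (by exact_mod_cast hn) ?_
  rw [one_div_mul_eq_div, div_le_one (by linarith)]
  push_cast; linarith

theorem one_le_bandwidth (hα : 1 ≤ α) {n : ℕ} (hn : 0 < n) : 1 ≤ bandwidth α n :=
  Real.one_le_rpow (by exact_mod_cast hn) (by positivity)

theorem tendsto_log_natCast : Tendsto (fun n : ℕ => Real.log n) atTop atTop :=
  Real.tendsto_log_atTop.comp tendsto_natCast_atTop_atTop

theorem tendsto_mul_exp_neg_log_sq {c : ℝ} (hc : 0 < c) :
    Tendsto (fun n : ℕ => ((n : ℝ) + 1) * (2 * Real.exp (-(c * Real.log n ^ 2)))) atTop (𝓝 0) := by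
  have h1 : Tendsto (fun y : ℝ => 4 * Real.exp (y - c * y ^ 2)) atTop (𝓝 0) := by
    rw [← mul_zero (4 : ℝ)]
    refine (Real.tendsto_exp_atBot.comp ?_).const_mul 4
    have h2 : Tendsto (fun y : ℝ => y * (c * y - 1)) atTop atTop :=
      tendsto_id.atTop_mul_atTop₀
        (tendsto_atTop_add_const_right _ _ (tendsto_id.const_mul_atTop hc))
    refine (tendsto_neg_atTop_atBot.comp h2).congr fun y => ?_
    simp only [Function.comp]; ring
  refine squeeze_zero' (Eventually.of_forall fun n => by positivity) ?_
    (h1.comp tendsto_log_natCast)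
  filter_upwards [eventually_ge_atTop 1] with n hn
  have hn' : (1 : ℝ) ≤ n := by exact_mod_cast hn
  simp only [Function.comp]
  -- With y = log n the factor n is exp(y), which loses against exp(-c y²).
  rw [sub_eq_add_neg, Real.exp_add, Real.exp_log (by linarith)]
  nlinarith [Real.exp_pos (-(c * Real.log n ^ 2))]

/-- A shift of the frequency by a fixed amount does not matter for the Sobolev weights. -/
theorem eventually_sobolevWeight_le (hα : 1 ≤ α) (m : ℕ) {b : ℝ} (hb : 1 < b) :
    ∀ᶠ j : ℕ in atTop, 1 + (Real.pi * ((j + m : ℕ) : ℝ)) ^ (2 * α)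
      ≤ b * (Real.pi * j) ^ (2 * α) := by
  have hj : Tendsto (fun j : ℕ => (j : ℝ)) atTop atTop := tendsto_natCast_atTop_atTop
  have h1 : Tendsto (fun j : ℕ => ((Real.pi * j) ^ (2 * α))⁻¹ + (1 + (m : ℝ) / j) ^ (2 * α))
      atTop (𝓝 (0 + (1 + 0) ^ (2 * α))) := by
    refine Tendsto.add ?_ (Tendsto.rpow_const (tendsto_const_nhds.add (hj.const_div_atTop _))
      (Or.inl (by norm_num)))
    exact tendsto_inv_atTop_zero.comp
      ((tendsto_rpow_atTop (by linarith)).comp (hj.const_mul_atTop Real.pi_pos))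
  rw [add_zero, Real.one_rpow, zero_add] at h1
  filter_upwards [h1.eventually_le_const hb, eventually_gt_atTop 0] with j hj1 hj0
  have hj' : (0 : ℝ) < j := by exact_mod_cast hj0
  have hp : 0 < (Real.pi * j) ^ (2 * α) := by positivity
  have e : (Real.pi * ((j + m : ℕ) : ℝ)) ^ (2 * α)
      = (1 + (m : ℝ) / j) ^ (2 * α) * (Real.pi * j) ^ (2 * α) := by
    rw [← Real.mul_rpow (by positivity) (by positivity)]
    congr 1
    push_cast; field_simp
  rw [e]
  calc 1 + (1 + (m : ℝ) / j) ^ (2 * α) * (Real.pi * j) ^ (2 * α)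
      = (((Real.pi * j) ^ (2 * α))⁻¹ + (1 + (m : ℝ) / j) ^ (2 * α)) * (Real.pi * j) ^ (2 * α) := by
        rw [add_mul, inv_mul_cancel₀ hp.ne']
    _ ≤ _ := mul_le_mul_of_nonneg_right hj1 hp.le

end Bandwidth

/-! ### Asymptotics for a fixed modulating polynomial -/

section Asymptotics

variable {D : ℕ} {p σ : ℝ → (Fin D → ℝ) → ℝ} {g : (Fin D → ℝ) → ℝ} {α Q : ℝ}

/-- `L` is taken large first to make 3b/L small, then `δ` small depending on `L`. Neither depends on
the sample size. -/
theorem exists_tail_parameters {a b ε : ℝ} (ha : 0 ≤ a) (hb : 0 ≤ b) (hε : 0 < ε) :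
    ∃ L > 0, ∃ δ > 0, a * δ + b * (L * δ + 3 / L) ≤ ε := by
  have hL : 0 < 6 * b / ε + 1 := by positivity
  refine ⟨6 * b / ε + 1, hL, ε / (2 * (a + b * (6 * b / ε + 1)) + 1), by positivity, ?_⟩
  set L := 6 * b / ε + 1 with hLdef
  have h1 : b * (3 / L) ≤ ε / 2 := by
    rw [← mul_div_assoc, div_le_iff₀ hL, hLdef]
    have : ε / 2 * (6 * b / ε + 1) = 3 * b + ε / 2 := by field_simp; ring
    rw [this]; linarith
  have h2 : (a + b * L) * (ε / (2 * (a + b * L) + 1)) ≤ ε / 2 := by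
    have : 0 ≤ b * L := by positivity
    rw [← mul_div_assoc, div_le_iff₀ (by positivity)]
    nlinarith
  nlinarith

/-- The held-back share b pays for two losses, the weight factor 1 + b/2 and the lower-order term
K^{2α}/n: (1 + b/2)(1 - b) + b²/2 = 1 - b/2. The remaining gap bQ/2 is left for Chebyshev. -/
theorem modulated_sobolev_sum_le (hα : 1 ≤ α) {n : ℕ} (hn : 0 < n) {κ I b : ℝ} (hκ0 : 0 < κ)
    (hI : 0 < I) (hQ : 0 < Q) (hb0 : 0 < b) {j₀ K : ℕ} (hj₀pos : 0 < j₀) (hj₀K : j₀ ≤ K)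
    (hKle : (K : ℝ) ≤ κ * bandwidth α n)
    (hκ : I * (Real.pi ^ (2 * α) * (κ ^ (2 * α + 1) * (α / ((α + 1) * (2 * α + 1)))))
      ≤ (1 - b) * Q)
    (hx : (1 + b / 2) * (I * (Real.pi ^ (2 * α) * κ ^ (2 * α))) / (b ^ 2 / 2 * Q) ≤ bandwidth α n) :
    I * ∑ j ∈ Finset.Ico j₀ K, priorVar α n K j₀ j * ((1 + b / 2) * (Real.pi * j) ^ (2 * α))
      ≤ (1 - b / 2) * Q := by
  have hn' : (0 : ℝ) < n := by exact_mod_cast hn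
  have hx0 := bandwidth_pos (α := α) hn
  have hx2α := bandwidth_rpow hα hn
  have hx2α1 := bandwidth_rpow_add_one hα n
  set x := bandwidth α n
  have h1 : ∑ j ∈ Finset.Ico j₀ K, priorVar α n K j₀ j * ((1 + b / 2) * (Real.pi * j) ^ (2 * α))
      = (1 + b / 2) * (Real.pi ^ (2 * α)
        * ∑ j ∈ Finset.Ico j₀ K, priorVar α n K j₀ j * (j : ℝ) ^ (2 * α)) := by
    rw [Finset.mul_sum, Finset.mul_sum]
    refine Finset.sum_congr rfl fun j _ => ?_
    rw [Real.mul_rpow Real.pi_pos.le (Nat.cast_nonneg j)]; ring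
  have h2 := sum_priorVar_mul_rpow_le (n := n) (by linarith : 0 ≤ α) hj₀pos hj₀K
  have h3 : (K : ℝ) ^ (2 * α + 1) ≤ κ ^ (2 * α + 1) * n := by
    rw [← hx2α1, ← Real.mul_rpow hκ0.le hx0.le]
    exact Real.rpow_le_rpow (Nat.cast_nonneg K) hKle (by linarith)
  have h4 : (K : ℝ) ^ (2 * α) ≤ κ ^ (2 * α) * (n / x) := by
    rw [← hx2α, ← Real.mul_rpow hκ0.le hx0.le]
    exact Real.rpow_le_rpow (Nat.cast_nonneg K) hKle (by linarith)
  have h5 : ((K : ℝ) ^ (2 * α + 1) * (α / ((α + 1) * (2 * α + 1))) + (K : ℝ) ^ (2 * α)) / n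
      ≤ κ ^ (2 * α + 1) * (α / ((α + 1) * (2 * α + 1))) + κ ^ (2 * α) / x := by
    rw [div_le_iff₀ hn']
    have h6 : (K : ℝ) ^ (2 * α + 1) * (α / ((α + 1) * (2 * α + 1)))
        ≤ κ ^ (2 * α + 1) * n * (α / ((α + 1) * (2 * α + 1))) :=
      mul_le_mul_of_nonneg_right h3 (by positivity)
    calc _ ≤ κ ^ (2 * α + 1) * n * (α / ((α + 1) * (2 * α + 1))) + κ ^ (2 * α) * (n / x) :=
          add_le_add h6 h4
      _ = _ := by ring
  have h7 : (1 + b / 2) * (I * (Real.pi ^ (2 * α) * κ ^ (2 * α))) / x ≤ b ^ 2 / 2 * Q := by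
    rw [div_le_iff₀ (by positivity)] at hx
    rw [div_le_iff₀ hx0]; linarith
  rw [h1]
  calc I * ((1 + b / 2) * (Real.pi ^ (2 * α)
        * ∑ j ∈ Finset.Ico j₀ K, priorVar α n K j₀ j * (j : ℝ) ^ (2 * α)))
      ≤ I * ((1 + b / 2) * (Real.pi ^ (2 * α)
        * (κ ^ (2 * α + 1) * (α / ((α + 1) * (2 * α + 1))) + κ ^ (2 * α) / x))) := by
        gcongr; exact h2.trans h5
    _ = (1 + b / 2) * (I * (Real.pi ^ (2 * α) * (κ ^ (2 * α + 1)
        * (α / ((α + 1) * (2 * α + 1))))))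
        + (1 + b / 2) * (I * (Real.pi ^ (2 * α) * κ ^ (2 * α))) / x := by ring
    _ ≤ (1 + b / 2) * ((1 - b) * Q) + b ^ 2 / 2 * Q := by gcongr
    _ ≤ (1 - b / 2) * Q := le_of_eq (by ring)
theorem cutoff_ge {η κ x m K j₀ : ℝ} (hη0 : 0 < η) (hκ0 : 0 < κ) (hK : κ * x - 1 ≤ K)
    (hj₀ : η * K ≤ j₀) (hx : 2 * (η + m + 1) / (η * κ) ≤ x) : η * κ / 2 * x + 1 + m ≤ j₀ := by
  rw [div_le_iff₀ (by positivity)] at hx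
  nlinarith [mul_le_mul_of_nonneg_left hK hη0.le]

theorem div_sq_le_mul {η κ x l : ℝ} (hη0 : 0 < η) (hκ0 : 0 < κ) (hx : 0 < x) (hl1 : 1 ≤ l)
    (hl : 2 / (η * κ) ≤ l) : x / l ^ 2 ≤ η * κ / 2 * x := by
  have h2 : 2 / (η * κ) ≤ l ^ 2 := by nlinarith
  rw [div_le_iff₀ (by positivity)] at h2 ⊢
  nlinarith

/-- The Lipschitz constant is at most a constant times x, and a spacing 1/n ≤ 1/x² makes the
interpolation error of order 1/x; a large logarithm absorbs the constant. Half of log n / x is spent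
here, half on grid values. -/
theorem grid_error_le {x n κ l T : ℝ} (hx : 1 ≤ x) (hxn : x ^ 3 ≤ n) (hn : 0 < n) (hκ : 0 < κ)
    (hQ : 0 ≤ Q) (hT : T ≤ (κ + 1) * x) (hl : 2 * √(2 * ((κ + 1) * Q)) ≤ l) :
    l / (2 * x) + √(2 * T * Q) / n ≤ x⁻¹ * l := by
  have hx0 : 0 < x := by linarith
  have h1 : √(2 * T * Q) ≤ √(2 * ((κ + 1) * Q)) * x := by
    have h0 : √(2 * ((κ + 1) * Q)) * x = √(2 * ((κ + 1) * Q) * x ^ 2) := by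
      rw [Real.sqrt_mul (x := 2 * ((κ + 1) * Q)) (by positivity), Real.sqrt_sq hx0.le]
    rw [h0]
    refine Real.sqrt_le_sqrt ?_
    have h2 : T * Q ≤ (κ + 1) * x * Q := mul_le_mul_of_nonneg_right hT hQ
    have h3 : (κ + 1) * x * Q ≤ (κ + 1) * x ^ 2 * Q := by
      gcongr; nlinarith
    linarith
  have h4 : x ^ 2 ≤ n := by nlinarith [mul_nonneg (sq_nonneg x) (sub_nonneg.2 hx)]
  have h5 : √(2 * T * Q) / n ≤ l / (2 * x) := by
    rw [div_le_div_iff₀ hn (by positivity)]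
    calc √(2 * T * Q) * (2 * x) ≤ √(2 * ((κ + 1) * Q)) * x * (2 * x) := by gcongr
      _ = 2 * √(2 * ((κ + 1) * Q)) * x ^ 2 := by ring
      _ ≤ l * n := mul_le_mul hl h4 (sq_nonneg x) (le_trans (by positivity) hl)
  have h6 : x⁻¹ * l = l / (2 * x) + l / (2 * x) := by field_simp; ring
  linarith

/-- The exponent equals -γ l² · n/x³, and n/x³ ≥ 1 exactly because α ≥ 1; with l = log n this beats
the number of grid points. -/
theorem gaussian_exponent_le {x n C e κ l : ℝ} (hx : 1 ≤ x) (hxn : x ^ 3 ≤ n) (hn : 0 < n)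
    (hC : 0 < C) (he : 0 < e) (hκ : 0 < κ) :
    -(l / (2 * x)) ^ 2 / (2 * (2 * C ^ 2 * (e * (κ + 1)) * x / n))
      ≤ -((16 * (C ^ 2 * e * (κ + 1)))⁻¹ * l ^ 2) := by
  have hx0 : 0 < x := by linarith
  have h1 : -(l / (2 * x)) ^ 2 / (2 * (2 * C ^ 2 * (e * (κ + 1)) * x / n))
      = -((16 * (C ^ 2 * e * (κ + 1)))⁻¹ * l ^ 2) * (n / x ^ 3) := by
    field_simp; ring
  have h2 : 1 ≤ n / x ^ 3 := by rwa [le_div_iff₀ (by positivity), one_mul]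
  have h3 : 0 ≤ (16 * (C ^ 2 * e * (κ + 1)))⁻¹ * l ^ 2 := by positivity
  rw [h1]
  nlinarith

theorem mul_sub_le_of_abs {x κ K c I ε : ℝ} (hK : K ≤ κ * x) (hK' : κ * x - 1 ≤ K) (hε : 0 < ε)
    (hx : 2 * (|c| + I) / ε ≤ x) : x * (κ * c - ε / 2) ≤ K * c - I := by
  rw [div_le_iff₀ hε] at hx
  have h1 : (κ * x - K) * c ≤ |c| :=
    calc (κ * x - K) * c ≤ (κ * x - K) * |c| :=
          mul_le_mul_of_nonneg_left (le_abs_self c) (by linarith)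
      _ ≤ 1 * |c| := mul_le_mul_of_nonneg_right (by linarith) (abs_nonneg c)
      _ = |c| := one_mul _
  nlinarith

theorem error_term_le {y a C e S L δ ε : ℝ} (hy : 0 ≤ y) (hL : 0 ≤ L) (hδ : 0 ≤ δ)
    (hS : S ≤ y * e) (h : 8 * a * δ + 2 * C ^ 2 * e * (L * δ + 3 / L) ≤ ε) :
    8 * (a * y) * δ + 2 * C ^ 2 * S * (L * δ + 3 / L) ≤ y * ε :=
  calc 8 * (a * y) * δ + 2 * C ^ 2 * S * (L * δ + 3 / L)
      ≤ 8 * (a * y) * δ + 2 * C ^ 2 * (y * e) * (L * δ + 3 / L) := by gcongr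
    _ = y * (8 * a * δ + 2 * C ^ 2 * e * (L * δ + 3 / L)) := by ring
    _ ≤ y * ε := by gcongr

theorem main_term_le {x n κ K J I C τ a η ε S₁ S₂ : ℝ} (hn : 0 < n) (hI : 0 ≤ I)
    (hτ : 0 ≤ τ) (hK : K ≤ κ * x) (hK' : κ * x - 1 ≤ K) (hε : 0 < ε)
    (hx : 2 * (|I * (a - η) - 2 * C ^ 2 * τ| + I) / ε ≤ x) (hJ : J ≤ η * K + 1)
    (hS₁ : (K * a - J) / n ≤ S₁) (hS₂ : S₂ ≤ K / n ^ 2) :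
    x / n * (κ * (I * (a - η) - 2 * C ^ 2 * τ) - ε / 2)
      ≤ I * S₁ - 2 * C ^ 2 * τ * n * S₂ :=
  calc x / n * (κ * (I * (a - η) - 2 * C ^ 2 * τ) - ε / 2)
      ≤ (K * (I * (a - η) - 2 * C ^ 2 * τ) - I) / n := by
        rw [div_mul_eq_mul_div]
        exact div_le_div_of_nonneg_right (mul_sub_le_of_abs hK hK' hε hx) hn.le
    _ ≤ (I * (K * a - J) - 2 * C ^ 2 * τ * K) / n := by
        refine div_le_div_of_nonneg_right ?_ hn.le
        linarith [mul_le_mul_of_nonneg_left hJ hI]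
    _ = I * ((K * a - J) / n) - 2 * C ^ 2 * τ * n * (K / n ^ 2) := by field_simp
    _ ≤ I * S₁ - 2 * C ^ 2 * τ * n * S₂ := by gcongr

set_option maxHeartbeats 400000 in
/-- The Bayes bound for a fixed modulating polynomial, at the scale `n^{-2α/(2α+1)}`. -/
theorem eventually_le_dealerMinimaxRisk (h : RegularDesign p σ) (hg : Measurable g) (f₀ : ℝ → ℝ)
    (hα : 1 ≤ α) (hQ : 0 < Q) {M : ℕ → ℕ}
    (hM : ∀ᶠ n : ℕ in atTop, (M n : ℝ) < (n : ℝ) ^ (1 / (2 * α + 1)) / Real.log n ^ 2)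
    {ρ : ℕ → ℝ≥0∞} (hρ : ∀ᶠ n : ℕ in atTop,
      ENNReal.ofReal ((n : ℝ) ^ (-1 / (2 * α + 1)) * Real.log n) < ρ n)
    {q : Polynomial ℝ} {C τ : ℝ} (hC1 : 1 ≤ C) (hC : ∀ x, |cosPoly q x| ≤ C)
    (hτ : ∫ y in Set.Icc (0 : ℝ) 1, max (designInfo p σ y * cosPoly q y ^ 2 - 1) 0 ≤ τ)
    (hD : 0 < ∫ x in (0 : ℝ)..1, cosPoly q x ^ 2) {b η κ : ℝ} (hb0 : 0 < b) (hb1 : b < 1)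
    (hη0 : 0 < η) (hη1 : η < 1) (hκ0 : 0 < κ)
    (hκ : (∫ x in (0 : ℝ)..1, cosPoly q x ^ 2) * (Real.pi ^ (2 * α) * (κ ^ (2 * α + 1)
      * (α / ((α + 1) * (2 * α + 1))))) ≤ (1 - b) * Q) {ε : ℝ} (hε : 0 < ε) :
    ∀ᶠ n : ℕ in atTop, ENNReal.ofReal (bandwidth α n / n *
        (κ * ((∫ x in (0 : ℝ)..1, cosPoly q x ^ 2) * (α / (α + 1) - η) - 2 * C ^ 2 * τ) - ε))
      ≤ dealerMinimaxRisk (pivotClass f₀ (ρ n) (M n) α Q) g p σ n := by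
  set I := ∫ x in (0 : ℝ)..1, cosPoly q x ^ 2 with hI
  set m := q.natDegree with hm
  set c' := I * (α / (α + 1) - η) - 2 * C ^ 2 * τ with hc'
  set e := η⁻¹ ^ α with he
  have he0 : 0 < e := by positivity
  have hC0 : 0 < C := by linarith
  set CR := Q * ((Real.pi * (η * κ / 2)) ^ (2 * α))⁻¹ with hCR
  have hCR0 : 0 < CR := by positivity
  -- Half of ε is for the bad event, half for rounding the cutoffs.
  obtain ⟨L, hL, δ, hδ, hLδ⟩ := exists_tail_parameters (a := 8 * CR) (b := 2 * C ^ 2 * (κ * e))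
    (ε := ε / 2) (by positivity) (by positivity) (by linarith)
  have hx := tendsto_bandwidth hα
  set A := (Real.pi * (κ + 1)) ^ (2 * α) with hA
  set B := 2 * (C ^ 2 * e) * ((1 - b / 2) * Q) / (Q - (1 - b / 2) * Q) ^ 2 with hB
  set γ := (16 * (C ^ 2 * e * (κ + 1)))⁻¹ with hγ
  have hγ0 : 0 < γ := by positivity
  obtain ⟨J, hJ⟩ := eventually_atTop.1
    (eventually_sobolevWeight_le hα m (b := 1 + b / 2) (by linarith))
  have hbad : ∀ᶠ n : ℕ in atTop, B * (1 / n + A * (1 / bandwidth α n))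
      + ((n : ℝ) + 1) * (2 * Real.exp (-(γ * Real.log n ^ 2))) ≤ δ := by
    have h1 : Tendsto (fun n : ℕ => B * (1 / (n : ℝ) + A * (1 / bandwidth α n))
        + ((n : ℝ) + 1) * (2 * Real.exp (-(γ * Real.log n ^ 2)))) atTop
        (𝓝 (B * (0 + A * 0) + 0)) :=
      (((tendsto_natCast_atTop_atTop.const_div_atTop 1).add
        ((hx.const_div_atTop 1).const_mul A)).const_mul B).add (tendsto_mul_exp_neg_log_sq hγ0)
    simp only [mul_zero, add_zero] at h1
    exact h1.eventually_le_const hδ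
  filter_upwards [hbad, hM, hρ, eventually_gt_atTop 0,
    hx.eventually_ge_atTop (2 * (η + m + 1) / (η * κ)), hx.eventually_ge_atTop (m : ℝ),
    hx.eventually_ge_atTop (2 * (η + J + 1) / (η * κ)),
    hx.eventually_ge_atTop (2 * (|c'| + I) / ε),
    hx.eventually_ge_atTop ((1 + b / 2) * (I * (Real.pi ^ (2 * α) * κ ^ (2 * α))) / (b ^ 2 / 2 * Q)),
    tendsto_log_natCast.eventually_ge_atTop (2 * √(2 * ((κ + 1) * Q))),
    tendsto_log_natCast.eventually_ge_atTop 1,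
    tendsto_log_natCast.eventually_ge_atTop (2 / (η * κ))]
    with n hbad hMn hρn hn hx1 hx2 hx3 hx4 hx5 hl1 hl2 hl3
  have hn' : (0 : ℝ) < n := by exact_mod_cast hn
  have hx0 := bandwidth_pos (α := α) hn
  have hxone := one_le_bandwidth hα hn
  have hx2α := bandwidth_rpow hα hn
  have hx2α1 := bandwidth_rpow_add_one hα n
  have hxcube := bandwidth_pow_three_le hα hn
  set x := bandwidth α n with hxdef
  have hMx : (M n : ℝ) < x / Real.log n ^ 2 := hMn
  have hxinv : (n : ℝ) ^ (-1 / (2 * α + 1)) = x⁻¹ := by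
    rw [hxdef, bandwidth, ← Real.rpow_neg hn'.le, neg_div]
  rw [hxinv] at hρn
  set K := ⌊κ * x⌋₊ with hK
  set j₀ := ⌈η * K⌉₊ with hj₀
  have hKle : (K : ℝ) ≤ κ * x := Nat.floor_le (by positivity)
  have hKge : κ * x - 1 ≤ K := (Nat.sub_one_lt_floor _).le
  have hj₀ge : η * K ≤ j₀ := Nat.le_ceil _
  have hj₀le : (j₀ : ℝ) ≤ η * K + 1 := (Nat.ceil_lt_add_one (by positivity)).le
  have hj₀K : j₀ ≤ K := Nat.ceil_le.2 (mul_le_of_le_one_left (Nat.cast_nonneg K) hη1.le)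
  have hlow : η * κ / 2 * x + 1 + m ≤ j₀ := cutoff_ge hη0 hκ0 hKge hj₀ge hx1
  have hηκx : 0 < η * κ / 2 * x := by positivity
  have hmj₀ : m < j₀ := by
    have : (m : ℝ) < j₀ := by linarith
    exact_mod_cast this
  have hj₀pos : 0 < j₀ := by omega
  have hsub : ((j₀ - m : ℕ) : ℝ) = j₀ - m := by rw [Nat.cast_sub hmj₀.le]
  have hk₀ : η * κ / 2 * x ≤ ((j₀ - m : ℕ) : ℝ) := by rw [hsub]; linarith
  have hMk₀ : M n ≤ j₀ - m := by
    -- The logarithmic gap in the assumption on `M` puts every prior frequency, shifted down by the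
    -- degree, at or above `M n`.
    have h1 : x / Real.log n ^ 2 ≤ η * κ / 2 * x := div_sq_le_mul hη0 hκ0 hx0 hl2 hl3
    have : (M n : ℝ) ≤ ((j₀ - m : ℕ) : ℝ) := by linarith
    exact_mod_cast this
  have hJj₀ : J ≤ j₀ := by
    have := cutoff_ge (m := J) hη0 hκ0 hKge hj₀ge hx3
    have : (J : ℝ) ≤ j₀ := by linarith
    exact_mod_cast this
  have hKm : (K : ℝ) + m ≤ (κ + 1) * x := by linarith
  have hsum : ∑ j ∈ Finset.Ico j₀ K, priorVar α n K j₀ j ≤ x / n * (κ * e) := by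
    calc ∑ j ∈ Finset.Ico j₀ K, priorVar α n K j₀ j
        ≤ ∑ j ∈ Finset.Ico j₀ K, e / n :=
          Finset.sum_le_sum fun j hj => priorVar_le (by linarith) hj₀pos hη0 hj₀ge hj
      _ = ((K - j₀ : ℕ) : ℝ) * (e / n) := by
          rw [Finset.sum_const, Nat.card_Ico, nsmul_eq_mul]
      _ ≤ (κ * x) * (e / n) := by
          refine mul_le_mul_of_nonneg_right (le_trans ?_ hKle) (by positivity)
          exact_mod_cast Nat.sub_le K j₀
      _ = x / n * (κ * e) := by ring
  have hsob := modulated_sobolev_sum_le hα hn hκ0 hD hQ hb0 hj₀pos hj₀K hKle hκ hx5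
  set t := Finset.Ico (j₀ - m) (K + m) with ht
  have htcard : (t.card : ℝ) ≤ (κ + 1) * x := by
    rw [ht, Nat.card_Ico]
    refine le_trans ?_ hKm
    exact_mod_cast Nat.sub_le _ _
  have hwt : ∀ k ∈ t, 1 + (Real.pi * k) ^ (2 * α) ≤ 1 + A * (n / x) := fun k hk => by
    have h1 : (k : ℝ) ≤ (κ + 1) * x := le_trans (by exact_mod_cast (Finset.mem_Ico.1 hk).2.le) hKm
    rw [hA, ← hx2α, ← Real.mul_rpow (by positivity) hx0.le, mul_assoc]
    gcongr
  have hWj : ∀ j ∈ Finset.Ico j₀ K, ∀ k ∈ Finset.Icc (j - m) (j + m),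
      1 + (Real.pi * k) ^ (2 * α) ≤ (1 + b / 2) * (Real.pi * j) ^ (2 * α) := fun j hj k hk => by
    refine le_trans ?_ (hJ j (hJj₀.trans (Finset.mem_Ico.1 hj).1))
    have h1 : (k : ℝ) ≤ ((j + m : ℕ) : ℝ) := by exact_mod_cast (Finset.mem_Icc.1 hk).2
    gcongr
  have hgrid : Real.log n / (2 * x) + √(2 * t.card * Q) / n ≤ x⁻¹ * Real.log n :=
    grid_error_le hxone hxcube hn' hκ0 hQ.le htcard hl1
  have hexp : 2 * (1 + A * (n / x)) * (C ^ 2 * (e / n)) * ((1 - b / 2) * Q)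
        / (Q - (1 - b / 2) * Q) ^ 2
      + ((n : ℝ) + 1) * (2 * Real.exp (-(Real.log n / (2 * x)) ^ 2
        / (2 * (2 * C ^ 2 * (e * (κ + 1)) * x / n)))) ≤ δ := by
    -- The largest weight is of order n/x and the largest variance of order 1/n, so the Chebyshev
    -- part is of order 1/x.
    refine le_trans (add_le_add (le_of_eq ?_) ?_) hbad
    · rw [hB]; field_simp
    · gcongr
      exact gaussian_exponent_le hxone hxcube hn' hC0 he0 hκ0
  have hR : Q / (1 + (Real.pi * ((j₀ - m : ℕ) : ℝ)) ^ (2 * α)) ≤ CR * (x / n) := by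
    have h1 : (Real.pi * (η * κ / 2)) ^ (2 * α) * (n / x)
        ≤ 1 + (Real.pi * ((j₀ - m : ℕ) : ℝ)) ^ (2 * α) := by
      rw [← hx2α, ← Real.mul_rpow (by positivity) hx0.le]
      refine le_add_of_nonneg_of_le zero_le_one
        (Real.rpow_le_rpow (by positivity) ?_ (by linarith))
      rw [mul_assoc]
      exact mul_le_mul_of_nonneg_left hk₀ Real.pi_pos.le
    calc Q / (1 + (Real.pi * ((j₀ - m : ℕ) : ℝ)) ^ (2 * α))
        ≤ Q / ((Real.pi * (η * κ / 2)) ^ (2 * α) * (n / x)) :=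
          div_le_div_of_nonneg_left hQ.le (by positivity) h1
      _ = CR * (x / n) := by rw [hCR]; field_simp
  have hmain := bayes_bound_le_dealerMinimaxRisk (s := Finset.Ico j₀ K) (t := t) (C := C)
    (lam := priorVar α n K j₀) (Λ := e / n) (k₀ := j₀ - m) (M := M n) (n := n) (ρ := ρ n)
    (wmax := 1 + A * (n / x)) (W := fun j => (1 + b / 2) * (Real.pi * j) ^ (2 * α))
    (m := (1 - b / 2) * Q) (N := n) (r := Real.log n / (2 * x))
    (v := 2 * C ^ 2 * (e * (κ + 1)) * x / n) (t₀ := x⁻¹ * Real.log n) (δ := δ)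
    (R := CR * (x / n)) (L := L) (τ := τ) (Q := Q) (α := α)
    h hg f₀ hα hC hτ (fun j hj => hmj₀.trans_le (Finset.mem_Ico.1 hj).1)
    (fun j hj k hk => by
      have h1 := Finset.mem_Ico.1 hj
      have h2 := Finset.mem_Icc.1 hk
      exact Finset.mem_Ico.2 ⟨by omega, by omega⟩)
    (priorVar_nonneg (by linarith) hj₀pos) (by positivity)
    (fun j hj => priorVar_le (by linarith) hj₀pos hη0 hj₀ge hj)
    (fun k hk => hMk₀.trans (Finset.mem_Ico.1 hk).1) (fun k hk => (Finset.mem_Ico.1 hk).1)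
    (by positivity) hwt (fun j _ => by positivity) hWj hsob (by linarith [mul_pos hb0 hQ]) hn (by positivity)
    (by positivity)
    (by
      rw [Nat.card_Ico]
      have h1 : ((K - j₀ : ℕ) : ℝ) ≤ (κ + 1) * x := by
        refine le_trans (le_trans ?_ hKle) (by linarith)
        exact_mod_cast Nat.sub_le _ _
      calc 2 * C ^ 2 * (e / n) * ((K - j₀ : ℕ) : ℝ)
          ≤ 2 * C ^ 2 * (e / n) * ((κ + 1) * x) := by gcongr
        _ = _ := by ring)
    hgrid hρn hexp hR hL
  have hτ0 : 0 ≤ τ := le_trans (integral_nonneg fun _ => le_max_right _ _) hτ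
  have hfirst := main_term_le (τ := τ) hn' hD.le hτ0 hKle hKge hε hx4 hj₀le
    (le_sum_priorVar_shrink (by linarith : 0 ≤ α) hn hj₀pos hj₀K)
    (sum_sq_priorVar_shrink_le (K := K) (by linarith : 0 ≤ α) hn hj₀pos)
  have hS₀ := Finset.sum_nonneg fun j (_ : j ∈ Finset.Ico j₀ K) =>
    priorVar_nonneg (α := α) (n := n) (K := K) (by linarith) hj₀pos j
  have herr := error_term_le (y := x / n) (by positivity) hL.le hδ.le hsum hLδ
  refine le_trans (ENNReal.ofReal_le_ofReal (le_trans (le_of_eq (by ring))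
    (sub_le_sub hfirst herr))) ?_
  rw [ENNReal.ofReal_sub _ (by positivity)]
  exact tsub_le_iff_right.2 hmain

end Asymptotics

/-! ### The sharp constant -/

section SharpConstant

variable {D : ℕ} {p σ : ℝ → (Fin D → ℝ) → ℝ} {g : (Fin D → ℝ) → ℝ} {α Q : ℝ}

/-- The relative deficit min(0, R/a - 1) is the natural remainder; when R is infinite or a vanishes,
remainder 0 works. This yields a bound at every n from eventual ones. -/
theorem exists_tendsto_zero_mul_le {a : ℕ → ℝ} (ha : ∀ n, 0 ≤ a n) {R : ℕ → ℝ≥0∞}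
    (h : ∀ ε > 0, ∀ᶠ n in atTop, ENNReal.ofReal (a n * (1 - ε)) ≤ R n) :
    ∃ o : ℕ → ℝ, Tendsto o atTop (𝓝 0) ∧ ∀ n, ENNReal.ofReal (a n * (1 + o n)) ≤ R n := by
  classical
  refine ⟨fun n => if R n = ⊤ ∨ a n = 0 then 0 else min 0 ((R n).toReal / a n - 1), ?_, ?_⟩
  · rw [Metric.tendsto_nhds]
    intro ε hε
    filter_upwards [h (ε / 2) (by positivity)] with n hn
    rw [Real.dist_eq, sub_zero]
    split_ifs with hc
    · simpa using hε
    · push Not at hc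
      have ha0 : 0 < a n := lt_of_le_of_ne (ha n) (Ne.symm hc.2)
      have h1 : 1 - ε / 2 ≤ (R n).toReal / a n := by
        rw [le_div_iff₀ ha0, mul_comm]
        exact (ENNReal.ofReal_le_iff_le_toReal hc.1).1 hn
      rw [abs_of_nonpos (min_le_left _ _)]
      have : -(ε / 2) ≤ min 0 ((R n).toReal / a n - 1) :=
        le_min (by linarith) (by linarith)
      linarith
  · intro n
    simp only
    split_ifs with hc
    · rcases hc with hc | hc
      · simp [hc]
      · simp [hc]
    · push Not at hc
      have ha0 : 0 < a n := lt_of_le_of_ne (ha n) (Ne.symm hc.2)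
      refine (ENNReal.ofReal_le_iff_le_toReal hc.1).2 ?_
      calc a n * (1 + min 0 ((R n).toReal / a n - 1))
          ≤ a n * (1 + ((R n).toReal / a n - 1)) := by
            gcongr; exact min_le_right _ _
        _ = (R n).toReal := by field_simp; ring

/-- The factor `κ` of the cutoff frequency `κ n^{1/(2α+1)}` of the prior, when the modulating
function has squared norm `I` and a share `b` of the Sobolev radius is held back. -/
def cutoffFactor (α Q b I : ℝ) : ℝ :=
  ((1 - b) * Q * ((α + 1) * (2 * α + 1)) / (I * Real.pi ^ (2 * α) * α)) ^ (1 / (2 * α + 1))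

theorem cutoffFactor_pos (hα : 1 ≤ α) (hQ : 0 < Q) {b I : ℝ} (hb : b < 1) (hI : 0 < I) :
    0 < cutoffFactor α Q b I := by
  have : 0 < 1 - b := by linarith
  have := Real.pi_pos
  unfold cutoffFactor
  positivity

theorem cutoffFactor_budget (hα : 1 ≤ α) (hQ : 0 < Q) {b I : ℝ} (hb : b < 1) (hI : 0 < I) :
    I * (Real.pi ^ (2 * α) * (cutoffFactor α Q b I ^ (2 * α + 1)
      * (α / ((α + 1) * (2 * α + 1))))) = (1 - b) * Q := by
  have h1 : 0 < 1 - b := by linarith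
  have := Real.pi_pos
  rw [cutoffFactor, ← Real.rpow_mul (by positivity), one_div_mul_cancel (by positivity),
    Real.rpow_one]
  field_simp

/-- With nothing held back, κ contributes I^{-1/(2α+1)}, which against the factor I leaves the power
2α/(2α+1); the rest is the Pinsker constant. -/
theorem cutoffFactor_zero_mul (hα : 1 ≤ α) (hQ : 0 < Q) {I : ℝ} (hI : 0 < I) :
    cutoffFactor α Q 0 I * (I * (α / (α + 1)))
      = pinskerConst α Q * I ^ (2 * α / (2 * α + 1)) := by
  have hπ := Real.pi_pos
  set y := I * (α / (α + 1)) with hy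
  have hy0 : 0 < y := by positivity
  have h1 : (1 - 0) * Q * ((α + 1) * (2 * α + 1)) / (I * Real.pi ^ (2 * α) * α)
      = Q * (2 * α + 1) / (y * Real.pi ^ (2 * α)) := by
    rw [hy]; field_simp; ring
  have h2 : (Real.pi ^ (2 * α)) ^ (1 / (2 * α + 1)) = Real.pi ^ (2 * α / (2 * α + 1)) := by
    rw [← Real.rpow_mul hπ.le, mul_one_div]
  have h3 : y ^ (1 / (2 * α + 1)) * y ^ (2 * α / (2 * α + 1)) = y := by
    rw [← Real.rpow_add hy0]
    conv_rhs => rw [← Real.rpow_one y]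
    congr 1
    field_simp; ring
  have h4 : (α / (Real.pi * (α + 1))) ^ (2 * α / (2 * α + 1)) * I ^ (2 * α / (2 * α + 1))
      = y ^ (2 * α / (2 * α + 1)) / Real.pi ^ (2 * α / (2 * α + 1)) := by
    rw [← Real.mul_rpow (by positivity) hI.le, ← Real.div_rpow hy0.le hπ.le]
    congr 1
    rw [hy]; field_simp
  rw [cutoffFactor, h1, Real.div_rpow (by positivity) (by positivity),
    Real.mul_rpow hy0.le (by positivity), h2, pinskerConst, mul_right_comm, h4]
  have h5 : 0 < y ^ (1 / (2 * α + 1)) := by positivity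
  have h6 : 0 < Real.pi ^ (2 * α / (2 * α + 1)) := by positivity
  rw [div_mul_eq_mul_div, div_mul_eq_mul_div, div_eq_div_iff (by positivity) h6.ne']
  conv_lhs => rw [← h3]
  ring

/-- The first coordinate plays the roles of b, η and τ at once, the second that of ∫u². The bound
`C` must not depend on them, which `RegularDesign.exists_cosPoly` ensures. -/
theorem continuousAt_bayesConst (hα : 1 ≤ α) (Q C : ℝ) {d : ℝ} (hd : 0 < d) :
    ContinuousAt (fun v : ℝ × ℝ =>
      cutoffFactor α Q v.1 v.2 * (v.2 * (α / (α + 1) - v.1) - 2 * C ^ 2 * v.1)) (0, d) := by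
  have hπ := Real.pi_pos
  refine ContinuousAt.mul ?_ (by fun_prop)
  unfold cutoffFactor
  refine ContinuousAt.rpow_const ?_ (Or.inr (by positivity))
  refine ContinuousAt.div (by fun_prop) (by fun_prop) ?_
  positivity

theorem bandwidth_div_mul_rpow {d : ℝ} (hd : 0 ≤ d) (hα : 1 ≤ α) {n : ℕ} (hn : 0 < n) :
    (d / n) ^ (2 * α / (2 * α + 1)) = bandwidth α n / n * d ^ (2 * α / (2 * α + 1)) := by
  have hn' : (0 : ℝ) < n := by exact_mod_cast hn
  have h1 : (n : ℝ) ^ (2 * α / (2 * α + 1)) = n / bandwidth α n := by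
    rw [← bandwidth_rpow hα hn, bandwidth, ← Real.rpow_mul hn'.le, one_div_mul_eq_div]
  rw [Real.div_rpow hd hn'.le, h1]
  have := bandwidth_pos (α := α) hn
  field_simp

theorem pinskerConst_pos (hα : 1 ≤ α) (hQ : 0 < Q) : 0 < pinskerConst α Q := by
  have hπ := Real.pi_pos
  unfold pinskerConst
  positivity

theorem eventually_pinsker_le_dealerMinimaxRisk (h : RegularDesign p σ) (hg : Measurable g)
    (f₀ : ℝ → ℝ) (hα : 1 ≤ α) (hQ : 0 < Q) {M : ℕ → ℕ}
    (hM : ∀ᶠ n : ℕ in atTop, (M n : ℝ) < (n : ℝ) ^ (1 / (2 * α + 1)) / Real.log n ^ 2)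
    {ρ : ℕ → ℝ≥0∞} (hρ : ∀ᶠ n : ℕ in atTop,
      ENNReal.ofReal ((n : ℝ) ^ (-1 / (2 * α + 1)) * Real.log n) < ρ n) {ε : ℝ} (hε : 0 < ε) :
    ∀ᶠ n : ℕ in atTop, ENNReal.ofReal (pinskerConst α Q *
        (difficulty p σ / n) ^ (2 * α / (2 * α + 1)) * (1 - ε))
      ≤ dealerMinimaxRisk (pivotClass f₀ (ρ n) (M n) α Q) g p σ n := by
  obtain ⟨C, hC1, hq⟩ := h.exists_cosPoly
  have hd := h.difficulty_pos
  set d := difficulty p σ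
  set a := pinskerConst α Q * d ^ (2 * α / (2 * α + 1)) with ha
  have ha0 : 0 < a := mul_pos (pinskerConst_pos hα hQ) (by positivity)
  have hcont := (continuousAt_bayesConst hα Q C hd).tendsto
  simp only [sub_zero, mul_zero] at hcont
  rw [cutoffFactor_zero_mul hα hQ hd, ← ha] at hcont
  have hlt : a * (1 - ε / 2) < a := by nlinarith
  obtain ⟨r, hr, hball⟩ := Metric.eventually_nhds_iff_ball.1 (hcont.eventually_const_lt hlt)
  -- Below r for the continuity bound, below 1 for admissible b and η, below d so that ∫u² > 0.
  set τ := min r (min 1 d) / 2 with hτdef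
  have hτ0 : 0 < τ := by positivity
  have hτr : τ < r := by
    have : min r (min 1 d) ≤ r := min_le_left _ _
    linarith
  have hτ1 : τ < 1 := by
    have : min r (min 1 d) ≤ 1 := (min_le_right _ _).trans (min_le_left _ _)
    linarith
  have hτd : τ < d := by
    have : min r (min 1 d) ≤ d := (min_le_right _ _).trans (min_le_right _ _)
    linarith
  obtain ⟨q, hqC, hqτ, hqI⟩ := hq τ hτ0
  have hI : 0 < ∫ x in (0 : ℝ)..1, cosPoly q x ^ 2 := by
    have := (abs_le.1 hqI).1
    linarith
  have hmem : (τ, ∫ x in (0 : ℝ)..1, cosPoly q x ^ 2) ∈ Metric.ball ((0 : ℝ), d) r := by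
    rw [Metric.mem_ball, Prod.dist_eq]
    refine max_lt ?_ ?_
    · simpa [Real.dist_eq, abs_of_pos hτ0] using hτr
    · rw [Real.dist_eq]; exact hqI.trans_lt hτr
  have hconst := hball _ hmem
  simp only at hconst
  filter_upwards [eventually_le_dealerMinimaxRisk h hg f₀ hα hQ hM hρ hC1 hqC hqτ hI hτ0 hτ1 hτ0
    hτ1 (cutoffFactor_pos hα hQ hτ1 hI) (cutoffFactor_budget hα hQ hτ1 hI).le
    (ε := a * (ε / 2)) (by positivity), eventually_gt_atTop 0] with n hn hn0
  refine le_trans (ENNReal.ofReal_le_ofReal ?_) hn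
  have hy : 0 ≤ bandwidth α n / n := div_nonneg (bandwidth_pos hn0).le (Nat.cast_nonneg n)
  calc pinskerConst α Q * (d / n) ^ (2 * α / (2 * α + 1)) * (1 - ε)
      = bandwidth α n / n * (a * (1 - ε / 2) - a * (ε / 2)) := by
        rw [bandwidth_div_mul_rpow hd.le hα hn0, ha]; ring
    _ ≤ _ := mul_le_mul_of_nonneg_left (sub_le_sub_right hconst.le _) hy

end SharpConstant

end ScaleRegression

end

theorem theorem2p1 {D : ℕ} (p σ : ℝ → (Fin D → ℝ) → ℝ) (hpσ : ScaleRegression.RegularDesign p σ)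
    (g : (Fin D → ℝ) → ℝ) (hg : Measurable g)
    (α Q : ℝ) (hα : 1 ≤ α) (hQ : 0 ≤ Q)
    (f₀ : ℝ → ℝ) (hf₀_bdd : ∃ C : ℝ, ∀ x ∈ Set.Icc (0 : ℝ) 1, |f₀ x| ≤ C)
    (hf₀_L2 : MemLp f₀ 2 (volume.restrict (Set.Icc (0 : ℝ) 1)))
    (M : ℕ → ℕ)
    (hM : ∀ᶠ n : ℕ in atTop, (M n : ℝ) < (n : ℝ) ^ (1 / (2 * α + 1)) / Real.log n ^ 2)
    (ρ : ℕ → ℝ≥0∞)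
    (hρ : ∀ᶠ n : ℕ in atTop,
      ENNReal.ofReal ((n : ℝ) ^ (-1 / (2 * α + 1)) * Real.log n) < ρ n) :
    ∃ o : ℕ → ℝ, Tendsto o atTop (𝓝 0) ∧ ∀ n : ℕ,
      ENNReal.ofReal
          (ScaleRegression.pinskerConst α Q *
            (ScaleRegression.difficulty p σ / n) ^ (2 * α / (2 * α + 1)) * (1 + o n)) ≤
        ScaleRegression.dealerMinimaxRisk
          (ScaleRegression.pivotClass f₀ (ρ n) (M n) α Q) g p σ n := by
  have hd := hpσ.difficulty_pos
  have hπ := Real.pi_pos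
  refine ScaleRegression.exists_tendsto_zero_mul_le (fun n => ?_) fun ε hε => ?_
  · unfold ScaleRegression.pinskerConst
    positivity
  -- For `Q = 0` the Pinsker constant contains 0 to a positive power and vanishes, so the bound is
  -- trivial.
  · rcases hQ.eq_or_lt with rfl | hQ'
    · refine Eventually.of_forall fun n => ?_
      have h0 : ScaleRegression.pinskerConst α 0 = 0 := by
        rw [ScaleRegression.pinskerConst, zero_mul, Real.zero_rpow (by positivity), mul_zero]
      simp [h0]
    · exact ScaleRegression.eventually_pinsker_le_dealerMinimaxRisk hpσ hg f₀ hα hQ' hM hρ hε
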